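/- **Setting.** Let $\Sigma$ be a finite hypergraph (finite sets of wires $W(\Sigma)$ and boxes $B(\Sigma)$, with $\mathrm{dom},\mathrm{cod}:B(\Sigma)\to W(\Sigma)^*$). A morphism $(n,\sigma)\to(m,\sigma')$ of the free Markov category $\mathbf{FreeMarkov}_\Sigma$ is an isomorphism class of cospans $\underline n\xrightarrow{p}G\xleftarrow{q}\underline m$ of finite hypergraphs over $\Sigma$, with labelling $\tau:G\to\Sigma$, such that $G$ is acyclic, every wire of $G$ has exactly one starting place (an input of the diagram or an output position of a box), and every box has an output wire that is an output of the diagram or an input of a box. Composition is gluing along the shared wires followed by deleting discarded boxes until none is left. A *generalized causal model* is such a morphism $\varphi$ with $q$ injective. For $b\in B(\Sigma)$, $\langle b\rangle$ denotes the diagram consisting of the single box $b$ (with discarded boxes deleted). Let $\mathcal M$ be a Markov category of measurable spaces and Markov kernels, with $\otimes$ the product of measurable spaces (regarded as strict), containing all standard Borel spaces and all Markov kernels between them. Standard Borel spaces $R$ obtained as finite products and coproducts of countable spaces and of spaces identified with some $\mathbb R^n$ (where every uncountable standard Borel space may be identified with $\mathbb R$) carry the base measure $\mu_R$ formed from counting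 and Lebesgue measures by taking product measures and sums of measures. A *joint density kernel* from $Z$ to $X$ is a triple $([R,k],f)$ of such a space $R$ (the *residual*), a deterministic morphism $k:R\otimes Z\to X$ of $\mathcal M$, and a Markov kernel $f:Z\to R$ of $\mathcal M$ with $f(z)\ll\mu_R$ for all $z\in Z$. It denotes the kernel $[\![([R,k],f)]\!]:Z\to X$ that draws $r$ from $f(z)$ and then applies $k$ to $(r,z)$. The morphisms of $\mathbf{dJoint}(\mathcal M)$ are the joint density kernels, two being identified when they denote the same kernel; kernels compose by composing mechanisms and drawing the second residual conditionally on the output of the first, and $\otimes$ pairs mechanisms and noises. A *density* of $f:Z\to R$ is a jointly measurable $p(\cdot\mid\cdot):R\times Z\to[0,\infty]$ with $f(z)(A)=\int_A p(r\mid z)\,\mu_R(dr)$ for all $z\in Z$ and measurable $A\subseteq R$. **Theorem (joint density kernels admit factorized densities).** Let $F:\mathbf{FreeMarkov}_\Sigma\to\mathbf{dJoint}(\mathcal M)$ be a strict Markov functor. 1. For every generalized causal model $\varphi$ and every joint density kernel $([R,k],f)$ representing $F(\varphi)$, the kernel $f:F(\mathrm{dom}\,\varphi)\to R$ has a density. 2.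 For every $b\in B(\Sigma)$ let $([R_b,k_b],f_b)$ represent $F(\langle b\rangle)$. Every $f_b$ has a density. Let $p_b$ be any density of $f_b$, for every $b$. Then for every generalized causal model $\varphi$, with hypergraph $G$ and labelling $\tau$, there is a deterministic morphism of $\mathcal M$ $$K:\ \Big(\bigotimes_{c\in B(G)}R_{\tau(c)}\Big)\otimes F(\mathrm{dom}\,\varphi)\longrightarrow\bigotimes_{w\in W(G)}F(\tau(w))$$ which computes the values of all wires: its input wires carry the inputs of $\varphi$, and for every box $c$ of $G$ its marginal on the output wires of $c$ is $k_{\tau(c)}$ applied to the residual $r_c$ and to its marginal on the input wires of $c$. Moreover $F(\varphi)$ is represented by a joint density kernel $\big(\big[\bigotimes_{c}R_{\tau(c)},k\big],f\big)$ where $k$ is the marginal of $K$ on the output wires of $\varphi$ and $f$ has, with respect to the product base measure, the density $$p\big((r_c)_{c\in B(G)}\,\big|\,z\big)=\prod_{c\in B(G)}\int p_{\tau(c)}\big(r_c\,\big|\,v_{\mathrm{dom}(c)}\big)\,K\big((r,z),dv\big).$$ In particular, if $K((r,z),\cdot)$ is the point mass at the wire values $v(r,z)$, this is the product $\prod_c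 p_{\tau(c)}\big(r_c\mid v(r,z)_{\mathrm{dom}(c)}\big)$ of the densities of the individual boxes. -/

import Mathlib

open MeasureTheory ProbabilityTheory
open scoped ENNReal

universe u

namespace JointDensity

/-! ### Standard Borel spaces with their base measures -/

/-- A standard Borel space presented as a finite product or coproduct of basic ones.
The constructor `euclidean n X e` covers `ℝⁿ` itself (`e` the identity) and, for `n = 1`, every
other uncountable standard Borel space, which counts as `ℝ` through a measurable isomorphism `e`. -/
inductive SbsPres : Type (u + 1)
  | countable (X : Type u) [MeasurableSpace X] [StandardBorelSpace X] [Countable X] : SbsPres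
  | euclidean (n : ℕ) (X : Type u) [MeasurableSpace X] (e : X ≃ᵐ (Fin n → ℝ)) : SbsPres
  | prod (P Q : SbsPres) : SbsPres
  | sum (P Q : SbsPres) : SbsPres
  | pi (ι : Type) [Fintype ι] (P : ι → SbsPres) : SbsPres

namespace SbsPres

/-- The underlying set of a presented standard Borel space. -/
def carrier : SbsPres.{u} → Type u
  | countable X => X
  | euclidean _ X _ => X
  | prod P Q => P.carrier × Q.carrier
  | sum P Q => P.carrier ⊕ Q.carrier
  | pi _ P => ∀ i, (P i).carrier

/-- The σ-algebra of a presented standard Borel space. -/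
@[reducible] def ms : (P : SbsPres.{u}) → MeasurableSpace P.carrier
  | @countable _ m _ _ => m
  | @euclidean _ _ m _ => m
  | prod P Q => @Prod.instMeasurableSpace _ _ P.ms Q.ms
  | sum P Q => @Sum.instMeasurableSpace _ _ P.ms Q.ms
  | pi _ P => @MeasurableSpace.pi _ _ fun i => (P i).ms

instance (P : SbsPres.{u}) : MeasurableSpace P.carrier := P.ms

/-- The base measure: counting measure on countable spaces, Lebesgue measure on `ℝⁿ`, product
measures on products, and sums of measures on coproducts. -/
noncomputable def base : (P : SbsPres.{u}) → Measure P.carrier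
  | @countable X m _ _ => @Measure.count X m
  | @euclidean _ _ _ e => Measure.map e.symm volume
  | prod P Q => P.base.prod Q.base
  | sum P Q => Measure.map Sum.inl P.base + Measure.map Sum.inr Q.base
  | pi _ P => Measure.pi fun i => (P i).base

theorem standardBorel_of_equiv {X Y : Type*} [MeasurableSpace X]
    [MeasurableSpace Y] [StandardBorelSpace Y] (e : X ≃ᵐ Y) : StandardBorelSpace X := by
  let _ := upgradeStandardBorel Y
  let _ : TopologicalSpace X := TopologicalSpace.induced e inferInstance
  have hind : Topology.IsInducing e := ⟨rfl⟩
  let h : X ≃ₜ Y := e.toEquiv.toHomeomorphOfIsInducing hind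
  have : PolishSpace X := h.isClosedEmbedding.polishSpace
  refine ⟨⟨inferInstance, ⟨?_⟩, inferInstance⟩⟩
  have h1 := e.measurableEmbedding.comap_eq
  exact h1.symm.trans ((congrArg (MeasurableSpace.comap (⇑e))
    (eq_borel_upgradeStandardBorel Y)).trans (borel_comap.symm))

theorem standardBorel_sum {X Y : Type*} [MeasurableSpace X]
    [MeasurableSpace Y] [StandardBorelSpace X] [StandardBorelSpace Y] :
    StandardBorelSpace (X ⊕ Y) := by
  let _ := upgradeStandardBorel X
  let _ := upgradeStandardBorel Y
  refine ⟨⟨inferInstance, ⟨?_⟩, inferInstance⟩⟩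
  apply le_antisymm
  · intro s hs
    have h1 : MeasurableSet (Sum.inl ⁻¹' s : Set X) := measurable_inl hs
    have h2 : MeasurableSet (Sum.inr ⁻¹' s : Set Y) := measurable_inr hs
    let _ : MeasurableSpace (X ⊕ Y) := borel _
    have : BorelSpace (X ⊕ Y) := ⟨rfl⟩
    have e1 := (Topology.IsOpenEmbedding.inl (X := X) (Y := Y)).measurableEmbedding.measurableSet_image.2 h1
    have e2 := (Topology.IsOpenEmbedding.inr (X := X) (Y := Y)).measurableEmbedding.measurableSet_image.2 h2
    have : s = Sum.inl '' (Sum.inl ⁻¹' s : Set X) ∪ Sum.inr '' (Sum.inr ⁻¹' s : Set Y) := by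
      ext x; cases x <;> simp
    rw [this]
    exact e1.union e2
  · refine MeasurableSpace.generateFrom_le fun s hs => ?_
    have hs' := isOpen_sum_iff.1 (show IsOpen s from hs)
    exact measurableSet_sum_iff.2 ⟨hs'.1.measurableSet, hs'.2.measurableSet⟩

instance standardBorel : (P : SbsPres.{u}) → StandardBorelSpace P.carrier
  | @countable _ _ h _ => h
  | @euclidean n _ _ e => standardBorel_of_equiv e
  | prod P Q => by
      have := standardBorel P; have := standardBorel Q
      exact inferInstanceAs (StandardBorelSpace (P.carrier × Q.carrier))
  | sum P Q => by
      have := standardBorel P; have := standardBorel Q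
      exact standardBorel_sum (X := P.carrier) (Y := Q.carrier)
  | pi ι P => by
      have := fun i => standardBorel (P i)
      exact inferInstanceAs (StandardBorelSpace (∀ i, (P i).carrier))

instance sigmaFinite_base : (P : SbsPres.{u}) → SigmaFinite P.base
  | @countable X _ _ _ => inferInstanceAs (SigmaFinite (Measure.count : Measure X))
  | @euclidean n X _ e => e.symm.sigmaFinite_map
  | prod P Q => by
      have := sigmaFinite_base P; have := sigmaFinite_base Q
      exact inferInstanceAs (SigmaFinite (P.base.prod Q.base))
  | sum P Q => by
      have := sigmaFinite_base P; have := sigmaFinite_base Q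
      have h1 : SigmaFinite (Measure.map (Sum.inl : P.carrier → P.carrier ⊕ Q.carrier) P.base) :=
        (⟨Sum.inl_injective, measurable_inl, fun _ h => measurableSet_inl_image.2 h⟩ :
          MeasurableEmbedding (Sum.inl : P.carrier → P.carrier ⊕ Q.carrier)).sigmaFinite_map
      have h2 : SigmaFinite (Measure.map (Sum.inr : Q.carrier → P.carrier ⊕ Q.carrier) Q.base) :=
        (⟨Sum.inr_injective, measurable_inr, fun _ h => measurableSet_inr_image.2 h⟩ :
          MeasurableEmbedding (Sum.inr : Q.carrier → P.carrier ⊕ Q.carrier)).sigmaFinite_map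
      exact inferInstanceAs (SigmaFinite
        (Measure.map (Sum.inl : P.carrier → P.carrier ⊕ Q.carrier) P.base +
          Measure.map (Sum.inr : Q.carrier → P.carrier ⊕ Q.carrier) Q.base))
  | pi ι P => by
      have := fun i => sigmaFinite_base (P i)
      exact inferInstanceAs (SigmaFinite (Measure.pi fun i => (P i).base))

end SbsPres

/-! ### Markov categories of Markov kernels containing all standard Borel spaces -/

/-- A Markov category `M` of measurable spaces and Markov kernels with `BorelStoch ⊆ M`: a class of
measurable spaces and a class of Markov kernels between them, containing the identities, copy and
delete maps and marginalisations, closed under composition and products, and containing all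
standard Borel spaces and all Markov kernels between them. (Symmetries, associators and unitors are
composites of copies, projections and products.) Finite tensor products are realised by `X × Y` and
by the unbiased products `∀ i, X i`, whose deterministic structure maps are in `M`. -/
structure KernelCat where
  Obj : (X : Type u) → [MeasurableSpace X] → Prop
  Hom : {X Y : Type u} → [MeasurableSpace X] → [MeasurableSpace Y] → Kernel X Y → Prop
  hom_markov : ∀ {X Y : Type u} [MeasurableSpace X] [MeasurableSpace Y] {κ : Kernel X Y},
    Hom κ → IsMarkovKernel κ
  hom_obj : ∀ {X Y : Type u} [MeasurableSpace X] [MeasurableSpace Y] {κ : Kernel X Y},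
    Hom κ → Obj X ∧ Obj Y
  obj_borel : ∀ (X : Type u) [MeasurableSpace X] [StandardBorelSpace X], Obj X
  hom_borel : ∀ {X Y : Type u} [MeasurableSpace X] [MeasurableSpace Y] [StandardBorelSpace X]
    [StandardBorelSpace Y] (κ : Kernel X Y) [IsMarkovKernel κ], Hom κ
  obj_prod : ∀ {X Y : Type u} [MeasurableSpace X] [MeasurableSpace Y],
    Obj X → Obj Y → Obj (X × Y)
  obj_pi : ∀ {ι : Type} [Finite ι] {X : ι → Type u} [∀ i, MeasurableSpace (X i)],
    (∀ i, Obj (X i)) → Obj (∀ i, X i)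
  hom_id : ∀ {X : Type u} [MeasurableSpace X], Obj X → Hom (Kernel.id : Kernel X X)
  hom_comp : ∀ {X Y Z : Type u} [MeasurableSpace X] [MeasurableSpace Y] [MeasurableSpace Z]
    {κ : Kernel X Y} {η : Kernel Y Z}, Hom κ → Hom η → Hom (η ∘ₖ κ)
  hom_parallel : ∀ {X Y X' Y' : Type u} [MeasurableSpace X] [MeasurableSpace Y]
    [MeasurableSpace X'] [MeasurableSpace Y'] {κ : Kernel X Y} {η : Kernel X' Y'},
    Hom κ → Hom η → Hom (κ ∥ₖ η)
  hom_copy : ∀ {X : Type u} [MeasurableSpace X], Obj X → Hom (Kernel.copy X)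
  hom_discard : ∀ {X : Type u} [MeasurableSpace X], Obj X →
    Hom (Kernel.discard X : Kernel X PUnit.{u + 1})
  hom_fst : ∀ {X Y : Type u} [MeasurableSpace X] [MeasurableSpace Y], Obj X → Obj Y →
    Hom (Kernel.deterministic (Prod.fst : X × Y → X) measurable_fst)
  hom_snd : ∀ {X Y : Type u} [MeasurableSpace X] [MeasurableSpace Y], Obj X → Obj Y →
    Hom (Kernel.deterministic (Prod.snd : X × Y → Y) measurable_snd)
  hom_eval : ∀ {ι : Type} [Finite ι] {X : ι → Type u} [∀ i, MeasurableSpace (X i)],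
    (∀ i, Obj (X i)) → ∀ i,
      Hom (Kernel.deterministic (fun x : ∀ i, X i => x i) (measurable_pi_apply i))
  hom_tuple : ∀ {ι : Type} [Finite ι] {Z : Type u} [MeasurableSpace Z] {X : ι → Type u}
    [∀ i, MeasurableSpace (X i)] {g : ∀ i, Z → X i} (hg : ∀ i, Measurable (g i)),
    Obj Z → (∀ i, Hom (Kernel.deterministic (g i) (hg i))) →
      Hom (Kernel.deterministic (fun z i => g i z) (measurable_pi_lambda _ hg))

namespace KernelCat

variable {M : KernelCat.{u}} {X Y Z : Type u} [MeasurableSpace X] [MeasurableSpace Y]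
  [MeasurableSpace Z]

/-- The objects of `M`, bundled. -/
structure Ob (M : KernelCat.{u}) where
  carrier : Type u
  [meas : MeasurableSpace carrier]
  obj : M.Obj carrier

attribute [instance] Ob.meas

theorem hom_prod {κ : Kernel Z X} {η : Kernel Z Y} (hκ : M.Hom κ) (hη : M.Hom η) :
    M.Hom (κ ×ₖ η) := by
  rw [← Kernel.parallelComp_comp_copy]
  exact M.hom_comp (M.hom_copy (M.hom_obj hκ).1) (M.hom_parallel hκ hη)

theorem hom_det_comp {f : X → Y} {g : Y → Z} {hf : Measurable f} {hg : Measurable g}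
    (h1 : M.Hom (Kernel.deterministic f hf)) (h2 : M.Hom (Kernel.deterministic g hg)) :
    M.Hom (Kernel.deterministic (fun x => g (f x)) (hg.comp hf)) := by
  have := M.hom_comp h1 h2
  rwa [Kernel.deterministic_comp_deterministic] at this

theorem hom_det_pair {f : Z → X} {g : Z → Y} {hf : Measurable f} {hg : Measurable g}
    (h1 : M.Hom (Kernel.deterministic f hf)) (h2 : M.Hom (Kernel.deterministic g hg)) :
    M.Hom (Kernel.deterministic (fun z => (f z, g z)) (hf.prodMk hg)) := by
  have := hom_prod h1 h2
  rwa [Kernel.deterministic_prod_deterministic] at this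

end KernelCat

/-! ### Joint density kernels -/

section Deterministic

variable {X Y Z W : Type*} [MeasurableSpace X] [MeasurableSpace Y] [MeasurableSpace Z]
  [MeasurableSpace W]

theorem isDeterministic_det {f : X → Y} (hf : Measurable f) :
    IsDeterministic (Kernel.deterministic f hf) := inferInstance

theorem isDeterministic_comp {κ : Kernel X Y} {η : Kernel Y Z} [IsMarkovKernel κ]
    [IsMarkovKernel η] (hκ : IsDeterministic κ) (hη : IsDeterministic η) :
    IsDeterministic (η ∘ₖ κ) := by
  refine ⟨?_⟩
  rw [← Kernel.parallelComp_comp_parallelComp, Kernel.comp_assoc,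
    hκ.parallelComp_self_comp_copy', ← Kernel.comp_assoc, hη.parallelComp_self_comp_copy',
    Kernel.comp_assoc]

theorem isDeterministic_parallel {κ : Kernel X Y} {η : Kernel Z W} [IsMarkovKernel κ]
    [IsMarkovKernel η] (hκ : IsDeterministic κ) (hη : IsDeterministic η) :
    IsDeterministic (κ ∥ₖ η) := by
  rw [Kernel.isDeterministic_iff_isZeroOneMeasure] at *
  rintro ⟨x, z⟩
  refine ⟨fun s hs => ?_⟩
  rw [Kernel.parallelComp_apply, Measure.prod_apply hs]
  have h1 : (fun y => (η z) (Prod.mk y ⁻¹' s)) =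
      Set.indicator {y | η z (Prod.mk y ⁻¹' s) = 1} 1 := by
    funext y
    by_cases h : (η z) (Prod.mk y ⁻¹' s) = 1
    · simp [h]
    · have := (hη z).zero_one₀ (measurable_prodMk_left (x := y) hs)
      simp_all
  have hm : MeasurableSet {y | η z (Prod.mk y ⁻¹' s) = 1} :=
    measurable_measure_prodMk_left hs (measurableSet_singleton 1)
  rw [h1, lintegral_indicator_one hm]
  exact (hκ x).zero_one₀ hm

theorem isDeterministic_prod {κ : Kernel Z X} {η : Kernel Z Y} [IsMarkovKernel κ]
    [IsMarkovKernel η] (hκ : IsDeterministic κ) (hη : IsDeterministic η) :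
    IsDeterministic (κ ×ₖ η) := by
  rw [← Kernel.parallelComp_comp_copy]
  exact isDeterministic_comp inferInstance (isDeterministic_parallel hκ hη)

theorem isDeterministic_lintegral {κ : Kernel Z X} [IsMarkovKernel κ]
    (hκ : IsDeterministic κ) (z : Z) {g : X × X → ℝ≥0∞} (hg : Measurable g) :
    ∫⁻ x, ∫⁻ x', g (x, x') ∂κ z ∂κ z = ∫⁻ x, g (x, x) ∂κ z := by
  have h := congrArg (fun κ' => ∫⁻ y, g y ∂(κ' z)) hκ.parallelComp_self_comp_copy'
  simp only [Kernel.parallelComp_comp_copy] at h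
  rw [Kernel.lintegral_prod _ _ _ hg, Kernel.lintegral_comp _ _ _ hg] at h
  rw [h]
  refine lintegral_congr fun x => ?_
  rw [Kernel.copy_apply, lintegral_dirac' _ hg]

theorem lintegral_compF (κ : Kernel Z X) (η : Kernel (X × Z) Y) [IsMarkovKernel κ]
    [IsMarkovKernel η] (z : Z) {g : X × Y → ℝ≥0∞} (hg : Measurable g) :
    ∫⁻ w, g w ∂((Kernel.deterministic Prod.fst measurable_fst ×ₖ η) ∘ₖ (κ ×ₖ Kernel.id)) z =
      ∫⁻ x, ∫⁻ y, g (x, y) ∂η (x, z) ∂κ z := by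
  have h1 : Measurable fun v : X × Z => ∫⁻ y, g (v.1, y) ∂η v :=
    Measurable.lintegral_kernel_prod_right (f := fun (v : X × Z) y => g (v.1, y))
      (hg.comp ((measurable_fst.comp measurable_fst).prodMk measurable_snd))
  have h2 : ∀ v : X × Z, ∫⁻ w, g w ∂(Kernel.deterministic Prod.fst measurable_fst ×ₖ η) v =
      ∫⁻ y, g (v.1, y) ∂η v := by
    intro v
    rw [Kernel.lintegral_prod _ _ _ hg, Kernel.deterministic_apply,
      lintegral_dirac' v.1 (f := fun x => ∫⁻ y, g (x, y) ∂η v) hg.lintegral_prod_right']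
  rw [Kernel.lintegral_comp _ _ _ hg, lintegral_congr h2, Kernel.lintegral_prod _ _ _ h1]
  refine lintegral_congr fun x => ?_
  rw [Kernel.id_apply, lintegral_dirac' z (f := fun c => ∫⁻ y, g (x, y) ∂η (x, c))
    (h1.comp measurable_prodMk_left)]

theorem lintegral_denoteF {R : Type*} [MeasurableSpace R] (k : Kernel (R × Z) X) (f : Kernel Z R)
    [IsMarkovKernel k] [IsMarkovKernel f] (z : Z) {g : X → ℝ≥0∞} (hg : Measurable g) :
    ∫⁻ x, g x ∂(k ∘ₖ (f ×ₖ Kernel.id)) z = ∫⁻ m, ∫⁻ x, g x ∂k (m, z) ∂f z := by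
  rw [Kernel.lintegral_comp _ _ _ hg, Kernel.lintegral_prod _ _ _ hg.lintegral_kernel]
  refine lintegral_congr fun m => ?_
  rw [Kernel.id_apply, lintegral_dirac' z
    (f := fun c => ∫⁻ x, g x ∂k (m, c)) (hg.lintegral_kernel.comp measurable_prodMk_left)]

section CompAux

variable {R S : Type*} [MeasurableSpace R] [MeasurableSpace S]
  (k₁ : Kernel (R × Z) X) (k₂ : Kernel (S × X) Y) (f₁ : Kernel Z R) (f₂ : Kernel X S)
  [IsMarkovKernel k₁] [IsMarkovKernel k₂] [IsMarkovKernel f₁] [IsMarkovKernel f₂]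

/-- The mechanism of a sequential composite: `((m₁, m₂), z) ↦ k₂ (m₂, k₁ (m₁, z))`. -/
noncomputable def compK : Kernel ((R × S) × Z) Y :=
  k₂ ∘ₖ (Kernel.deterministic (fun w : (R × S) × Z => w.1.2) (by fun_prop) ×ₖ
    (k₁ ∘ₖ Kernel.deterministic (fun w : (R × S) × Z => (w.1.1, w.2)) (by fun_prop)))

/-- The noise of a sequential composite: draw `m₁` from `f₁ z`, then `m₂` from
`f₂ (k₁ (m₁, z))`. -/
noncomputable def compF : Kernel Z (R × S) :=
  (Kernel.deterministic Prod.fst measurable_fst ×ₖ (f₂ ∘ₖ k₁)) ∘ₖ (f₁ ×ₖ Kernel.id)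

instance : IsMarkovKernel (compK k₁ k₂) := by
  unfold compK; infer_instance

instance : IsMarkovKernel (compF k₁ f₁ f₂) := by
  unfold compF; infer_instance

variable {k₁ k₂} in
theorem compK_det (h₁ : IsDeterministic k₁) (h₂ : IsDeterministic k₂) :
    IsDeterministic (compK k₁ k₂) :=
  isDeterministic_comp (isDeterministic_prod (isDeterministic_det _)
    (isDeterministic_comp (isDeterministic_det _) h₁)) h₂

set_option linter.unusedSectionVars false in
theorem lintegral_compK (w : (R × S) × Z) {g : Y → ℝ≥0∞} (hg : Measurable g) :
    ∫⁻ y, g y ∂compK k₁ k₂ w = ∫⁻ x, ∫⁻ y, g y ∂k₂ (w.1.2, x) ∂k₁ (w.1.1, w.2) := by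
  rw [compK, Kernel.lintegral_comp _ _ _ hg, Kernel.lintegral_prod _ _ _ hg.lintegral_kernel,
    Kernel.deterministic_apply, Kernel.comp_deterministic_eq_comap,
    lintegral_dirac' _ (f := fun b => ∫⁻ c, ∫⁻ y, g y ∂k₂ (b, c) ∂_) hg.lintegral_kernel.lintegral_prod_right']
  rfl

theorem lintegral_compF' (z : Z) {g : R × S → ℝ≥0∞} (hg : Measurable g) :
    ∫⁻ w, g w ∂compF k₁ f₁ f₂ z =
      ∫⁻ m, ∫⁻ x, ∫⁻ n, g (m, n) ∂f₂ x ∂k₁ (m, z) ∂f₁ z := by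
  rw [compF, lintegral_compF _ _ _ hg]
  refine lintegral_congr fun m => ?_
  rw [Kernel.lintegral_comp (g := fun n => g (m, n)) _ _ _ (hg.comp measurable_prodMk_left)]

theorem compF_ac {μ : Measure R} {ν : Measure S} [SFinite ν] (h₁ : ∀ z, f₁ z ≪ μ)
    (h₂ : ∀ x, f₂ x ≪ ν) (z : Z) : compF k₁ f₁ f₂ z ≪ μ.prod ν := by
  refine Measure.AbsolutelyContinuous.mk fun s hs h0 => ?_
  rw [← lintegral_indicator_one hs, lintegral_compF' _ _ _ _ (measurable_one.indicator hs)]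
  rw [Measure.measure_prod_null hs] at h0
  have h := (h₁ z).ae_le h0
  rw [← lintegral_zero (μ := f₁ z)]
  refine lintegral_congr_ae ?_
  filter_upwards [h] with m hm
  rw [← lintegral_zero (μ := k₁ (m, z))]
  refine lintegral_congr fun x => ?_
  have h3 : ∀ n, s.indicator (1 : R × S → ℝ≥0∞) (m, n) =
      (Prod.mk m ⁻¹' s).indicator 1 n := fun n => rfl
  rw [lintegral_congr h3, lintegral_indicator_one (measurable_prodMk_left hs)]
  exact h₂ x hm

variable {k₁} in
theorem denote_comp_aux (h₁ : IsDeterministic k₁) :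
    compK k₁ k₂ ∘ₖ (compF k₁ f₁ f₂ ×ₖ Kernel.id) =
      (k₂ ∘ₖ (f₂ ×ₖ Kernel.id)) ∘ₖ (k₁ ∘ₖ (f₁ ×ₖ Kernel.id)) := by
  ext z s hs
  have hi : Measurable (s.indicator (1 : Y → ℝ≥0∞)) := measurable_one.indicator hs
  rw [← lintegral_indicator_one hs, ← lintegral_indicator_one hs, lintegral_denoteF _ _ _ hi,
    lintegral_compF' (g := fun w => ∫⁻ y, s.indicator 1 y ∂compK k₁ k₂ (w, z)) _ _ _ _
      (hi.lintegral_kernel.comp measurable_prodMk_right),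
    Kernel.lintegral_comp _ _ _ hi, lintegral_denoteF _ _ _ hi.lintegral_kernel]
  refine lintegral_congr fun m => ?_
  simp only [lintegral_compK k₁ k₂ _ hi, lintegral_denoteF k₂ f₂ _ hi]
  have hh : Measurable fun v : S × X => ∫⁻ y, s.indicator 1 y ∂k₂ v := hi.lintegral_kernel
  have hg : Measurable fun v : X × X => ∫⁻ n, ∫⁻ y, s.indicator 1 y ∂k₂ (n, v.2) ∂f₂ v.1 := by
    have h2 : Measurable fun w : (X × X) × S => ∫⁻ y, s.indicator 1 y ∂k₂ (w.2, w.1.2) :=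
      hh.comp (measurable_snd.prodMk (measurable_snd.comp measurable_fst))
    exact Measurable.lintegral_kernel_prod_right
      (κ := f₂.comap Prod.fst measurable_fst)
      (f := fun (v : X × X) n => ∫⁻ y, s.indicator 1 y ∂k₂ (n, v.2)) h2
  rw [← isDeterministic_lintegral h₁ (m, z) hg]
  refine lintegral_congr fun x => ?_
  rw [lintegral_lintegral_swap]
  exact (hh.comp measurable_id).aemeasurable

end CompAux

section TensorAux

variable {R S : Type*} [MeasurableSpace R] [MeasurableSpace S]
  (k₁ : Kernel (R × Z) X) (k₂ : Kernel (S × W) Y) (f₁ : Kernel Z R) (f₂ : Kernel W S)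
  [IsMarkovKernel k₁] [IsMarkovKernel k₂] [IsMarkovKernel f₁] [IsMarkovKernel f₂]

/-- The mechanism of a product: `((m₁, m₂), (z, w)) ↦ (k₁ (m₁, z), k₂ (m₂, w))`. -/
noncomputable def tensorK : Kernel ((R × S) × (Z × W)) (X × Y) :=
  (k₁ ∥ₖ k₂) ∘ₖ Kernel.deterministic
    (fun w : (R × S) × (Z × W) => ((w.1.1, w.2.1), (w.1.2, w.2.2))) (by fun_prop)

variable {k₁ k₂} in
theorem tensorK_det (h₁ : IsDeterministic k₁) (h₂ : IsDeterministic k₂) :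
    IsDeterministic (tensorK k₁ k₂) :=
  isDeterministic_comp (isDeterministic_det _) (isDeterministic_parallel h₁ h₂)

theorem denote_tensor_aux :
    tensorK k₁ k₂ ∘ₖ ((f₁ ∥ₖ f₂) ×ₖ Kernel.id) =
      (k₁ ∘ₖ (f₁ ×ₖ Kernel.id)) ∥ₖ (k₂ ∘ₖ (f₂ ×ₖ Kernel.id)) := by
  rw [← Kernel.parallelComp_comp_parallelComp, tensorK, Kernel.comp_assoc]
  congr 1
  ext ⟨z, w⟩ : 1
  rw [Kernel.deterministic_comp_eq_map, Kernel.map_apply _ (by fun_prop), Kernel.prod_apply,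
    Kernel.parallelComp_apply, Kernel.parallelComp_apply, Kernel.prod_apply, Kernel.prod_apply,
    Kernel.id_apply, Kernel.id_apply, Kernel.id_apply, Measure.prod_dirac, Measure.prod_dirac,
    Measure.prod_dirac, Measure.map_map (by fun_prop) (by fun_prop),
    Measure.map_prod_map _ _ (by fun_prop) (by fun_prop)]
  rfl

end TensorAux

end Deterministic

/-- `f` is a density kernel into the presented standard Borel space `P`: a Markov kernel that is
everywhere absolutely continuous with respect to the base measure. -/
def IsDensityKernel {Z : Type u} [MeasurableSpace Z] (P : SbsPres.{u})
    (f : Kernel Z P.carrier) : Prop :=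
  IsMarkovKernel f ∧ ∀ z, f z ≪ P.base

/-- `p z m = p(m | z)` is a conditional density of `f` with respect to the base measure of `P`,
jointly measurable in the parameter and the residual. -/
def IsDensity {Z : Type u} [MeasurableSpace Z] (P : SbsPres.{u}) (f : Kernel Z P.carrier)
    (p : Z → P.carrier → ℝ≥0∞) : Prop :=
  Measurable (Function.uncurry p) ∧ ∀ z, f z = P.base.withDensity (p z)

/-- A joint density kernel `([P, k], f)` from `Z` to `X` with residual `P`: a deterministic
mechanism `k : P ⊗ Z → X` in `M` and a density kernel `f : Z → P` in `M`. -/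
structure JointDensityKernel (M : KernelCat.{u}) (P : SbsPres.{u}) (Z X : Type u)
    [MeasurableSpace Z] [MeasurableSpace X] where
  k : Kernel (P.carrier × Z) X
  f : Kernel Z P.carrier
  k_mem : M.Hom k
  k_det : IsDeterministic k
  f_mem : M.Hom f
  f_density : IsDensityKernel P f

namespace JointDensityKernel

variable {M : KernelCat.{u}} {P Q : SbsPres.{u}} {X Y Z W : Type u} [MeasurableSpace X]
  [MeasurableSpace Y] [MeasurableSpace Z] [MeasurableSpace W]

instance (a : JointDensityKernel M P Z X) : IsMarkovKernel a.k := M.hom_markov a.k_mem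
instance (a : JointDensityKernel M P Z X) : IsMarkovKernel a.f := M.hom_markov a.f_mem

/-- The Markov kernel `⟦([P, k], f)⟧ : Z → X`: sample the residual from `f`, then apply `k`. -/
noncomputable def denote (a : JointDensityKernel M P Z X) : Kernel Z X :=
  a.k ∘ₖ (a.f ×ₖ Kernel.id)

instance (a : JointDensityKernel M P Z X) : IsMarkovKernel a.denote :=
  inferInstanceAs (IsMarkovKernel (a.k ∘ₖ (a.f ×ₖ Kernel.id)))

theorem lintegral_denote (a : JointDensityKernel M P Z X) (z : Z) {g : X → ℝ≥0∞}
    (hg : Measurable g) :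
    ∫⁻ x, g x ∂a.denote z = ∫⁻ m, ∫⁻ x, g x ∂a.k (m, z) ∂a.f z := by
  rw [denote, Kernel.lintegral_comp _ _ _ hg, Kernel.lintegral_prod _ _ _ hg.lintegral_kernel]
  refine lintegral_congr fun m => ?_
  rw [Kernel.id_apply, lintegral_dirac' z
    (f := fun c => ∫⁻ x, g x ∂a.k (m, c)) (hg.lintegral_kernel.comp measurable_prodMk_left)]

/-- A deterministic morphism of `M`, as a joint density kernel with trivial residual. -/
noncomputable def pure (g : Kernel Z X) (hg : M.Hom g) (hd : IsDeterministic g) :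
    JointDensityKernel M (.countable PUnit.{u + 1}) Z X where
  k := (g ∘ₖ Kernel.deterministic Prod.snd measurable_snd : Kernel (PUnit.{u + 1} × Z) X)
  f := (Kernel.discard Z : Kernel Z PUnit.{u + 1})
  k_mem := M.hom_comp (M.hom_snd (M.obj_borel _) (M.hom_obj hg).1) hg
  k_det := by
    have := M.hom_markov hg
    change IsDeterministic (g ∘ₖ Kernel.deterministic
      (Prod.snd : PUnit.{u + 1} × Z → Z) measurable_snd)
    exact isDeterministic_comp inferInstance hd
  f_mem := M.hom_discard (M.hom_obj hg).1
  f_density := by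
    refine ⟨inferInstanceAs (IsMarkovKernel (Kernel.discard Z : Kernel Z PUnit.{u + 1})), ?_⟩
    intro z
    change (Kernel.discard Z : Kernel Z PUnit.{u + 1}) z ≪ (Measure.count : Measure PUnit.{u + 1})
    intro s hs
    rw [Measure.count_eq_zero_iff.1 hs]
    simp

theorem denote_pure (g : Kernel Z X) (hg : M.Hom g) (hd : IsDeterministic g) :
    (pure g hg hd).denote = g := by
  ext z s hs
  rw [← lintegral_indicator_one hs, lintegral_denote _ _ (measurable_one.indicator hs)]
  have h := M.hom_markov hg
  change ∫⁻ m, ∫⁻ x, s.indicator 1 x ∂(g ∘ₖ Kernel.deterministic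
      (Prod.snd : PUnit.{u + 1} × Z → Z) measurable_snd) (m, z)
    ∂(Kernel.discard Z : Kernel Z PUnit.{u + 1}) z = _
  rw [Kernel.discard_apply, lintegral_dirac, Kernel.comp_deterministic_eq_comap,
    Kernel.comap_apply, lintegral_indicator_one hs]

/-- Sequential composition: the mechanisms are composed, and the residual of the second kernel is
drawn conditionally on the output of the first. -/
noncomputable def comp (a : JointDensityKernel M P Z X) (b : JointDensityKernel M Q X Y) :
    JointDensityKernel M (P.prod Q) Z Y where
  k := compK a.k b.k
  f := compF a.k a.f b.f
  k_mem := by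
    have hP := M.obj_borel P.carrier
    have hQ := M.obj_borel Q.carrier
    have hZ := (M.hom_obj a.f_mem).1
    have h1 := M.hom_fst (M.obj_prod hP hQ) hZ
    have h2 := M.hom_snd (M.obj_prod hP hQ) hZ
    exact M.hom_comp (KernelCat.hom_prod (KernelCat.hom_det_comp h1 (M.hom_snd hP hQ))
      (M.hom_comp (KernelCat.hom_det_pair (KernelCat.hom_det_comp h1 (M.hom_fst hP hQ)) h2)
        a.k_mem)) b.k_mem
  k_det := compK_det a.k_det b.k_det
  f_mem := by
    have hP := M.obj_borel P.carrier
    have hZ := (M.hom_obj a.f_mem).1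
    exact M.hom_comp (KernelCat.hom_prod a.f_mem (M.hom_id hZ))
      (KernelCat.hom_prod (M.hom_fst hP hZ) (M.hom_comp a.k_mem b.f_mem))
  f_density := ⟨inferInstanceAs (IsMarkovKernel (compF a.k a.f b.f)),
    compF_ac a.k a.f b.f a.f_density.2 b.f_density.2⟩

theorem denote_comp (a : JointDensityKernel M P Z X) (b : JointDensityKernel M Q X Y) :
    (a.comp b).denote = b.denote ∘ₖ a.denote :=
  denote_comp_aux b.k a.f b.f a.k_det

/-- Monoidal product: mechanisms and noises are paired. -/
noncomputable def tensor (a : JointDensityKernel M P Z X) (b : JointDensityKernel M Q W Y) :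
    JointDensityKernel M (P.prod Q) (Z × W) (X × Y) where
  k := tensorK a.k b.k
  f := (a.f ∥ₖ b.f : Kernel (Z × W) (P.carrier × Q.carrier))
  k_mem := by
    have hP := M.obj_borel P.carrier
    have hQ := M.obj_borel Q.carrier
    have hZ := (M.hom_obj a.f_mem).1
    have hW := (M.hom_obj b.f_mem).1
    have h1 := M.hom_fst (M.obj_prod hP hQ) (M.obj_prod hZ hW)
    have h2 := M.hom_snd (M.obj_prod hP hQ) (M.obj_prod hZ hW)
    exact M.hom_comp (KernelCat.hom_det_pair
      (KernelCat.hom_det_pair (KernelCat.hom_det_comp h1 (M.hom_fst hP hQ))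
        (KernelCat.hom_det_comp h2 (M.hom_fst hZ hW)))
      (KernelCat.hom_det_pair (KernelCat.hom_det_comp h1 (M.hom_snd hP hQ))
        (KernelCat.hom_det_comp h2 (M.hom_snd hZ hW)))) (M.hom_parallel a.k_mem b.k_mem)
  k_det := tensorK_det a.k_det b.k_det
  f_mem := M.hom_parallel a.f_mem b.f_mem
  f_density := by
    refine ⟨inferInstanceAs (IsMarkovKernel (a.f ∥ₖ b.f)), fun z => ?_⟩
    change (a.f ∥ₖ b.f) z ≪ P.base.prod Q.base
    rw [Kernel.parallelComp_apply]
    exact (a.f_density.2 z.1).prod (b.f_density.2 z.2)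

theorem denote_tensor (a : JointDensityKernel M P Z X) (b : JointDensityKernel M Q W Y) :
    (a.tensor b).denote = a.denote ∥ₖ b.denote :=
  denote_tensor_aux a.k b.k a.f b.f

end JointDensityKernel


/-! ### Free copy/delete and Markov categories of string diagrams -/

/-- A hypergraph: wires, boxes, and for each box its lists of input and output wires. -/
structure Hypergraph where
  W : Type
  B : Type
  dom : B → List W
  cod : B → List W

/-- A morphism of hypergraphs. -/
structure Hypergraph.Hom (G H : Hypergraph) where
  onW : G.W → H.W
  onB : G.B → H.B
  dom_eq : ∀ b, H.dom (onB b) = (G.dom b).map onW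
  cod_eq : ∀ b, H.cod (onB b) = (G.cod b).map onW

/-- An object `(n, σ : n → Σ)` of the free categories: a finite sequence of wires of `Σ`. -/
structure Word (S : Hypergraph) where
  n : ℕ
  lab : Fin n → S.W

namespace Word

variable {S : Hypergraph}

/-- A list of wires as an object. -/
def ofList (l : List S.W) : Word S := ⟨l.length, l.get⟩

/-- The empty sequence of wires. -/
def unit : Word S := ⟨0, Fin.elim0⟩

/-- Concatenation. -/
def tensor (A B : Word S) : Word S := ⟨A.n + B.n, Fin.append A.lab B.lab⟩

end Word

/-- A cospan `p : n → G ← m : q` over `Σ`, with `G` a finite hypergraph labelled in `Σ`. -/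
structure Diagram (S : Hypergraph) (A B : Word S) where
  G : Hypergraph
  [finW : Finite G.W]
  [fintypeB : Fintype G.B]
  lab : G.Hom S
  p : Fin A.n → G.W
  q : Fin B.n → G.W
  p_lab : ∀ i, lab.onW (p i) = A.lab i
  q_lab : ∀ j, lab.onW (q j) = B.lab j

attribute [instance] Diagram.finW Diagram.fintypeB

namespace Diagram

variable {S : Hypergraph} {A B : Word S} (D : Diagram S A B)

/-- The wire at a starting place: an input of the diagram, or an output position of a box. -/
def start : Fin A.n ⊕ (Σ b : D.G.B, Fin (D.G.cod b).length) → D.G.W :=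
  Sum.elim D.p fun s => (D.G.cod s.1).get s.2

/-- Some output wire of `b` is an input wire of `b'`. -/
def Feeds (b b' : D.G.B) : Prop := ∃ w, w ∈ D.G.cod b ∧ w ∈ D.G.dom b'

/-- There is no directed cycle of boxes. -/
def Acyclic : Prop := ∀ b, ¬ Relation.TransGen D.Feeds b b

/-- The boxes removed when discarded boxes (no output wire of which is an output of the diagram
or an input of a remaining box) are deleted until none is left. -/
inductive Dead : D.G.B → Prop
  | intro (b : D.G.B) (hq : ∀ w ∈ D.G.cod b, w ∉ Set.range D.q)
      (hd : ∀ w ∈ D.G.cod b, ∀ b', w ∈ D.G.dom b' → Dead b') : Dead b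

/-- Isomorphism of cospans over `Σ`. -/
def Iso (D E : Diagram S A B) : Prop :=
  ∃ (eW : D.G.W ≃ E.G.W) (eB : D.G.B ≃ E.G.B),
    (∀ b, E.G.dom (eB b) = (D.G.dom b).map eW) ∧ (∀ b, E.G.cod (eB b) = (D.G.cod b).map eW) ∧
    (∀ w, E.lab.onW (eW w) = D.lab.onW w) ∧ (∀ b, E.lab.onB (eB b) = D.lab.onB b) ∧
    (∀ i, E.p i = eW (D.p i)) ∧ (∀ j, E.q j = eW (D.q j))

theorem start_bijective_iff : Function.Bijective D.start ↔
    Function.Injective D.p ∧ (∀ b, (D.G.cod b).Nodup) ∧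
      (∀ b b' w, w ∈ D.G.cod b → w ∈ D.G.cod b' → b = b') ∧ (∀ i b, D.p i ∉ D.G.cod b) ∧
      ∀ w, w ∈ Set.range D.p ∨ ∃ b, w ∈ D.G.cod b := by
  constructor
  · rintro ⟨hi, hs⟩
    refine ⟨fun i j h => Sum.inl_injective (hi (a₁ := .inl i) (a₂ := .inl j) h), fun b => ?_,
      fun b b' w h h' => ?_, fun i b h => ?_, fun w => ?_⟩
    · refine List.nodup_iff_injective_get.2 fun i j h => ?_
      have := hi (a₁ := .inr ⟨b, i⟩) (a₂ := .inr ⟨b, j⟩) h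
      simpa using this
    · obtain ⟨i, hi'⟩ := List.get_of_mem h
      obtain ⟨j, hj'⟩ := List.get_of_mem h'
      have := hi (a₁ := .inr ⟨b, i⟩) (a₂ := .inr ⟨b', j⟩) (hi'.trans hj'.symm)
      exact congrArg Sigma.fst (Sum.inr_injective this)
    · obtain ⟨j, hj⟩ := List.get_of_mem h
      have := hi (a₁ := .inl i) (a₂ := .inr ⟨b, j⟩) hj.symm
      simp at this
    · obtain ⟨i | ⟨b, i⟩, h⟩ := hs w
      · exact .inl ⟨i, h⟩
      · exact .inr ⟨b, h ▸ List.get_mem _ _⟩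
  · rintro ⟨h1, h2, h3, h4, h5⟩
    refine ⟨?_, fun w => ?_⟩
    · rintro (i | ⟨b, i⟩) (j | ⟨b', j⟩) h
      · exact congrArg _ (h1 h)
      · exact (h4 i b' (by rw [show D.p i = (D.G.cod b').get j from h]; exact List.get_mem _ _)).elim
      · exact (h4 j b (by rw [← show (D.G.cod b).get i = D.p j from h]; exact List.get_mem _ _)).elim
      · have h' : (D.G.cod b).get i = (D.G.cod b').get j := h
        obtain rfl := h3 b b' _ (List.get_mem _ i) (h' ▸ List.get_mem _ j)
        exact congrArg _ (congrArg _ (List.nodup_iff_injective_get.1 (h2 b) h'))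
    · rcases h5 w with ⟨i, h⟩ | ⟨b, h⟩
      · exact ⟨.inl i, h⟩
      · obtain ⟨i, h⟩ := List.get_of_mem h
        exact ⟨.inr ⟨b, i⟩, h⟩

end Diagram

/-- A morphism of the free copy/delete category on `Σ` (a representative of its isomorphism
class): an acyclic cospan in which every wire has exactly one starting place. -/
structure FreeCD (S : Hypergraph) (A B : Word S) extends Diagram S A B where
  acyclic : toDiagram.Acyclic
  start_bij : Function.Bijective toDiagram.start

/-- A morphism of the free Markov category on `Σ`: in addition, every box has an output that is
connected to an output of the diagram or to another box. -/
structure FreeMarkov (S : Hypergraph) (A B : Word S) extends FreeCD S A B where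
  connected : ∀ b, ∃ w ∈ toDiagram.G.cod b,
    w ∈ Set.range toDiagram.q ∨ ∃ b', w ∈ toDiagram.G.dom b'

theorem transGen_lift {α β : Type} {r : α → α → Prop} {s : β → β → Prop} (f : α → β)
    (h : ∀ a b, r a b → s (f a) (f b)) {a b : α} (hab : Relation.TransGen r a b) :
    Relation.TransGen s (f a) (f b) := by
  induction hab with
  | single h' => exact .single (h _ _ h')
  | tail _ h' ih => exact ih.tail (h _ _ h')

namespace FreeCD

open Diagram

variable {S : Hypergraph} {A B C A' B' : Word S}

theorem p_injective (D : FreeCD S A B) : Function.Injective D.p :=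
  ((start_bijective_iff _).1 D.start_bij).1

theorem cod_nodup (D : FreeCD S A B) : ∀ b, (D.G.cod b).Nodup :=
  ((start_bijective_iff _).1 D.start_bij).2.1

theorem cod_unique (D : FreeCD S A B) {b b' : D.G.B} {w : D.G.W} :
    w ∈ D.G.cod b → w ∈ D.G.cod b' → b = b' :=
  ((start_bijective_iff _).1 D.start_bij).2.2.1 b b' w

theorem p_notMem_cod (D : FreeCD S A B) : ∀ i b, D.p i ∉ D.G.cod b :=
  ((start_bijective_iff _).1 D.start_bij).2.2.2.1

theorem exists_start (D : FreeCD S A B) (w : D.G.W) :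
    w ∈ Set.range D.p ∨ ∃ b, w ∈ D.G.cod b :=
  ((start_bijective_iff _).1 D.start_bij).2.2.2.2 w

/-- The wires that remain when the boxes in `Dead` are deleted together with their outputs. -/
def Remains (D : FreeCD S A B) (w : D.G.W) : Prop :=
  w ∈ Set.range D.p ∨ ∃ b, ¬ D.Dead b ∧ w ∈ D.G.cod b

theorem remains_cod (D : FreeCD S A B) {b : D.G.B} (hb : ¬ D.Dead b) :
    ∀ w ∈ D.G.cod b, D.Remains w := fun _ hw => .inr ⟨b, hb, hw⟩

theorem remains_dom (D : FreeCD S A B) {b : D.G.B} (hb : ¬ D.Dead b) :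
    ∀ w ∈ D.G.dom b, D.Remains w := by
  intro w hw
  refine (D.exists_start w).imp_right fun ⟨b', h⟩ => ⟨b', ?_, h⟩
  rintro ⟨_, _, hd⟩
  exact hb (hd w h b hw)

theorem remains_q (D : FreeCD S A B) (j : Fin B.n) : D.Remains (D.q j) := by
  refine (D.exists_start _).imp_right fun ⟨b', h⟩ => ⟨b', ?_, h⟩
  rintro ⟨_, hq, _⟩
  exact hq _ h ⟨j, rfl⟩

open Classical in
/-- Deletion of discarded boxes, iterated to a fixed point. -/
noncomputable def normalize (D : FreeCD S A B) : FreeMarkov S A B where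
  G :=
    { W := {w // D.Remains w}
      B := {b // ¬ D.Dead b}
      dom := fun b => (D.G.dom b.1).pmap Subtype.mk (D.remains_dom b.2)
      cod := fun b => (D.G.cod b.1).pmap Subtype.mk (D.remains_cod b.2) }
  finW := inferInstanceAs (Finite {w // D.Remains w})
  fintypeB := inferInstanceAs (Fintype {b // ¬ D.Dead b})
  lab :=
    { onW := fun w => D.lab.onW w.1
      onB := fun b => D.lab.onB b.1
      dom_eq := fun b => by simp [List.map_pmap, D.lab.dom_eq]
      cod_eq := fun b => by simp [List.map_pmap, D.lab.cod_eq] }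
  p := fun i => ⟨D.p i, .inl ⟨i, rfl⟩⟩
  q := fun j => ⟨D.q j, D.remains_q j⟩
  p_lab := D.p_lab
  q_lab := D.q_lab
  acyclic := by
    intro b hb
    refine D.acyclic b.1 (transGen_lift Subtype.val ?_ hb)
    rintro b b' ⟨w, h, h'⟩
    simp only [List.mem_pmap] at h h'
    obtain ⟨v, hv, rfl⟩ := h
    obtain ⟨v', hv', h⟩ := h'
    obtain rfl : v' = v := congrArg Subtype.val h
    exact ⟨v', hv, hv'⟩
  start_bij := by
    rw [start_bijective_iff]
    refine ⟨fun i j h => D.p_injective (congrArg Subtype.val h), fun b => ?_, ?_, ?_, ?_⟩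
    · exact (D.cod_nodup b.1).pmap fun _ _ _ _ h => congrArg Subtype.val h
    · intro b b' w h h'
      simp only [List.mem_pmap] at h h'
      obtain ⟨v, hv, rfl⟩ := h
      obtain ⟨v', hv', h⟩ := h'
      obtain rfl : v' = v := congrArg Subtype.val h
      exact Subtype.ext (D.cod_unique hv hv')
    · intro i b h
      simp only [List.mem_pmap] at h
      obtain ⟨v, hv, h⟩ := h
      obtain rfl : v = D.p i := congrArg Subtype.val h
      exact D.p_notMem_cod i _ hv
    · rintro ⟨w, ⟨i, rfl⟩ | ⟨b, hb, hw⟩⟩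
      · exact .inl ⟨i, rfl⟩
      · exact .inr ⟨⟨b, hb⟩, List.mem_pmap.2 ⟨w, hw, rfl⟩⟩
  connected := by
    rintro ⟨b, hb⟩
    by_contra hcon
    refine hb ⟨b, fun w hw hq => hcon ?_, fun w hw b' hd => by_contra fun hb' => hcon ?_⟩
    · obtain ⟨j, rfl⟩ := hq
      exact ⟨⟨D.q j, D.remains_q j⟩, List.mem_pmap.2 ⟨_, hw, rfl⟩, .inl ⟨j, rfl⟩⟩
    · exact ⟨⟨w, D.remains_cod hb w hw⟩, List.mem_pmap.2 ⟨_, hw, rfl⟩,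
        .inr ⟨⟨b', hb'⟩, List.mem_pmap.2 ⟨_, hd, rfl⟩⟩⟩

open Classical in
/-- The map from the wires of the second diagram to those of the gluing. -/
noncomputable def glueMap (D : FreeCD S A B) (E : FreeCD S B C) (w : E.G.W) :
    D.G.W ⊕ {w : E.G.W // w ∉ Set.range E.p} :=
  if h : w ∈ Set.range E.p then .inl (D.q h.choose) else .inr ⟨w, h⟩

theorem glueMap_of_notMem (D : FreeCD S A B) (E : FreeCD S B C) {w : E.G.W}
    (h : w ∉ Set.range E.p) : glueMap D E w = .inr ⟨w, h⟩ := dif_neg h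

theorem glueMap_p (D : FreeCD S A B) (E : FreeCD S B C) (i : Fin B.n) :
    glueMap D E (E.p i) = .inl (D.q i) := by
  have h : E.p i ∈ Set.range E.p := ⟨i, rfl⟩
  rw [glueMap, dif_pos h, E.p_injective h.choose_spec]

theorem glueMap_cod (D : FreeCD S A B) (E : FreeCD S B C) {w : E.G.W} {b : E.G.B}
    (hw : w ∈ E.G.cod b) : ∃ h, glueMap D E w = .inr ⟨w, h⟩ := by
  have h : w ∉ Set.range E.p := by
    rintro ⟨i, rfl⟩
    exact E.p_notMem_cod i b hw
  exact ⟨h, glueMap_of_notMem D E h⟩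

theorem glueMap_lab (D : FreeCD S A B) (E : FreeCD S B C) (w : E.G.W) :
    Sum.elim D.lab.onW (fun v : {w : E.G.W // w ∉ Set.range E.p} => E.lab.onW v.1)
      (glueMap D E w) = E.lab.onW w := by
  by_cases h : w ∈ Set.range E.p
  · obtain ⟨i, rfl⟩ := h
    rw [glueMap_p, Sum.elim_inl, D.q_lab, E.p_lab]
  · rw [glueMap_of_notMem D E h, Sum.elim_inr]

/-- The underlying cospan of a composite: the pushout along the shared wires `E.p` and `D.q`.
As `E.p` is injective, the pushout consists of the wires of `D` and the wires of `E` that are not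
inputs of `E`. -/
noncomputable def glueDiagram (D : FreeCD S A B) (E : FreeCD S B C) : Diagram S A C where
  G :=
    { W := D.G.W ⊕ {w : E.G.W // w ∉ Set.range E.p}
      B := D.G.B ⊕ E.G.B
      dom := Sum.elim (fun b => (D.G.dom b).map Sum.inl) (fun b => (E.G.dom b).map (glueMap D E))
      cod := Sum.elim (fun b => (D.G.cod b).map Sum.inl)
        (fun b => (E.G.cod b).map (glueMap D E)) }
  finW := inferInstanceAs (Finite (D.G.W ⊕ {w : E.G.W // w ∉ Set.range E.p}))
  fintypeB := inferInstanceAs (Fintype (D.G.B ⊕ E.G.B))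
  lab :=
    { onW := Sum.elim D.lab.onW fun w => E.lab.onW w.1
      onB := Sum.elim D.lab.onB E.lab.onB
      dom_eq := by
        rintro (b | b)
        · simp [D.lab.dom_eq]
        · simp [E.lab.dom_eq, glueMap_lab]
      cod_eq := by
        rintro (b | b)
        · simp [D.lab.cod_eq]
        · simp [E.lab.cod_eq, glueMap_lab] }
  p := fun i => .inl (D.p i)
  q := fun j => glueMap D E (E.q j)
  p_lab := D.p_lab
  q_lab := fun j => (glueMap_lab D E _).trans (E.q_lab j)

theorem glue_feeds (D : FreeCD S A B) (E : FreeCD S B C) {b b' : D.G.B ⊕ E.G.B}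
    (h : (glueDiagram D E).Feeds b b') :
    Sum.Lex D.Feeds E.Feeds b b' := by
  obtain ⟨w, h, h'⟩ := h
  rcases b with b | b <;> rcases b' with b' | b'
  · obtain ⟨v, hv, rfl⟩ := List.mem_map.1 h
    obtain ⟨v', hv', h2⟩ := List.mem_map.1 h'
    obtain rfl := Sum.inl_injective h2
    exact .inl ⟨_, hv, hv'⟩
  · exact .sep _ _
  · obtain ⟨v, hv, rfl⟩ := List.mem_map.1 h
    obtain ⟨v', hv', h2⟩ := List.mem_map.1 h'
    obtain ⟨h3, h4⟩ := glueMap_cod D E hv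
    rw [h4] at h2
    cases h2
  · obtain ⟨v, hv, rfl⟩ := List.mem_map.1 h
    obtain ⟨v', hv', h2⟩ := List.mem_map.1 h'
    obtain ⟨h3, h4⟩ := glueMap_cod D E hv
    rw [h4] at h2
    by_cases h5 : v' ∈ Set.range E.p
    · obtain ⟨i, rfl⟩ := h5
      rw [glueMap_p] at h2
      cases h2
    · rw [glueMap_of_notMem D E h5] at h2
      obtain rfl : v' = v := congrArg Subtype.val (Sum.inr_injective h2)
      exact .inr ⟨_, hv, hv'⟩

theorem acyclic_of_lex {α β : Type} {r : α → α → Prop} {s : β → β → Prop}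
    (hr : ∀ a, ¬ Relation.TransGen r a a) (hs : ∀ b, ¬ Relation.TransGen s b b)
    (x : α ⊕ β) : ¬ Relation.TransGen (Sum.Lex r s) x x := by
  intro h
  have key : ∀ y, Relation.TransGen (Sum.Lex r s) x y →
      Sum.Lex (Relation.TransGen r) (Relation.TransGen s) x y := by
    intro y hy
    induction hy with
    | single h1 =>
      cases h1 with
      | inl h2 => exact .inl (.single h2)
      | inr h2 => exact .inr (.single h2)
      | sep => exact .sep _ _
    | tail _ h1 ih =>
      cases h1 with
      | inl h2 => cases ih with
        | inl h3 => exact .inl (h3.tail h2)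
      | inr h2 => cases ih with
        | inr h3 => exact .inr (h3.tail h2)
        | sep => exact .sep _ _
      | sep => cases ih with
        | inl h3 => exact .sep _ _
  rcases key x h with h | h
  · exact hr _ h
  · exact hs _ h

/-- Composition in the free copy/delete category. -/
noncomputable def glue (D : FreeCD S A B) (E : FreeCD S B C) : FreeCD S A C where
  toDiagram := glueDiagram D E
  acyclic := fun b hb => acyclic_of_lex D.acyclic E.acyclic b
    (transGen_lift _root_.id (fun _ _ => glue_feeds D E) hb)
  start_bij := by
    rw [start_bijective_iff]
    refine ⟨fun i j h => D.p_injective (Sum.inl_injective h), ?_, ?_, ?_, ?_⟩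
    · rintro (b | b)
      · exact (D.cod_nodup b).map Sum.inl_injective
      · refine (E.cod_nodup b).map_on fun v hv v' hv' h => ?_
        obtain ⟨h1, h2⟩ := glueMap_cod D E hv
        obtain ⟨h3, h4⟩ := glueMap_cod D E hv'
        rw [h2, h4] at h
        exact congrArg Subtype.val (Sum.inr_injective h)
    · rintro (b | b) (b' | b') w h h'
      · obtain ⟨v, hv, rfl⟩ := List.mem_map.1 h
        obtain ⟨v', hv', h2⟩ := List.mem_map.1 h'
        obtain rfl := Sum.inl_injective h2
        exact congrArg _ (D.cod_unique hv hv')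
      · obtain ⟨v, hv, rfl⟩ := List.mem_map.1 h
        obtain ⟨v', hv', h2⟩ := List.mem_map.1 h'
        obtain ⟨h3, h4⟩ := glueMap_cod D E hv'
        rw [h4] at h2
        cases h2
      · obtain ⟨v, hv, rfl⟩ := List.mem_map.1 h
        obtain ⟨v', hv', h2⟩ := List.mem_map.1 h'
        obtain ⟨h3, h4⟩ := glueMap_cod D E hv
        rw [h4] at h2
        cases h2
      · obtain ⟨v, hv, rfl⟩ := List.mem_map.1 h
        obtain ⟨v', hv', h2⟩ := List.mem_map.1 h'
        obtain ⟨h3, h4⟩ := glueMap_cod D E hv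
        obtain ⟨h5, h6⟩ := glueMap_cod D E hv'
        rw [h4, h6] at h2
        obtain rfl : v' = v := congrArg Subtype.val (Sum.inr_injective h2)
        exact congrArg _ (E.cod_unique hv hv')
    · rintro i (b | b) h
      · obtain ⟨v, hv, h2⟩ := List.mem_map.1 h
        obtain rfl := Sum.inl_injective h2
        exact D.p_notMem_cod i b hv
      · obtain ⟨v, hv, h2⟩ := List.mem_map.1 h
        obtain ⟨h3, h4⟩ := glueMap_cod D E hv
        rw [h4] at h2
        cases h2
    · rintro (w | ⟨w, hw⟩)
      · rcases D.exists_start w with ⟨i, rfl⟩ | ⟨b, hb⟩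
        · exact .inl ⟨i, rfl⟩
        · exact .inr ⟨.inl b, List.mem_map.2 ⟨w, hb, rfl⟩⟩
      · rcases E.exists_start w with h | ⟨b, hb⟩
        · exact (hw h).elim
        · exact .inr ⟨.inr b, List.mem_map.2 ⟨w, hb, glueMap_of_notMem D E hw⟩⟩

/-- The diagram with the single box `b`. -/
def box (b : S.B) : FreeCD S (.ofList (S.dom b)) (.ofList (S.cod b)) where
  G :=
    { W := Fin (S.dom b).length ⊕ Fin (S.cod b).length
      B := Unit
      dom := fun _ => List.ofFn Sum.inl
      cod := fun _ => List.ofFn Sum.inr }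
  finW := inferInstanceAs (Finite (Fin (S.dom b).length ⊕ Fin (S.cod b).length))
  fintypeB := inferInstanceAs (Fintype Unit)
  lab :=
    { onW := Sum.elim (S.dom b).get (S.cod b).get
      onB := fun _ => b
      dom_eq := fun _ => by
        rw [List.map_ofFn]
        exact (List.ofFn_get _).symm
      cod_eq := fun _ => by
        rw [List.map_ofFn]
        exact (List.ofFn_get _).symm }
  p := Sum.inl
  q := Sum.inr
  p_lab := fun _ => rfl
  q_lab := fun _ => rfl
  acyclic := by
    intro x hx
    obtain ⟨y, ⟨w, h, h'⟩, -⟩ := Relation.TransGen.head'_iff.1 hx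
    obtain ⟨i, rfl⟩ := (List.mem_ofFn' _ _).1 h
    obtain ⟨j, hj⟩ := (List.mem_ofFn' _ _).1 h'
    cases hj
  start_bij := by
    rw [start_bijective_iff]
    refine ⟨Sum.inl_injective, fun _ => List.nodup_ofFn.2 Sum.inr_injective,
      fun _ _ _ _ _ => rfl, fun i _ h => ?_, ?_⟩
    · obtain ⟨j, hj⟩ := (List.mem_ofFn' _ _).1 h
      cases hj
    · rintro (i | i)
      · exact .inl ⟨i, rfl⟩
      · exact .inr ⟨(), (List.mem_ofFn' _ _).2 ⟨i, rfl⟩⟩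

end FreeCD

namespace FreeMarkov

open Diagram

variable {S : Hypergraph} {A B C A' B' : Word S}

/-- Composition in the free Markov category: glue, then delete discarded boxes. -/
noncomputable def comp (D : FreeMarkov S A B) (E : FreeMarkov S B C) : FreeMarkov S A C :=
  (D.toFreeCD.glue E.toFreeCD).normalize

/-- The generator `⟨b⟩`. -/
noncomputable def box (b : S.B) : FreeMarkov S (.ofList (S.dom b)) (.ofList (S.cod b)) :=
  (FreeCD.box b).normalize

/-- The diagram without boxes that connects output `j` to input `g j`. -/
def wiring (g : Fin B.n → Fin A.n) (hg : ∀ j, A.lab (g j) = B.lab j) : FreeMarkov S A B where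
  G := { W := Fin A.n, B := Empty, dom := Empty.elim, cod := Empty.elim }
  finW := inferInstanceAs (Finite (Fin A.n))
  fintypeB := inferInstanceAs (Fintype Empty)
  lab :=
    { onW := A.lab
      onB := Empty.elim
      dom_eq := fun b => b.elim
      cod_eq := fun b => b.elim }
  p := id
  q := g
  p_lab := fun _ => rfl
  q_lab := hg
  acyclic := fun b => Empty.elim b
  start_bij := (start_bijective_iff _).2 ⟨Function.injective_id, fun b => Empty.elim b,
    fun b => Empty.elim b, fun _ b => Empty.elim b, fun w => .inl ⟨w, rfl⟩⟩
  connected := fun b => Empty.elim b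

/-- Identities. -/
def id (A : Word S) : FreeMarkov S A A := wiring _root_.id fun _ => rfl

/-- The symmetry exchanging `A` and `B`. -/
def swap (A B : Word S) : FreeMarkov S (A.tensor B) (B.tensor A) :=
  wiring (Fin.append (Fin.natAdd A.n) (Fin.castAdd B.n) : Fin (B.n + A.n) → Fin (A.n + B.n))
    fun j => by
      refine Fin.addCases (fun i => ?_) (fun i => ?_) j
      · simp [Word.tensor]
      · simp [Word.tensor]

/-- The copy map. -/
def copy (A : Word S) : FreeMarkov S A (A.tensor A) :=
  wiring (Fin.append _root_.id _root_.id : Fin (A.n + A.n) → Fin A.n) fun j => by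
    refine Fin.addCases (fun i => ?_) (fun i => ?_) j
    · simp [Word.tensor]
    · change A.lab (Fin.append (_root_.id : Fin A.n → Fin A.n) _root_.id (Fin.natAdd A.n i)) =
        Fin.append A.lab A.lab (Fin.natAdd A.n i)
      rw [Fin.append_right, Fin.append_right]
      rfl

/-- The delete map. -/
def discard (A : Word S) : FreeMarkov S A .unit := wiring Fin.elim0 fun j => j.elim0

/-- Juxtaposition of diagrams. -/
def tensor (D : FreeMarkov S A B) (E : FreeMarkov S A' B') :
    FreeMarkov S (A.tensor A') (B.tensor B') where
  G :=
    { W := D.G.W ⊕ E.G.W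
      B := D.G.B ⊕ E.G.B
      dom := Sum.elim (fun b => (D.G.dom b).map Sum.inl) (fun b => (E.G.dom b).map Sum.inr)
      cod := Sum.elim (fun b => (D.G.cod b).map Sum.inl) (fun b => (E.G.cod b).map Sum.inr) }
  finW := inferInstanceAs (Finite (D.G.W ⊕ E.G.W))
  fintypeB := inferInstanceAs (Fintype (D.G.B ⊕ E.G.B))
  lab :=
    { onW := Sum.elim D.lab.onW E.lab.onW
      onB := Sum.elim D.lab.onB E.lab.onB
      dom_eq := by
        rintro (b | b)
        · simp [D.lab.dom_eq]
        · simp [E.lab.dom_eq]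
      cod_eq := by
        rintro (b | b)
        · simp [D.lab.cod_eq]
        · simp [E.lab.cod_eq] }
  p := (Fin.append (fun i => .inl (D.p i)) (fun i => .inr (E.p i)) :
    Fin (A.n + A'.n) → D.G.W ⊕ E.G.W)
  q := (Fin.append (fun i => .inl (D.q i)) (fun i => .inr (E.q i)) :
    Fin (B.n + B'.n) → D.G.W ⊕ E.G.W)
  p_lab := fun j => by
    refine Fin.addCases (fun i => ?_) (fun i => ?_) j
    · simp [Word.tensor, D.p_lab]
    · simp [Word.tensor, E.p_lab]
  q_lab := fun j => by
    refine Fin.addCases (fun i => ?_) (fun i => ?_) j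
    · simp [Word.tensor, D.q_lab]
    · simp [Word.tensor, E.q_lab]
  acyclic := fun b hb => FreeCD.acyclic_of_lex D.acyclic E.acyclic b
    (transGen_lift _root_.id (fun b b' h => by
      obtain ⟨w, h, h'⟩ := h
      rcases b with b | b <;> rcases b' with b' | b' <;>
        obtain ⟨v, hv, rfl⟩ := List.mem_map.1 h <;>
        obtain ⟨v', hv', h2⟩ := List.mem_map.1 h'
      · obtain rfl := Sum.inl_injective h2
        exact .inl ⟨_, hv, hv'⟩
      · cases h2
      · cases h2
      · obtain rfl := Sum.inr_injective h2
        exact .inr ⟨_, hv, hv'⟩) hb)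
  start_bij := by
    rw [start_bijective_iff]
    refine ⟨?_, ?_, ?_, ?_, ?_⟩
    · intro i j
      refine Fin.addCases (fun i => ?_) (fun i => ?_) i <;>
        refine Fin.addCases (fun j => ?_) (fun j => ?_) j <;> intro h <;> simp at h
      · rw [D.p_injective h]
      · rw [E.p_injective h]
    · rintro (b | b)
      · exact (D.cod_nodup b).map Sum.inl_injective
      · exact (E.cod_nodup b).map Sum.inr_injective
    · rintro (b | b) (b' | b') w h h' <;>
        obtain ⟨v, hv, rfl⟩ := List.mem_map.1 h <;>
        obtain ⟨v', hv', h2⟩ := List.mem_map.1 h'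
      · obtain rfl := Sum.inl_injective h2
        exact congrArg _ (D.cod_unique hv hv')
      · cases h2
      · cases h2
      · obtain rfl := Sum.inr_injective h2
        exact congrArg _ (E.cod_unique hv hv')
    · intro i
      refine Fin.addCases (fun i => ?_) (fun i => ?_) i <;> rintro (b | b) h <;>
        obtain ⟨v, hv, h2⟩ := List.mem_map.1 h <;> simp at h2
      · exact D.p_notMem_cod i b (h2 ▸ hv)
      · exact E.p_notMem_cod i b (h2 ▸ hv)
    · rintro (w | w)
      · rcases D.exists_start w with ⟨i, rfl⟩ | ⟨b, hb⟩
        · exact .inl ⟨Fin.castAdd A'.n i, by simp⟩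
        · exact .inr ⟨.inl b, List.mem_map.2 ⟨w, hb, rfl⟩⟩
      · rcases E.exists_start w with ⟨i, rfl⟩ | ⟨b, hb⟩
        · exact .inl ⟨Fin.natAdd A.n i, by simp⟩
        · exact .inr ⟨.inr b, List.mem_map.2 ⟨w, hb, rfl⟩⟩
  connected := by
    rintro (b | b)
    · obtain ⟨w, hw, h⟩ := D.connected b
      refine ⟨.inl w, List.mem_map.2 ⟨w, hw, rfl⟩, h.imp ?_ ?_⟩
      · rintro ⟨j, rfl⟩
        exact ⟨Fin.castAdd B'.n j, by simp⟩
      · rintro ⟨b', h⟩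
        exact ⟨.inl b', List.mem_map.2 ⟨w, h, rfl⟩⟩
    · obtain ⟨w, hw, h⟩ := E.connected b
      refine ⟨.inr w, List.mem_map.2 ⟨w, hw, rfl⟩, h.imp ?_ ?_⟩
      · rintro ⟨j, rfl⟩
        exact ⟨Fin.natAdd B.n j, by simp⟩
      · rintro ⟨b', h⟩
        exact ⟨.inr b', List.mem_map.2 ⟨w, h, rfl⟩⟩

/-- A generalized causal model: a diagram whose output map is one-to-one on wires. -/
def IsCausalModel (D : FreeMarkov S A B) : Prop := Function.Injective D.q

end FreeMarkov

/-! ### The category of joint density kernels -/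

namespace KernelCat

variable {M : KernelCat.{u}}

/-- The tensor product of two objects. -/
def Ob.prod (X Y : M.Ob) : M.Ob := ⟨X.carrier × Y.carrier, M.obj_prod X.obj Y.obj⟩

/-- The tensor product of a finite family of objects. -/
def Ob.pi {ι : Type} [Finite ι] (X : ι → M.Ob) : M.Ob :=
  ⟨∀ i, (X i).carrier, M.obj_pi fun i => (X i).obj⟩

/-- The tensor unit. -/
def Ob.unit : M.Ob := ⟨PUnit.{u + 1}, M.obj_borel _⟩

end KernelCat

/-- The morphisms `dJoint(M)(Z, X)`: joint density kernels `([P, k], f)` with arbitrary residual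
`P`, two of them being equal as morphisms when they denote the same Markov kernel `Z → X`. -/
def DJoint (M : KernelCat.{u}) (Z X : M.Ob) : Type (u + 1) :=
  Quotient (Setoid.ker fun a : Σ P, JointDensityKernel M P Z.carrier X.carrier => a.2.denote)

namespace DJoint

variable {M : KernelCat.{u}} {X Y Z W : M.Ob}

/-- The morphism represented by a joint density kernel. -/
noncomputable def mk {P : SbsPres.{u}} (a : JointDensityKernel M P Z.carrier X.carrier) : DJoint M Z X :=
  Quotient.mk _ ⟨P, a⟩

theorem mk_eq_mk {P Q : SbsPres.{u}} {a : JointDensityKernel M P Z.carrier X.carrier}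
    {b : JointDensityKernel M Q Z.carrier X.carrier} :
    (mk a : DJoint M Z X) = mk b ↔ a.denote = b.denote :=
  Quotient.eq.trans Iff.rfl

/-- A deterministic morphism of `M` as a morphism of `dJoint(M)`. -/
noncomputable def pure (g : Z.carrier → X.carrier) (hg : Measurable g)
    (h : M.Hom (Kernel.deterministic g hg)) : DJoint M Z X :=
  mk (JointDensityKernel.pure _ h (isDeterministic_det hg))

/-- Composition (in diagrammatic order). -/
noncomputable def comp (a : DJoint M Z X) (b : DJoint M X Y) : DJoint M Z Y :=
  Quotient.map₂ (fun a b => ⟨_, a.2.comp b.2⟩) (fun a a' h b b' h' => by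
    change (a.2.comp b.2).denote = (a'.2.comp b'.2).denote
    rw [JointDensityKernel.denote_comp, JointDensityKernel.denote_comp,
      show a.2.denote = a'.2.denote from h, show b.2.denote = b'.2.denote from h']) a b

/-- Monoidal product of morphisms. -/
noncomputable def tensor (a : DJoint M Z X) (b : DJoint M W Y) :
    DJoint M (Z.prod W) (X.prod Y) :=
  Quotient.map₂ (fun a b => ⟨_, a.2.tensor b.2⟩) (fun a a' h b b' h' => by
    change (a.2.tensor b.2).denote = (a'.2.tensor b'.2).denote
    rw [JointDensityKernel.denote_tensor, JointDensityKernel.denote_tensor,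
      show a.2.denote = a'.2.denote from h, show b.2.denote = b'.2.denote from h']) a b

/-- Identities. -/
noncomputable def id (X : M.Ob) : DJoint M X X :=
  pure _root_.id measurable_id (M.hom_id X.obj)

/-- Symmetries. -/
noncomputable def swap (X Y : M.Ob) : DJoint M (X.prod Y) (Y.prod X) :=
  pure (fun x : X.carrier × Y.carrier => (x.2, x.1)) (measurable_snd.prodMk measurable_fst)
    (KernelCat.hom_det_pair (M.hom_snd X.obj Y.obj) (M.hom_fst X.obj Y.obj))

/-- Copy maps. -/
noncomputable def copy (X : M.Ob) : DJoint M X (X.prod X) :=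
  pure (fun x : X.carrier => (x, x)) (measurable_id.prodMk measurable_id) (M.hom_copy X.obj)

/-- Delete maps. -/
noncomputable def discard (X : M.Ob) : DJoint M X .unit :=
  pure (fun _ : X.carrier => PUnit.unit.{u + 1}) measurable_const (M.hom_discard X.obj)

end DJoint

/-! ### Strict Markov functors out of the free Markov category -/

section Interpretation

variable {S : Hypergraph} {M : KernelCat.{u}} (obj : S.W → M.Ob)

/-- The object `⨂ᵢ obj (σ i)` interpreting a word `σ` of wires. -/
def wordOb (A : Word S) : M.Ob := .pi fun i => obj (A.lab i)

/-- Transport along an equality of wires. -/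
def tr {w w' : S.W} (h : w = w') (x : (obj w).carrier) : (obj w').carrier :=
  cast (congrArg (fun w => (obj w).carrier) h) x

theorem measurable_tr {w w' : S.W} (h : w = w') : Measurable (tr obj h) := by
  subst h; exact measurable_id

theorem hom_tr {w w' : S.W} (h : w = w') :
    M.Hom (Kernel.deterministic (tr obj h) (measurable_tr obj h)) := by
  subst h; exact M.hom_id (obj w).obj

/-- Rearranging the coordinates of a tuple along equalities of labels. -/
def reindex {ι : Type} (l : ι → S.W) {κ : Type} (l' : κ → S.W) (g : κ → ι)
    (hg : ∀ j, l (g j) = l' j) (x : ∀ i, (obj (l i)).carrier) : ∀ j, (obj (l' j)).carrier :=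
  fun j => tr obj (hg j) (x (g j))

theorem measurable_reindex {ι : Type} (l : ι → S.W) {κ : Type} (l' : κ → S.W)
    (g : κ → ι) (hg : ∀ j, l (g j) = l' j) : Measurable (reindex obj l l' g hg) :=
  measurable_pi_lambda _ fun j => (measurable_tr obj (hg j)).comp (measurable_pi_apply (g j))

theorem hom_reindex {ι : Type} [Finite ι] (l : ι → S.W) {κ : Type} [Finite κ] (l' : κ → S.W)
    (g : κ → ι) (hg : ∀ j, l (g j) = l' j) :
    M.Hom (Kernel.deterministic (reindex obj l l' g hg) (measurable_reindex obj l l' g hg)) :=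
  M.hom_tuple (fun j => (measurable_tr obj (hg j)).comp (measurable_pi_apply (g j)))
    (M.obj_pi fun i => (obj (l i)).obj) fun j =>
      KernelCat.hom_det_comp (f := fun x : ∀ i, (obj (l i)).carrier => x (g j))
        (M.hom_eval (fun i => (obj (l i)).obj) (g j)) (hom_tr obj (hg j))

/-- The canonical identification of `⨂ (A ⊗ B)` with `⨂ A ⊗ ⨂ B`. -/
noncomputable def split (A B : Word S) :
    DJoint M (wordOb obj (A.tensor B)) ((wordOb obj A).prod (wordOb obj B)) :=
  DJoint.pure (fun x => (reindex obj (A.tensor B).lab A.lab (Fin.castAdd B.n)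
        (fun i => Fin.append_left A.lab B.lab i) x,
      reindex obj (A.tensor B).lab B.lab (Fin.natAdd A.n)
        (fun i => Fin.append_right A.lab B.lab i) x))
    ((measurable_reindex obj _ _ _ _).prodMk (measurable_reindex obj _ _ _ _))
    (KernelCat.hom_det_pair (hom_reindex obj _ _ _ _) (hom_reindex obj _ _ _ _))

end Interpretation

/-- A strict Markov functor from the free Markov category on `S` to `dJoint(M)`. On objects it is
determined by the images of the wires; it is invariant under isomorphism of diagrams and preserves
identities, composition, monoidal products, symmetries, copy maps and delete maps. -/
structure StrictMarkovFunctor (S : Hypergraph) (M : KernelCat.{u}) where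
  obj : S.W → M.Ob
  map : {A B : Word S} → FreeMarkov S A B → DJoint M (wordOb obj A) (wordOb obj B)
  map_iso : ∀ {A B : Word S} (D E : FreeMarkov S A B),
    D.toDiagram.Iso E.toDiagram → map D = map E
  map_id : ∀ A : Word S, map (FreeMarkov.id A) = DJoint.id _
  map_comp : ∀ {A B C : Word S} (D : FreeMarkov S A B) (E : FreeMarkov S B C),
    map (D.comp E) = (map D).comp (map E)
  map_tensor : ∀ {A B A' B' : Word S} (D : FreeMarkov S A B) (E : FreeMarkov S A' B'),
    (map (D.tensor E)).comp (split obj B B') = (split obj A A').comp ((map D).tensor (map E))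
  map_swap : ∀ A B : Word S,
    (map (FreeMarkov.swap A B)).comp (split obj B A) = (split obj A B).comp (DJoint.swap _ _)
  map_copy : ∀ A : Word S, (map (FreeMarkov.copy A)).comp (split obj A A) = DJoint.copy _
  map_discard : ∀ A : Word S,
    (map (FreeMarkov.discard A)).comp (DJoint.discard _) = DJoint.discard _

/-! ### Joint densities of diagrams -/

/-- The `i`-th coordinate of a point of a finite product. -/
def SbsPres.proj {ι : Type} [Fintype ι] (P : ι → SbsPres.{u}) (i : ι)
    (m : (SbsPres.pi ι P).carrier) : (P i).carrier :=
  (show ∀ i, (P i).carrier from m) i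

theorem SbsPres.measurable_proj {ι : Type} [Fintype ι] (P : ι → SbsPres.{u}) (i : ι) :
    Measurable (SbsPres.proj P i) :=
  measurable_pi_apply (X := fun i => (P i).carrier) i

namespace Diagram

variable {S : Hypergraph} {M : KernelCat.{u}} (obj : S.W → M.Ob) {A B : Word S}
  (D : Diagram S A B)

theorem lab_dom (c : D.G.B) (i : Fin (S.dom (D.lab.onB c)).length) :
    D.lab.onW ((D.G.dom c).get (i.cast (by rw [D.lab.dom_eq, List.length_map]))) =
      (S.dom (D.lab.onB c)).get i := by
  simp [D.lab.dom_eq]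

theorem lab_cod (c : D.G.B) (i : Fin (S.cod (D.lab.onB c)).length) :
    D.lab.onW ((D.G.cod c).get (i.cast (by rw [D.lab.cod_eq, List.length_map]))) =
      (S.cod (D.lab.onB c)).get i := by
  simp [D.lab.cod_eq]

/-- An assignment of values to all wires of the diagram. -/
abbrev Val : Type u := ∀ w : D.G.W, (obj (D.lab.onW w)).carrier

/-- The values at the inputs of the diagram. -/
def inputs (v : D.Val obj) : (wordOb obj A).carrier := reindex obj D.lab.onW A.lab D.p D.p_lab v

/-- The values at the outputs of the diagram. -/
def outputs (v : D.Val obj) : (wordOb obj B).carrier := reindex obj D.lab.onW B.lab D.q D.q_lab v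

/-- The values at the input wires of the box `c`. -/
def domVal (c : D.G.B) (v : D.Val obj) :
    (wordOb obj (.ofList (S.dom (D.lab.onB c)))).carrier :=
  reindex obj D.lab.onW (S.dom (D.lab.onB c)).get
    (fun i => (D.G.dom c).get (i.cast (by rw [D.lab.dom_eq, List.length_map]))) (D.lab_dom c) v

/-- The values at the output wires of the box `c`. -/
def codVal (c : D.G.B) (v : D.Val obj) :
    (wordOb obj (.ofList (S.cod (D.lab.onB c)))).carrier :=
  reindex obj D.lab.onW (S.cod (D.lab.onB c)).get
    (fun i => (D.G.cod c).get (i.cast (by rw [D.lab.cod_eq, List.length_map]))) (D.lab_cod c) v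

theorem measurable_inputs : Measurable (D.inputs obj) := measurable_reindex obj _ _ _ _
theorem measurable_outputs : Measurable (D.outputs obj) := measurable_reindex obj _ _ _ _
theorem measurable_domVal (c : D.G.B) : Measurable (D.domVal obj c) :=
  measurable_reindex obj _ _ _ _
theorem measurable_codVal (c : D.G.B) : Measurable (D.codVal obj c) :=
  measurable_reindex obj _ _ _ _

/-- The product of the residuals of all boxes of the diagram. -/
abbrev residual (P : S.B → SbsPres.{u}) : SbsPres.{u} :=
  .pi D.G.B fun c => P (D.lab.onB c)

/-- `K` is the joint mechanism of the diagram, when box `b` of the signature is interpreted by the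
joint density kernel `a b`: a deterministic morphism of `M` computing, from the residuals of all
boxes and the inputs, the values of all wires, such that the input wires carry the inputs and the
output wires of each box are obtained by applying its mechanism to its residual and its inputs. -/
structure IsMechanism (P : S.B → SbsPres.{u})
    (a : ∀ b, JointDensityKernel M (P b) (wordOb obj (.ofList (S.dom b))).carrier
      (wordOb obj (.ofList (S.cod b))).carrier)
    (K : Kernel ((D.residual P).carrier × (wordOb obj A).carrier) (D.Val obj)) : Prop where
  mem : M.Hom K
  det : IsDeterministic K
  inputs_eq : K.map (D.inputs obj) = Kernel.deterministic Prod.snd measurable_snd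
  box_eq : ∀ c : D.G.B, K.map (D.codVal obj c) =
    (a (D.lab.onB c)).k ∘ₖ (Kernel.deterministic
        (fun y : (D.residual P).carrier × (wordOb obj A).carrier => SbsPres.proj _ c y.1)
        ((SbsPres.measurable_proj _ c).comp measurable_fst) ×ₖ K.map (D.domVal obj c))

/-- The product over all boxes `c` of the densities `p_c(m_c | x_c)`, where `x_c` are the values of
the input wires of `c` determined by the residuals `m` and the inputs `z` through the joint
mechanism `K`. (The integral against the deterministic kernel `K` is evaluation at `v` whenever
`K (m, z)` is the point mass at `v`.) -/
noncomputable def productDensity (P : S.B → SbsPres.{u})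
    (p : ∀ b, (wordOb obj (.ofList (S.dom b))).carrier → (P b).carrier → ℝ≥0∞)
    (K : Kernel ((D.residual P).carrier × (wordOb obj A).carrier) (D.Val obj))
    (z : (wordOb obj A).carrier) (m : (D.residual P).carrier) : ℝ≥0∞ :=
  ∏ c : D.G.B, ∫⁻ v, p (D.lab.onB c) (D.domVal obj c v) (SbsPres.proj _ c m) ∂K (m, z)

end Diagram

end JointDensity

open JointDensity

/-!
For the existence of densities alone, structure is irrelevant: residuals are standard Borel with
σ-finite base measure, so the Radon–Nikodym derivative of a kernel that is everywhere absolutely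
continuous can be chosen jointly measurable (`JointDensity.exists_isDensity`).

For the factorization, the denotation of a morphism of `dJoint(M)` is a Markov kernel, and
everything is proved about the kernels `StrictMarkovFunctor.kernel` that a functor assigns to
diagrams. The main induction, `StrictMarkovFunctor.exists_joint`, is on the number of boxes. It
produces a joint density kernel into the values of *all* wires, whose mechanism is the required `K`;
the outputs of the diagram are then read off.

* Without boxes a diagram is a wiring. A wiring denotes the expected rearrangement of coordinates
  (`StrictMarkovFunctor.kernel_wiring`): a kernel into a finite product whose marginals are
  deterministic functions is deterministic, and the projections are tensor products of identities
  and delete maps.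
* By acyclicity a diagram with boxes has a sink `c`, a box none of whose outputs is an input of a
  box. Deleting `c` and its outputs leaves a diagram `D'`. If the outputs of `D'` are chosen to be
  all its wires followed by copies of the inputs of `c`, then `D'` followed by `id ⊗ ⟨c⟩` is the
  original diagram with all wires as outputs (`FreeMarkov.removeBox_comp_iso`). On the side of joint
  density kernels, the one for `D'` is composed with the one for `c`, which keeps its input
  (`Diagram.addSink`). The density of such a composite is the density for `D'` times the density of
  `c` averaged over the mechanism of `D'` (`JointDensityKernel.isDensity_comp`), and as the values
  of the wires of `D'` do not depend on the residual of `c` (`Diagram.map_addSink_k_of_rest`), this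
  is the product over all boxes.

The mechanisms are deterministic kernels, which need not be point masses on a general measurable
space, so that all computations are carried out with kernels. Determinism enters through
`JointDensityKernel.denote_comp`: a mechanism may be copied.
-/

namespace JointDensity

/-! ### Densities and denotations -/

theorem exists_isDensity {Z : Type u} [MeasurableSpace Z] {P : SbsPres.{u}}
    {f : Kernel Z P.carrier} (hf : IsDensityKernel P f) : ∃ p, IsDensity P f p := by
  have := hf.1
  -- `Kernel.rnDeriv` requires a finite reference kernel, whence the detour through an equivalent
  -- finite measure: the density is the product of the derivatives along `f z ≪ ν ≪ P.base`.
  let ν : Measure P.carrier := P.base.toFinite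
  let η : Kernel Z P.carrier := Kernel.const Z ν
  have hν : Measurable (ν.rnDeriv P.base) := Measure.measurable_rnDeriv _ _
  have hη : Measurable fun x : Z × P.carrier => f.rnDeriv η x.1 x.2 :=
    Kernel.measurable_rnDeriv f η
  refine ⟨fun z m => ν.rnDeriv P.base m * f.rnDeriv η z m, ?_, fun z => ?_⟩
  · exact (hν.comp measurable_snd).mul hη
  · have h1 : P.base.withDensity (ν.rnDeriv P.base) = ν :=
      Measure.withDensity_rnDeriv_eq _ _ (toFinite_absolutelyContinuous _)
    have h2 : f z ≪ η z := (hf.2 z).trans (absolutelyContinuous_toFinite _)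
    have h3 := Kernel.withDensity_rnDeriv_eq h2
    change _ = P.base.withDensity (ν.rnDeriv P.base * f.rnDeriv η z)
    rw [withDensity_mul _ hν (Kernel.measurable_rnDeriv_right f η z), h1, ← h3,
      Kernel.withDensity_apply _ (Kernel.measurable_rnDeriv f η)]
    rfl

namespace DJoint

variable {M : KernelCat.{u}} {X Y Z W : M.Ob}

/-- The Markov kernel denoted by a morphism of `dJoint(M)`. -/
noncomputable def kernel (a : DJoint M Z X) : Kernel Z.carrier X.carrier :=
  Quotient.lift (fun a => a.2.denote) (fun _ _ h => h) a

/-- By definition, morphisms of `dJoint(M)` are identified exactly when their denotations agree. -/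
theorem kernel_injective : Function.Injective (kernel : DJoint M Z X → _) := by
  intro a b
  refine Quotient.inductionOn₂ a b fun a b h => Quotient.sound h

instance (a : DJoint M Z X) : IsMarkovKernel a.kernel := by
  refine Quotient.inductionOn a fun a => ?_
  exact inferInstanceAs (IsMarkovKernel a.2.denote)

theorem kernel_comp (a : DJoint M Z X) (b : DJoint M X Y) :
    (a.comp b).kernel = b.kernel ∘ₖ a.kernel :=
  Quotient.inductionOn₂ a b fun a b => JointDensityKernel.denote_comp a.2 b.2

theorem kernel_tensor (a : DJoint M Z X) (b : DJoint M W Y) :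
    (a.tensor b).kernel = (a.kernel ∥ₖ b.kernel :
      Kernel (Z.carrier × W.carrier) (X.carrier × Y.carrier)) :=
  Quotient.inductionOn₂ a b fun a b => JointDensityKernel.denote_tensor a.2 b.2

theorem kernel_pure (g : Z.carrier → X.carrier) (hg : Measurable g)
    (h : M.Hom (Kernel.deterministic g hg)) :
    (pure g hg h).kernel = Kernel.deterministic g hg :=
  JointDensityKernel.denote_pure _ h (isDeterministic_det hg)

end DJoint

/-- A kernel into a finite product all of whose marginals are deterministic functions is itself
deterministic: on a measurable box it is `0` or `1` because a finite union of null sets is null. -/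
theorem eq_deterministic_of_marginals {Z : Type*} [MeasurableSpace Z] {ι : Type*} [Finite ι]
    {X : ι → Type*} [∀ i, MeasurableSpace (X i)] {κ : Kernel Z (∀ i, X i)} [IsMarkovKernel κ]
    {g : Z → ∀ i, X i} (hg : Measurable g)
    (h : ∀ i, κ.map (fun x => x i) = Kernel.deterministic (fun z => g z i)
      ((measurable_pi_apply i).comp hg)) :
    κ = Kernel.deterministic g hg := by
  have := Fintype.ofFinite ι
  ext z : 1
  refine MeasureTheory.ext_of_generate_finite _ generateFrom_pi.symm isPiSystem_pi ?_ (by simp)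
  rintro _ ⟨s, hs, rfl⟩
  have hs' : ∀ i, MeasurableSet (s i) := fun i => hs i (Set.mem_univ i)
  have hi : ∀ i, κ z ((fun x : ∀ i, X i => x i) ⁻¹' (s i)ᶜ) = (s i)ᶜ.indicator 1 (g z i) := by
    intro i
    have := DFunLike.congr_fun (DFunLike.congr_fun (h i) z) (s i)ᶜ
    rw [Kernel.map_apply' _ (by fun_prop) _ (hs' i).compl,
      Kernel.deterministic_apply' _ _ (hs' i).compl] at this
    rw [this]
    rfl
  have hm : MeasurableSet (Set.univ.pi s) := MeasurableSet.univ_pi hs'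
  rw [Kernel.deterministic_apply' _ _ hm]
  by_cases hz : g z ∈ Set.univ.pi s
  · rw [Set.indicator_of_mem hz, ← prob_compl_eq_zero_iff hm]
    have : (Set.univ.pi s)ᶜ ⊆ ⋃ i, (fun x : ∀ i, X i => x i) ⁻¹' (s i)ᶜ := by
      intro x hx
      simpa [Set.mem_pi] using hx
    refine measure_mono_null this (measure_iUnion_null fun i => ?_)
    rw [hi, Set.indicator_of_notMem]
    exact fun h => h (hz i (Set.mem_univ i))
  · rw [Set.indicator_of_notMem hz]
    simp only [Set.mem_pi, Set.mem_univ, true_imp_iff, not_forall] at hz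
    obtain ⟨i, hz⟩ := hz
    refine measure_mono_null (t := (fun x : ∀ i, X i => x i) ⁻¹' (s i))
      (fun x hx => hx i (Set.mem_univ i)) ?_
    have := prob_compl_eq_one_iff (μ := κ z) ((measurable_pi_apply i) (hs' i))
    refine this.1 ?_
    rw [← Set.preimage_compl, hi, Set.indicator_of_mem hz]
    rfl

/-! ### Isomorphisms of composite diagrams -/

section Diagrams

theorem map_eq_map_pmap {α β : Type} {P : α → Prop} (l : List α) (H : ∀ a ∈ l, P a) (f : α → β)
    (g : {a // P a} → β) (h : ∀ a, g a = f a.1) : l.map f = (l.pmap Subtype.mk H).map g := by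
  rw [List.map_pmap, ← List.pmap_eq_map (p := P) (f := f) H]
  exact List.pmap_congr_left _ fun a _ h₁ _ => (h ⟨a, h₁⟩).symm

theorem map_eq_map_map {α β γ : Type} (l : List α) (f : α → β) (g : β → γ) (k : α → γ)
    (h : ∀ a, g (f a) = k a) : l.map k = (l.map f).map g := by
  rw [List.map_map]
  exact List.map_congr_left fun a _ => (h a).symm

variable {S : Hypergraph} {A B C : Word S}

namespace FreeMarkov

/-- A diagram that is isomorphic to a morphism of the free Markov category has no box to delete. -/
theorem not_dead_of_iso {X : Diagram S A B} {T : FreeMarkov S A B} (h : X.Iso T.toDiagram)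
    (b : X.G.B) : ¬ X.Dead b := by
  obtain ⟨eW, eB, hdom, hcod, -, -, -, hq⟩ := h
  intro hb
  -- In `T` some output wire of the box reaches an output of the diagram or another box. The former
  -- is excluded by deadness, and in the latter case that box is again dead.
  induction hb with
  | intro b hbq _ ih =>
    obtain ⟨w, hw, hc⟩ := T.connected (eB b)
    rw [hcod] at hw
    obtain ⟨v, hv, rfl⟩ := List.mem_map.1 hw
    rcases hc with ⟨j, hj⟩ | ⟨b', hb'⟩
    · rw [hq] at hj
      exact hbq v hv ⟨j, eW.injective hj⟩
    · obtain ⟨b', rfl⟩ := eB.surjective b'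
      rw [hdom] at hb'
      obtain ⟨v', hv', h⟩ := List.mem_map.1 hb'
      obtain rfl := eW.injective h
      exact ih _ hv b' hv'

/-- If a diagram is isomorphic to a morphism of the free Markov category, its normalization, which
deletes nothing, is isomorphic to the same morphism. -/
theorem normalize_iso {X : FreeCD S A B} {T : FreeMarkov S A B}
    (h : X.toDiagram.Iso T.toDiagram) : X.normalize.toDiagram.Iso T.toDiagram := by
  have hd := not_dead_of_iso h
  obtain ⟨eW, eB, hdom, hcod, hw, hb, hp, hq⟩ := h
  have hr : ∀ w, X.Remains w := fun w =>
    (X.exists_start w).imp_right fun ⟨b, hb⟩ => ⟨b, hd b, hb⟩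
  refine ⟨(Equiv.subtypeUnivEquiv hr).trans eW, (Equiv.subtypeUnivEquiv hd).trans eB,
    fun b => ?_, fun b => ?_, fun w => hw w.1, fun b => hb b.1, hp, hq⟩
  · exact (hdom b.1).trans (map_eq_map_pmap _ (X.remains_dom b.2) eW _ fun _ => rfl)
  · exact (hcod b.1).trans (map_eq_map_pmap _ (X.remains_cod b.2) eW _ fun _ => rfl)

/-- A diagram `T` is the composite of `D` and `E` if it is covered by copies of `D` and `E` that
overlap exactly in the wires along which they are composed. -/
theorem comp_iso {D : FreeMarkov S A B} {E : FreeMarkov S B C} {T : FreeMarkov S A C}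
    (iD : D.G.W → T.G.W) (iE : E.G.W → T.G.W) (jD : D.G.B → T.G.B) (jE : E.G.B → T.G.B)
    (hpq : ∀ i, iE (E.p i) = iD (D.q i))
    (hW : Function.Bijective
      (Sum.elim iD fun w : {w : E.G.W // w ∉ Set.range E.p} => iE w.1))
    (hB : Function.Bijective (Sum.elim jD jE))
    (hdomD : ∀ b, T.G.dom (jD b) = (D.G.dom b).map iD)
    (hdomE : ∀ b, T.G.dom (jE b) = (E.G.dom b).map iE)
    (hcodD : ∀ b, T.G.cod (jD b) = (D.G.cod b).map iD)
    (hcodE : ∀ b, T.G.cod (jE b) = (E.G.cod b).map iE)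
    (hlabD : ∀ b, T.lab.onB (jD b) = D.lab.onB b)
    (hlabE : ∀ b, T.lab.onB (jE b) = E.lab.onB b)
    (hwD : ∀ w, T.lab.onW (iD w) = D.lab.onW w)
    (hwE : ∀ w, T.lab.onW (iE w) = E.lab.onW w)
    (hp : ∀ i, T.p i = iD (D.p i)) (hq : ∀ j, T.q j = iE (E.q j)) :
    (D.comp E).toDiagram.Iso T.toDiagram := by
  have hglue : ∀ w, Sum.elim iD (fun w : {w : E.G.W // w ∉ Set.range E.p} => iE w.1)
      (FreeCD.glueMap D.toFreeCD E.toFreeCD w) = iE w := by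
    intro w
    by_cases h : w ∈ Set.range E.p
    · obtain ⟨i, rfl⟩ := h
      rw [FreeCD.glueMap_p, Sum.elim_inl, hpq]
    · rw [FreeCD.glueMap_of_notMem _ _ h, Sum.elim_inr]
  refine normalize_iso ⟨Equiv.ofBijective _ hW, Equiv.ofBijective _ hB, ?_, ?_, ?_, ?_, hp,
    fun j => (hq j).trans (hglue _).symm⟩
  · rintro (b | b)
    · exact (hdomD b).trans (map_eq_map_map _ Sum.inl _ _ fun _ => rfl)
    · exact (hdomE b).trans (map_eq_map_map _ _ _ _ hglue)
  · rintro (b | b)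
    · exact (hcodD b).trans (map_eq_map_map _ Sum.inl _ _ fun _ => rfl)
    · exact (hcodE b).trans (map_eq_map_map _ _ _ _ hglue)
  · rintro (w | w)
    · exact hwD w
    · exact hwE w.1
  · rintro (b | b)
    · exact hlabD b
    · exact hlabE b

/-- Composing with a wiring only changes the outputs of a diagram. -/
theorem comp_wiring_iso {D : FreeMarkov S A B} {T : FreeMarkov S A C} (g : Fin C.n → Fin B.n)
    (hg : ∀ j, B.lab (g j) = C.lab j) (eW : D.G.W ≃ T.G.W) (eB : D.G.B ≃ T.G.B)
    (hdom : ∀ b, T.G.dom (eB b) = (D.G.dom b).map eW)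
    (hcod : ∀ b, T.G.cod (eB b) = (D.G.cod b).map eW)
    (hlab : ∀ b, T.lab.onB (eB b) = D.lab.onB b) (hw : ∀ w, T.lab.onW (eW w) = D.lab.onW w)
    (hp : ∀ i, T.p i = eW (D.p i)) (hq : ∀ j, T.q j = eW (D.q (g j))) :
    (D.comp (wiring g hg)).toDiagram.Iso T.toDiagram := by
  refine comp_iso eW (fun i => eW (D.q i)) eB Empty.elim (fun _ => rfl) ?_ ?_ hdom
    (fun b => Empty.elim b) hcod (fun b => Empty.elim b) hlab (fun b => Empty.elim b) hw
    (fun i => (hw _).trans (D.q_lab i)) hp hq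
  · refine ⟨?_, fun w => ?_⟩
    · rintro (w | ⟨w, hw⟩) (w' | ⟨w', hw'⟩) h
      · exact congrArg _ (eW.injective h)
      · exact (hw' ⟨w', rfl⟩).elim
      · exact (hw ⟨w, rfl⟩).elim
      · exact (hw ⟨w, rfl⟩).elim
    · obtain ⟨v, rfl⟩ := eW.surjective w
      exact ⟨.inl v, rfl⟩
  · refine ⟨?_, fun b => ?_⟩
    · rintro (b | b) (b' | b') h
      · exact congrArg _ (eB.injective h)
      · exact Empty.elim b'
      · exact Empty.elim b
      · exact Empty.elim b
    · obtain ⟨c, rfl⟩ := eB.surjective b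
      exact ⟨.inl c, rfl⟩

end FreeMarkov

end Diagrams

section Reindex

variable {S : Hypergraph} {M : KernelCat.{u}} (obj : S.W → M.Ob)

theorem tr_tr {w w' w'' : S.W} (h : w = w') (h' : w' = w'') (x : (obj w).carrier) :
    tr obj h' (tr obj h x) = tr obj (h.trans h') x := by
  subst h h'; rfl

theorem tr_apply_eq {ι : Type} {l : ι → S.W} (x : ∀ i, (obj (l i)).carrier) {i j : ι}
    (h : i = j) {w : S.W} (hi : l i = w) (hj : l j = w) :
    tr obj hi (x i) = tr obj hj (x j) := by
  subst h; rfl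

theorem reindex_reindex {ι κ μ : Type} {l : ι → S.W} {l' : κ → S.W} {l'' : μ → S.W}
    (g : κ → ι) (hg : ∀ j, l (g j) = l' j) (g' : μ → κ) (hg' : ∀ j, l' (g' j) = l'' j)
    (x : ∀ i, (obj (l i)).carrier) :
    reindex obj l' l'' g' hg' (reindex obj l l' g hg x) =
      reindex obj l l'' (fun j => g (g' j)) (fun j => (hg _).trans (hg' j)) x :=
  funext fun _ => tr_tr _ _ _ _

theorem reindex_congr {ι κ : Type} {l : ι → S.W} {l' : κ → S.W} {g g' : κ → ι}
    (h : ∀ j, g j = g' j) (hg : ∀ j, l (g j) = l' j) (hg' : ∀ j, l (g' j) = l' j)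
    (x : ∀ i, (obj (l i)).carrier) : reindex obj l l' g hg x = reindex obj l l' g' hg' x :=
  funext fun j => tr_apply_eq obj x (h j) _ _

/-- Concatenation of tuples, inverse to the identification `split`. -/
def joinFun (A B : Word S) (x : (wordOb obj A).carrier × (wordOb obj B).carrier) :
    (wordOb obj (A.tensor B)).carrier :=
  Fin.addCases (motive := fun i : Fin (A.n + B.n) => (obj ((A.tensor B).lab i)).carrier)
    (fun i => tr obj (Fin.append_left A.lab B.lab i).symm (x.1 i))
    (fun i => tr obj (Fin.append_right A.lab B.lab i).symm (x.2 i))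

theorem measurable_joinFun (A B : Word S) : Measurable (joinFun obj A B) := by
  refine measurable_pi_lambda _ fun i => ?_
  induction i using Fin.addCases with
  | left i =>
    simp only [joinFun, Fin.addCases_left]
    exact (measurable_tr obj _).comp ((measurable_pi_apply i).comp measurable_fst)
  | right i =>
    simp only [joinFun, Fin.addCases_right]
    exact (measurable_tr obj _).comp ((measurable_pi_apply i).comp measurable_snd)

/-- The function underlying the identification `split`. -/
def splitFun (A B : Word S) (x : (wordOb obj (A.tensor B)).carrier) :
    (wordOb obj A).carrier × (wordOb obj B).carrier :=
  (reindex obj (A.tensor B).lab A.lab (Fin.castAdd B.n)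
      (fun i => Fin.append_left A.lab B.lab i) x,
    reindex obj (A.tensor B).lab B.lab (Fin.natAdd A.n)
      (fun i => Fin.append_right A.lab B.lab i) x)

theorem measurable_splitFun (A B : Word S) : Measurable (splitFun obj A B) :=
  (measurable_reindex obj _ _ _ _).prodMk (measurable_reindex obj _ _ _ _)

theorem joinFun_splitFun (A B : Word S) (x : (wordOb obj (A.tensor B)).carrier) :
    joinFun obj A B (splitFun obj A B x) = x := by
  funext i
  induction i using Fin.addCases with
  | left i =>
    simp only [joinFun, Fin.addCases_left, splitFun, reindex]
    exact tr_tr _ _ _ _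
  | right i =>
    simp only [joinFun, Fin.addCases_right, splitFun, reindex]
    exact tr_tr _ _ _ _

theorem kernel_split (A B : Word S) : (split obj A B).kernel =
    Kernel.deterministic (splitFun obj A B) (measurable_splitFun obj A B) :=
  DJoint.kernel_pure _ _ _

end Reindex

/-! ### Strict Markov functors on wirings -/

theorem Word.ext_cast {S : Hypergraph} {A B : Word S} (h : A.n = B.n)
    (hl : ∀ i : Fin A.n, A.lab i = B.lab (i.cast h)) : A = B := by
  obtain ⟨n, l⟩ := A
  obtain ⟨m, l'⟩ := B
  obtain rfl : n = m := h
  exact congrArg _ (funext hl)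

namespace Word

variable {S : Hypergraph} (A B : Word S)

/-- The position of the `i`-th wire of `A` in `A ⊗ B`. -/
def inl (i : Fin A.n) : Fin (A.tensor B).n := Fin.castAdd B.n i

/-- The position of the `i`-th wire of `B` in `A ⊗ B`. -/
def inr (i : Fin B.n) : Fin (A.tensor B).n := Fin.natAdd A.n i

theorem lab_inl (i : Fin A.n) : (A.tensor B).lab (inl A B i) = A.lab i :=
  Fin.append_left A.lab B.lab i

theorem lab_inr (i : Fin B.n) : (A.tensor B).lab (inr A B i) = B.lab i :=
  Fin.append_right A.lab B.lab i

/-- The positions of `A ⊗ B` are those of `A` and those of `B`. -/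
def sumEquiv : Fin A.n ⊕ Fin B.n ≃ Fin (A.tensor B).n := finSumFinEquiv

theorem sumEquiv_inl (i : Fin A.n) : sumEquiv A B (.inl i) = inl A B i :=
  finSumFinEquiv_apply_left i

theorem sumEquiv_inr (i : Fin B.n) : sumEquiv A B (.inr i) = inr A B i :=
  finSumFinEquiv_apply_right i

variable {A B} in
theorem tensor_cases {P : Fin (A.tensor B).n → Prop} (hl : ∀ i, P (inl A B i))
    (hr : ∀ i, P (inr A B i)) (i : Fin (A.tensor B).n) : P i :=
  Fin.addCases (motive := P) hl hr i

end Word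

namespace FreeMarkov

variable {S : Hypergraph} {A B A' B' : Word S} (D : FreeMarkov S A B) (E : FreeMarkov S A' B')

theorem tensor_p_inl (i : Fin A.n) : (D.tensor E).p (Word.inl A A' i) = .inl (D.p i) :=
  Fin.append_left (fun i => (.inl (D.p i) : D.G.W ⊕ E.G.W)) (fun i => .inr (E.p i)) i

theorem tensor_p_inr (i : Fin A'.n) : (D.tensor E).p (Word.inr A A' i) = .inr (E.p i) :=
  Fin.append_right (fun i => (.inl (D.p i) : D.G.W ⊕ E.G.W)) (fun i => .inr (E.p i)) i

theorem tensor_q_inl (i : Fin B.n) : (D.tensor E).q (Word.inl B B' i) = .inl (D.q i) :=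
  Fin.append_left (fun i => (.inl (D.q i) : D.G.W ⊕ E.G.W)) (fun i => .inr (E.q i)) i

theorem tensor_q_inr (i : Fin B'.n) : (D.tensor E).q (Word.inr B B' i) = .inr (E.q i) :=
  Fin.append_right (fun i => (.inl (D.q i) : D.G.W ⊕ E.G.W)) (fun i => .inr (E.q i)) i

end FreeMarkov

section WordMap

variable {S : Hypergraph} {M : KernelCat.{u}} (obj : S.W → M.Ob) {A B C : Word S}

/-- The rearrangement of coordinates between the interpretations of two words. -/
def wordMap (g : Fin B.n → Fin A.n) (hg : ∀ j, A.lab (g j) = B.lab j)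
    (x : (wordOb obj A).carrier) : (wordOb obj B).carrier :=
  reindex obj A.lab B.lab g hg x

@[fun_prop]
theorem measurable_wordMap (g : Fin B.n → Fin A.n) (hg : ∀ j, A.lab (g j) = B.lab j) :
    Measurable (wordMap obj g hg) :=
  measurable_reindex obj A.lab B.lab g hg

theorem wordMap_wordMap (g : Fin B.n → Fin A.n) (hg : ∀ j, A.lab (g j) = B.lab j)
    (g' : Fin C.n → Fin B.n) (hg' : ∀ j, B.lab (g' j) = C.lab j) (x : (wordOb obj A).carrier) :
    wordMap obj g' hg' (wordMap obj g hg x) =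
      wordMap obj (B := C) (fun j => g (g' j)) (fun j => (hg _).trans (hg' j)) x :=
  reindex_reindex obj g hg g' hg' x

theorem wordMap_congr {g g' : Fin B.n → Fin A.n} (h : ∀ j, g j = g' j)
    (hg : ∀ j, A.lab (g j) = B.lab j) (hg' : ∀ j, A.lab (g' j) = B.lab j)
    (x : (wordOb obj A).carrier) : wordMap obj g hg x = wordMap obj g' hg' x :=
  reindex_congr obj h hg hg' x

end WordMap

namespace StrictMarkovFunctor

open FreeMarkov

variable {S : Hypergraph} {M : KernelCat.{u}} (F : StrictMarkovFunctor S M) {A B C A' B' : Word S}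

/-- The Markov kernel denoted by the image of a diagram. -/
noncomputable def kernel (D : FreeMarkov S A B) :
    Kernel (wordOb F.obj A).carrier (wordOb F.obj B).carrier :=
  (F.map D).kernel

instance (D : FreeMarkov S A B) : IsMarkovKernel (F.kernel D) :=
  inferInstanceAs (IsMarkovKernel (F.map D).kernel)

theorem kernel_iso {D E : FreeMarkov S A B} (h : D.toDiagram.Iso E.toDiagram) :
    F.kernel D = F.kernel E :=
  congrArg DJoint.kernel (F.map_iso D E h)

theorem kernel_comp (D : FreeMarkov S A B) (E : FreeMarkov S B C) :
    F.kernel (D.comp E) = F.kernel E ∘ₖ F.kernel D :=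
  (congrArg DJoint.kernel (F.map_comp D E)).trans (DJoint.kernel_comp _ _)

/-- A strict Markov functor preserves tensor products, up to the identification of tuples indexed by
`A ⊗ B` with pairs of tuples. -/
theorem kernel_tensor (D : FreeMarkov S A B) (E : FreeMarkov S A' B') :
    (F.kernel (D.tensor E)).map (splitFun F.obj B B') =
      (F.kernel D ∥ₖ F.kernel E).comap (splitFun F.obj A A') (measurable_splitFun _ _ _) := by
  have h := congrArg DJoint.kernel (F.map_tensor D E)
  rw [DJoint.kernel_comp, DJoint.kernel_comp, kernel_split, kernel_split,
    DJoint.kernel_tensor] at h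
  rw [← Kernel.deterministic_comp_eq_map (measurable_splitFun _ _ _),
    ← Kernel.comp_deterministic_eq_comap]
  exact h

/-- A wiring that identifies two equal words denotes the corresponding relabelling. -/
theorem kernel_wiring_cast (h : A = B) (g : Fin B.n → Fin A.n) (hv : ∀ j, (g j).val = j.val)
    (hg : ∀ j, A.lab (g j) = B.lab j) :
    F.kernel (wiring g hg) =
      Kernel.deterministic (wordMap F.obj g hg) (measurable_wordMap _ _ _) := by
  subst h
  obtain rfl : g = _root_.id := funext fun j => Fin.ext (hv j)
  exact (congrArg DJoint.kernel (F.map_id A)).trans (DJoint.kernel_pure _ _ _)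

/-- Composing wirings composes the functions on positions, in the opposite order. -/
theorem kernel_comp_wiring (g : Fin B.n → Fin A.n) (hg : ∀ j, A.lab (g j) = B.lab j)
    (g' : Fin C.n → Fin B.n) (hg' : ∀ j, B.lab (g' j) = C.lab j) :
    F.kernel (wiring g' hg') ∘ₖ F.kernel (wiring g hg) =
      F.kernel (wiring (A := A) (B := C) (fun j => g (g' j)) fun j => (hg _).trans (hg' j)) := by
  rw [← kernel_comp]
  exact F.kernel_iso (comp_wiring_iso g' hg' (Equiv.refl (Fin A.n)) (Equiv.refl Empty)
    (fun b => Empty.elim b) (fun b => Empty.elim b) (fun b => Empty.elim b) (fun _ => rfl)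
    (fun _ => rfl) fun _ => rfl)

theorem kernel_id (A : Word S) : F.kernel (FreeMarkov.id A) = Kernel.id :=
  (congrArg DJoint.kernel (F.map_id A)).trans (DJoint.kernel_pure _ _ _)

/-- The first projection `A ⊗ B → A` is `id ⊗ discard` up to the identification of `A ⊗ I` with
`A`. -/
theorem kernel_wiring_inl (A B : Word S) :
    F.kernel (wiring (Word.inl A B) (Word.lab_inl A B)) =
      Kernel.deterministic (wordMap F.obj (Word.inl A B)
        (Word.lab_inl A B)) (measurable_wordMap _ _ _) := by
  have hunit : A.tensor .unit = A := Word.ext_cast rfl fun i => Word.lab_inl A .unit i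
  have hiso : (((FreeMarkov.id A).tensor (FreeMarkov.discard B)).comp
      (wiring (Word.inl A .unit) (Word.lab_inl A .unit))).toDiagram.Iso
      (wiring (Word.inl A B) (Word.lab_inl A B)).toDiagram := by
    refine comp_wiring_iso _ _ (Word.sumEquiv A B) (Equiv.sumEmpty Empty Empty) ?_ ?_ ?_ ?_ ?_ ?_
    · rintro (b | b) <;> exact b.elim
    · rintro (b | b) <;> exact b.elim
    · rintro (b | b) <;> exact b.elim
    · rintro (w | w)
      · exact Word.lab_inl A B w
      · exact Word.lab_inr A B w
    · refine Word.tensor_cases (fun i => ?_) fun i => ?_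
      · rw [tensor_p_inl]; exact (Word.sumEquiv_inl A B i).symm
      · rw [tensor_p_inr]; exact (Word.sumEquiv_inr A B i).symm
    · intro j
      rw [tensor_q_inl]; exact (Word.sumEquiv_inl A B j).symm
  rw [← F.kernel_iso hiso, kernel_comp,
    F.kernel_wiring_cast hunit (Word.inl A .unit) (fun _ => rfl),
    Kernel.deterministic_comp_eq_map]
  have h := congrArg (fun κ => κ.map Prod.fst)
    (F.kernel_tensor (FreeMarkov.id A) (FreeMarkov.discard B))
  rw [← Kernel.map_comp_right _ (measurable_splitFun _ _ _) measurable_fst] at h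
  refine h.trans ?_
  ext x : 1
  rw [Kernel.map_apply _ measurable_fst, Kernel.comap_apply, Kernel.parallelComp_apply,
    ← Measure.fst, Measure.fst_prod, kernel_id]
  rfl

/-- The second projection `A ⊗ B → B` is `discard ⊗ id` up to the identification of `I ⊗ B` with
`B`, which are equal words but not definitionally so. -/
theorem kernel_wiring_inr (A B : Word S) :
    F.kernel (wiring (Word.inr A B) (Word.lab_inr A B)) =
      Kernel.deterministic (wordMap F.obj (Word.inr A B)
        (Word.lab_inr A B)) (measurable_wordMap _ _ _) := by
  have hunit : Word.unit.tensor B = B := by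
    refine Word.ext_cast (Nat.zero_add _) (Word.tensor_cases (fun i => i.elim0) fun i => ?_)
    exact (Word.lab_inr .unit B i).trans (congrArg B.lab (Fin.ext (Nat.zero_add _).symm))
  have hiso : (((FreeMarkov.discard A).tensor (FreeMarkov.id B)).comp
      (wiring (Word.inr .unit B) (Word.lab_inr .unit B))).toDiagram.Iso
      (wiring (Word.inr A B) (Word.lab_inr A B)).toDiagram := by
    refine comp_wiring_iso _ _ (Word.sumEquiv A B) (Equiv.sumEmpty Empty Empty) ?_ ?_ ?_ ?_ ?_ ?_
    · rintro (b | b) <;> exact b.elim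
    · rintro (b | b) <;> exact b.elim
    · rintro (b | b) <;> exact b.elim
    · rintro (w | w)
      · exact Word.lab_inl A B w
      · exact Word.lab_inr A B w
    · refine Word.tensor_cases (fun i => ?_) fun i => ?_
      · rw [tensor_p_inl]; exact (Word.sumEquiv_inl A B i).symm
      · rw [tensor_p_inr]; exact (Word.sumEquiv_inr A B i).symm
    · intro j
      rw [tensor_q_inr]; exact (Word.sumEquiv_inr A B j).symm
  rw [← F.kernel_iso hiso, kernel_comp, F.kernel_wiring_cast hunit _ (fun j => Nat.zero_add _),
    Kernel.deterministic_comp_eq_map]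
  have h := congrArg (fun κ => κ.map Prod.snd)
    (F.kernel_tensor (FreeMarkov.discard A) (FreeMarkov.id B))
  rw [← Kernel.map_comp_right _ (measurable_splitFun _ _ _) measurable_snd] at h
  refine h.trans ?_
  ext x : 1
  rw [Kernel.map_apply _ measurable_snd, Kernel.comap_apply, Kernel.parallelComp_apply,
    ← Measure.snd, Measure.snd_prod, kernel_id]
  rfl

/-- The `i`-th projection: `A` is `(A₁ ⊗ Aᵢ) ⊗ A₂`, from which `A₁` and `A₂` are discarded. -/
theorem kernel_wiring_single (i : Fin A.n) :
    F.kernel (wiring (A := A) (B := ⟨1, fun _ => A.lab i⟩) (fun _ => i) fun _ => rfl) =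
      Kernel.deterministic (wordMap F.obj (A := A) (B := ⟨1, fun _ => A.lab i⟩)
        (fun _ => i) fun _ => rfl) (measurable_wordMap _ _ _) := by
  let A₁ : Word S := ⟨i, fun k => A.lab ⟨k, k.2.trans i.2⟩⟩
  let a : Word S := ⟨1, fun _ => A.lab i⟩
  let A₂ : Word S := ⟨A.n - (i + 1), fun k => A.lab ⟨i + 1 + k, by omega⟩⟩
  have hn : ((A₁.tensor a).tensor A₂).n = A.n := by
    change i + 1 + (A.n - (i + 1)) = A.n
    omega
  have hl : ∀ k, ((A₁.tensor a).tensor A₂).lab k = A.lab (Fin.cast hn k) := by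
    refine Word.tensor_cases (fun k => ?_) fun k => Word.lab_inr _ _ k
    rw [Word.lab_inl]
    revert k
    refine Word.tensor_cases (fun k => Word.lab_inl _ _ k) fun k => ?_
    refine (Word.lab_inr _ _ k).trans (congrArg A.lab (Fin.ext ?_))
    change i.val = i.val + k.val
    have := k.2
    change k.val < 1 at this
    omega
  have hA : A = (A₁.tensor a).tensor A₂ := (Word.ext_cast hn hl).symm
  have h1 := F.kernel_wiring_cast hA (Fin.cast hn) (fun _ => rfl) (fun k => (hl k).symm)
  have h2 := F.kernel_wiring_inl (A₁.tensor a) A₂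
  have h3 := F.kernel_wiring_inr A₁ a
  have hi : ∀ j : Fin 1, Fin.cast hn (Word.inl (A₁.tensor a) A₂ (Word.inr A₁ a j)) = i := by
    intro j
    refine Fin.ext ?_
    change i.val + j.val = i.val
    omega
  have h4 := F.kernel_comp_wiring (A := A) _ (fun k => (hl k).symm)
    (Word.inl (A₁.tensor a) A₂) (Word.lab_inl _ _)
  have h5 := F.kernel_comp_wiring (A := A) _
    (fun j => (hl (Word.inl (A₁.tensor a) A₂ j)).symm.trans (Word.lab_inl _ _ j))
    (Word.inr A₁ a) (Word.lab_inr _ _)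
  rw [← h4, h1, h2, h3] at h5
  refine Eq.trans ?_ (h5.symm.trans ?_)
  · refine F.kernel_iso ⟨Equiv.refl (Fin A.n), Equiv.refl Empty, fun b => Empty.elim b,
      fun b => Empty.elim b, fun _ => rfl, fun b => Empty.elim b, fun _ => rfl, fun j => hi j⟩
  · rw [Kernel.deterministic_comp_deterministic, Kernel.deterministic_comp_deterministic]
    congr 1
    funext x
    refine (wordMap_wordMap _ _ _ _ _ _).trans ((wordMap_wordMap _ _ _ _ _ _).trans ?_)
    exact wordMap_congr F.obj hi _ _ x

/-- A strict Markov functor sends a wiring to the corresponding rearrangement of coordinates: each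
marginal of its image is the image of a wiring with a single output, which is a projection. -/
theorem kernel_wiring (g : Fin B.n → Fin A.n) (hg : ∀ j, A.lab (g j) = B.lab j) :
    F.kernel (wiring g hg) =
      Kernel.deterministic (wordMap F.obj g hg) (measurable_wordMap _ _ _) := by
  refine @eq_deterministic_of_marginals _ _ (Fin B.n) _ (fun j => (F.obj (B.lab j)).carrier) _
    (F.kernel (wiring g hg)) (inferInstanceAs (IsMarkovKernel (F.kernel (wiring g hg)))) _
    (measurable_wordMap F.obj g hg) fun j => ?_
  have h := F.kernel_comp_wiring g hg (C := ⟨1, fun _ => B.lab j⟩) (fun _ => j) fun _ => rfl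
  -- The labels `A.lab (g j)` and `B.lab j` are only propositionally equal, so the projection to
  -- position `g j` is followed by a relabelling.
  have h' := F.kernel_comp_wiring (A := A) (B := ⟨1, fun _ => A.lab (g j)⟩)
    (C := ⟨1, fun _ => B.lab j⟩) (fun _ => g j) (fun _ => rfl) (fun k => k) (fun _ => hg j)
  rw [kernel_wiring_single, Kernel.deterministic_comp_eq_map] at h
  rw [kernel_wiring_single, F.kernel_wiring_cast (congrArg (Word.mk 1) (funext fun _ => hg j)) _
    (fun _ => rfl), Kernel.deterministic_comp_deterministic] at h'
  have h2 := congrArg (fun κ => κ.map fun x => x (0 : Fin 1)) (h.trans h'.symm)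
  have hm : Measurable fun x : (wordOb F.obj ⟨1, fun _ => B.lab j⟩).carrier => x (0 : Fin 1) :=
    measurable_pi_apply (X := fun _ : Fin 1 => (F.obj (B.lab j)).carrier) 0
  rw [← Kernel.map_comp_right _ (measurable_wordMap _ _ _) hm] at h2
  refine h2.trans ?_
  rw [← Kernel.deterministic_comp_eq_map hm, Kernel.deterministic_comp_deterministic]
  rfl

end StrictMarkovFunctor

/-! ### Removing a sink from a diagram -/

section RemoveBox

variable {S : Hypergraph} {A B X : Word S}

/-- Case distinction on the positions of `A ⊗ B`. -/
def Word.elim {α : Type} (f : Fin A.n → α) (g : Fin B.n → α) : Fin (A.tensor B).n → α :=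
  Fin.append f g

theorem Word.elim_inl {α : Type} (f : Fin A.n → α) (g : Fin B.n → α) (i : Fin A.n) :
    Word.elim f g (Word.inl A B i) = f i := Fin.append_left f g i

theorem Word.elim_inr {α : Type} (f : Fin A.n → α) (g : Fin B.n → α) (i : Fin B.n) :
    Word.elim f g (Word.inr A B i) = g i := Fin.append_right f g i

theorem ofFn_get_cast {α : Type} (l : List α) {n : ℕ} (h : n = l.length) :
    List.ofFn (fun i : Fin n => l.get (i.cast h)) = l := by
  subst h
  exact List.ofFn_get l

namespace Diagram

variable (D : Diagram S A B) (c : D.G.B)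

/-- The word of input labels of a box. -/
abbrev domWord : Word S := .ofList (S.dom (D.lab.onB c))

/-- The word of output labels of a box. -/
abbrev codWord : Word S := .ofList (S.cod (D.lab.onB c))

theorem length_dom : (D.domWord c).n = (D.G.dom c).length := by
  change (S.dom (D.lab.onB c)).length = _
  rw [D.lab.dom_eq, List.length_map]

theorem length_cod : (D.codWord c).n = (D.G.cod c).length := by
  change (S.cod (D.lab.onB c)).length = _
  rw [D.lab.cod_eq, List.length_map]

/-- The `i`-th input wire of a box. -/
def domWire (i : Fin (D.domWord c).n) : D.G.W := (D.G.dom c).get (i.cast (D.length_dom c))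

/-- The `i`-th output wire of a box. -/
def codWire (i : Fin (D.codWord c).n) : D.G.W := (D.G.cod c).get (i.cast (D.length_cod c))

theorem ofFn_domWire : List.ofFn (D.domWire c) = D.G.dom c := ofFn_get_cast _ _

theorem ofFn_codWire : List.ofFn (D.codWire c) = D.G.cod c := ofFn_get_cast _ _

theorem mem_dom_iff {w : D.G.W} : w ∈ D.G.dom c ↔ ∃ i, D.domWire c i = w := by
  rw [← ofFn_domWire, List.mem_ofFn']
  rfl

theorem mem_cod_iff {w : D.G.W} : w ∈ D.G.cod c ↔ ∃ i, D.codWire c i = w := by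
  rw [← ofFn_codWire, List.mem_ofFn']
  rfl

theorem lab_domWire (i : Fin (D.domWord c).n) :
    D.lab.onW (D.domWire c i) = (D.domWord c).lab i := D.lab_dom c i

theorem lab_codWire (i : Fin (D.codWord c).n) :
    D.lab.onW (D.codWire c i) = (D.codWord c).lab i := D.lab_cod c i

/-- No output of the box is an input of a box. -/
def IsSink : Prop := ∀ w ∈ D.G.cod c, ∀ b, w ∉ D.G.dom b

theorem exists_isSink (hD : D.Acyclic) [Nonempty D.G.B] : ∃ c, D.IsSink c := by
  let r : D.G.B → D.G.B → Prop := fun b b' => Relation.TransGen D.Feeds b' b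
  have : IsTrans D.G.B r := ⟨fun _ _ _ h h' => h'.trans h⟩
  have : Std.Irrefl r := ⟨hD⟩
  obtain ⟨c, -, hc⟩ := (Finite.wellFounded_of_trans_of_irrefl r).has_min Set.univ Set.univ_nonempty
  exact ⟨c, fun w hw b hb => hc b trivial (.single ⟨w, hw, hb⟩)⟩

end Diagram

namespace FreeMarkov

open Diagram

theorem codWire_injective (D : FreeMarkov S A B) (c : D.G.B) :
    Function.Injective (D.codWire c) := by
  intro i j h
  exact Fin.cast_injective _ (List.nodup_iff_injective_get.1 (D.cod_nodup c) h)

/-- A box of the signature with at least one output is a morphism of the free Markov category. -/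
def boxOf (b : S.B) (hb : S.cod b ≠ []) :
    FreeMarkov S (.ofList (S.dom b)) (.ofList (S.cod b)) where
  toFreeCD := FreeCD.box b
  connected := fun _ => by
    have h : 0 < (S.cod b).length := List.length_pos_iff.2 hb
    exact ⟨.inr ⟨0, h⟩, (List.mem_ofFn' _ _).2 ⟨⟨0, h⟩, rfl⟩, .inl ⟨⟨0, h⟩, rfl⟩⟩

theorem box_iso (b : S.B) (hb : S.cod b ≠ []) :
    (box b).toDiagram.Iso (boxOf b hb).toDiagram :=
  normalize_iso ⟨Equiv.refl _, Equiv.refl _, fun _ => (List.map_id _).symm,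
    fun _ => (List.map_id _).symm, fun _ => rfl, fun _ => rfl, fun _ => rfl, fun _ => rfl⟩

variable (D : FreeMarkov S A B) {c : D.G.B}

theorem cod_ne_nil (c : D.G.B) : S.cod (D.lab.onB c) ≠ [] := by
  obtain ⟨w, hw, -⟩ := D.connected c
  rw [D.lab.cod_eq]
  exact List.ne_nil_of_mem (List.mem_map_of_mem hw)

open Classical in
/-- The diagram without a sink `c` and without the outputs of `c`. Its outputs are an enumeration
`e` of all remaining wires, followed by the input wires of `c`. -/
noncomputable def removeBox (hc : D.IsSink c) (e : Fin X.n → {w // w ∉ D.G.cod c})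
    (he : Function.Surjective e) (hl : ∀ i, D.lab.onW (e i).1 = X.lab i) :
    FreeMarkov S A (X.tensor (D.domWord c)) where
  G :=
    { W := {w // w ∉ D.G.cod c}
      B := {b // b ≠ c}
      dom := fun b => (D.G.dom b.1).pmap Subtype.mk fun w hw hw' => hc w hw' b.1 hw
      cod := fun b => (D.G.cod b.1).pmap Subtype.mk fun _ hw hw' => b.2 (D.cod_unique hw hw') }
  finW := inferInstanceAs (Finite {w // w ∉ D.G.cod c})
  fintypeB := inferInstanceAs (Fintype {b // b ≠ c})
  lab :=
    { onW := fun w => D.lab.onW w.1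
      onB := fun b => D.lab.onB b.1
      dom_eq := fun b => by simp [List.map_pmap, D.lab.dom_eq]
      cod_eq := fun b => by simp [List.map_pmap, D.lab.cod_eq] }
  p := fun i => ⟨D.p i, D.p_notMem_cod i c⟩
  q := Word.elim e fun i => ⟨D.domWire c i, fun h => hc _ h c ((D.mem_dom_iff c).2 ⟨i, rfl⟩)⟩
  p_lab := D.p_lab
  q_lab := by
    refine Word.tensor_cases (fun i => ?_) fun i => ?_
    · rw [Word.elim_inl, Word.lab_inl, hl]
    · rw [Word.elim_inr, Word.lab_inr, lab_domWire]
  acyclic := by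
    intro b hb
    refine D.acyclic b.1 (transGen_lift Subtype.val ?_ hb)
    rintro b b' ⟨w, h, h'⟩
    simp only [List.mem_pmap] at h h'
    obtain ⟨v, hv, rfl⟩ := h
    obtain ⟨v', hv', h⟩ := h'
    obtain rfl : v' = v := congrArg Subtype.val h
    exact ⟨v', hv, hv'⟩
  start_bij := by
    rw [start_bijective_iff]
    refine ⟨fun i j h => D.p_injective (congrArg Subtype.val h), fun b => ?_, ?_, ?_, ?_⟩
    · exact (D.cod_nodup b.1).pmap fun _ _ _ _ h => congrArg Subtype.val h
    · intro b b' w h h'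
      simp only [List.mem_pmap] at h h'
      obtain ⟨v, hv, rfl⟩ := h
      obtain ⟨v', hv', h⟩ := h'
      obtain rfl : v' = v := congrArg Subtype.val h
      exact Subtype.ext (D.cod_unique hv hv')
    · intro i b h
      simp only [List.mem_pmap] at h
      obtain ⟨v, hv, h⟩ := h
      obtain rfl : v = D.p i := congrArg Subtype.val h
      exact D.p_notMem_cod i _ hv
    · rintro ⟨w, hw⟩
      rcases D.exists_start w with ⟨i, rfl⟩ | ⟨b, hb⟩
      · exact .inl ⟨i, rfl⟩
      · exact .inr ⟨⟨b, fun h => hw (h ▸ hb)⟩, List.mem_pmap.2 ⟨w, hb, rfl⟩⟩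
  connected := by
    -- Boxes that fed only `c` stay connected because all remaining wires are outputs.
    rintro ⟨b, hb⟩
    obtain ⟨w, hw, -⟩ := D.connected b
    have hw' : w ∉ D.G.cod c := fun h => hb (D.cod_unique hw h)
    obtain ⟨i, hi⟩ := he ⟨w, hw'⟩
    exact ⟨⟨w, hw'⟩, List.mem_pmap.2 ⟨w, hw, rfl⟩, .inl ⟨Word.inl _ _ i,
      (Word.elim_inl _ _ i).trans hi⟩⟩

theorem removeBox_q_inl (hc : D.IsSink c) (e : Fin X.n → {w // w ∉ D.G.cod c})
    (he : Function.Surjective e) (hl : ∀ i, D.lab.onW (e i).1 = X.lab i) (i : Fin X.n) :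
    (D.removeBox hc e he hl).q (Word.inl X (D.domWord c) i) = e i :=
  Word.elim_inl e (fun i => (⟨D.domWire c i, _⟩ : {w // w ∉ D.G.cod c})) i

theorem removeBox_q_inr (hc : D.IsSink c) (e : Fin X.n → {w // w ∉ D.G.cod c})
    (he : Function.Surjective e) (hl : ∀ i, D.lab.onW (e i).1 = X.lab i)
    (i : Fin (D.domWord c).n) :
    ((D.removeBox hc e he hl).q (Word.inr X (D.domWord c) i)).1 = D.domWire c i :=
  congrArg Subtype.val
    (Word.elim_inr e (fun i => (⟨D.domWire c i, _⟩ : {w // w ∉ D.G.cod c})) i)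

/-- Every wire is in an enumeration of the wires that are not outputs of `c` or an output of
`c`. -/
theorem exists_elim_eq (c : D.G.B) {e : Fin X.n → {w // w ∉ D.G.cod c}}
    (he : Function.Surjective e) (w : D.G.W) :
    ∃ i, Word.elim (fun i => (e i).1) (D.codWire c) i = w := by
  by_cases hw : w ∈ D.G.cod c
  · obtain ⟨i, rfl⟩ := (D.mem_cod_iff c).1 hw
    exact ⟨Word.inr _ _ i, Word.elim_inr _ _ i⟩
  · obtain ⟨i, hi⟩ := he ⟨w, hw⟩
    exact ⟨Word.inl _ _ i, (Word.elim_inl _ _ i).trans (congrArg Subtype.val hi)⟩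

/-- The diagram with all wires as outputs: an enumeration of the wires that are not outputs of `c`,
followed by the outputs of `c`. -/
def expose (c : D.G.B) (e : Fin X.n → {w // w ∉ D.G.cod c})
    (he : Function.Surjective e) (hl : ∀ i, D.lab.onW (e i).1 = X.lab i) :
    FreeMarkov S A (X.tensor (D.codWord c)) where
  G := D.G
  finW := D.finW
  fintypeB := D.fintypeB
  lab := D.lab
  p := D.p
  q := Word.elim (fun i => (e i).1) (D.codWire c)
  p_lab := D.p_lab
  q_lab := by
    refine Word.tensor_cases (fun i => ?_) fun i => ?_
    · rw [Word.elim_inl, Word.lab_inl, hl]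
    · rw [Word.elim_inr, Word.lab_inr, lab_codWire]
  acyclic := D.acyclic
  start_bij := D.start_bij
  connected := fun b => by
    obtain ⟨w, hw, -⟩ := D.connected b
    exact ⟨w, hw, .inl (D.exists_elim_eq c he w)⟩

theorem expose_q_inl (c : D.G.B) (e : Fin X.n → {w // w ∉ D.G.cod c})
    (he : Function.Surjective e) (hl : ∀ i, D.lab.onW (e i).1 = X.lab i) (i : Fin X.n) :
    (D.expose c e he hl).q (Word.inl X (D.codWord c) i) = (e i).1 :=
  Word.elim_inl (fun i => (e i).1) (D.codWire c) i

theorem expose_q_inr (c : D.G.B) (e : Fin X.n → {w // w ∉ D.G.cod c})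
    (he : Function.Surjective e) (hl : ∀ i, D.lab.onW (e i).1 = X.lab i)
    (i : Fin (D.codWord c).n) :
    (D.expose c e he hl).q (Word.inr X (D.codWord c) i) = D.codWire c i :=
  Word.elim_inr (fun i => (e i).1) (D.codWire c) i

/-- Every diagram is obtained from the one with all wires as outputs by selecting outputs. -/
theorem expose_comp_wiring_iso (e : Fin X.n → {w // w ∉ D.G.cod c})
    (he : Function.Surjective e) (hl : ∀ i, D.lab.onW (e i).1 = X.lab i)
    (g : Fin B.n → Fin (X.tensor (D.codWord c)).n)
    (hg : ∀ j, Word.elim (fun i => (e i).1) (D.codWire c) (g j) = D.q j)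
    (hg' : ∀ j, (X.tensor (D.codWord c)).lab (g j) = B.lab j) :
    ((D.expose c e he hl).comp (wiring g hg')).toDiagram.Iso D.toDiagram :=
  comp_wiring_iso g hg' (Equiv.refl _) (Equiv.refl _) (fun _ => (List.map_id _).symm)
    (fun _ => (List.map_id _).symm) (fun _ => rfl) (fun _ => rfl) (fun _ => rfl)
    fun j => (hg j).symm

/-- A diagram arises from the diagram without a sink by applying the sink to its inputs and
keeping all other wires. -/
theorem removeBox_comp_iso (hc : D.IsSink c) (e : Fin X.n → {w // w ∉ D.G.cod c})
    (he : Function.Bijective e) (hl : ∀ i, D.lab.onW (e i).1 = X.lab i) :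
    ((D.removeBox hc e he.surjective hl).comp
      ((FreeMarkov.id X).tensor (boxOf (D.lab.onB c) (D.cod_ne_nil c)))).toDiagram.Iso
      (D.expose c e he.surjective hl).toDiagram := by
  let b₀ := boxOf (D.lab.onB c) (D.cod_ne_nil c)
  let E := (FreeMarkov.id X).tensor b₀
  let iE : E.G.W → D.G.W := Sum.elim (fun i : Fin X.n => (e i).1)
    (Sum.elim (D.domWire c) (D.codWire c))
  have hpE : ∀ w : E.G.W, w ∉ Set.range E.p →
      ∃ i : Fin (D.codWord c).n, w = Sum.inr (Sum.inr i) := by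
    rintro (i | i | i) hw
    · exact (hw ⟨Word.inl X _ i, tensor_p_inl (FreeMarkov.id X) b₀ i⟩).elim
    · exact (hw ⟨Word.inr X _ i, tensor_p_inr (FreeMarkov.id X) b₀ i⟩).elim
    · exact ⟨i, rfl⟩
  have hpE' : ∀ i : Fin (D.codWord c).n, (Sum.inr (Sum.inr i) : E.G.W) ∉ Set.range E.p := by
    rintro i ⟨j, hj⟩
    revert hj
    revert j
    refine Word.tensor_cases (fun j hj => ?_) fun j hj => ?_
    · rw [tensor_p_inl] at hj; cases hj
    · rw [tensor_p_inr] at hj; cases hj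
  refine comp_iso (T := D.expose c e he.surjective hl) Subtype.val iE Subtype.val
    (Sum.elim Empty.elim fun _ => c) ?_ ⟨?_, ?_⟩ ⟨?_, ?_⟩ ?_ ?_ ?_ ?_ (fun _ => rfl) ?_
    (fun _ => rfl) ?_ (fun _ => rfl) ?_
  · refine Word.tensor_cases (fun i => ?_) fun i => ?_
    · exact (congrArg iE (tensor_p_inl (FreeMarkov.id X) b₀ i)).trans
        (congrArg Subtype.val (D.removeBox_q_inl hc e he.surjective hl i)).symm
    · exact (congrArg iE (tensor_p_inr (FreeMarkov.id X) b₀ i)).trans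
        (D.removeBox_q_inr hc e he.surjective hl i).symm
  · rintro (⟨w, hw⟩ | ⟨w, hw⟩) (⟨w', hw'⟩ | ⟨w', hw'⟩) h
    · exact congrArg _ (Subtype.ext h)
    · obtain ⟨i, rfl⟩ := hpE w' hw'
      exact (hw ((D.mem_cod_iff c).2 ⟨i, h.symm⟩)).elim
    · obtain ⟨i, rfl⟩ := hpE w hw
      exact (hw' ((D.mem_cod_iff c).2 ⟨i, h⟩)).elim
    · obtain ⟨i, rfl⟩ := hpE w hw
      obtain ⟨j, rfl⟩ := hpE w' hw'
      obtain rfl := D.codWire_injective c h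
      rfl
  · intro w
    by_cases hw : w ∈ D.G.cod c
    · obtain ⟨i, rfl⟩ := (D.mem_cod_iff c).1 hw
      exact ⟨.inr ⟨_, hpE' i⟩, rfl⟩
    · exact ⟨.inl ⟨w, hw⟩, rfl⟩
  · rintro (⟨b, hb⟩ | (⟨⟨⟩⟩ | b)) (⟨b', hb'⟩ | (⟨⟨⟩⟩ | b')) h
    · exact congrArg _ (Subtype.ext h)
    · exact (hb h).elim
    · exact (hb' h.symm).elim
    · rfl
  · intro b
    by_cases hb : b = c
    · exact ⟨.inr (.inr ()), hb.symm⟩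
    · exact ⟨.inl ⟨b, hb⟩, rfl⟩
  · exact fun b => (List.map_id _).symm.trans (map_eq_map_pmap _ _ _ _ fun _ => rfl)
  · rintro (b | b)
    · exact Empty.elim b
    · refine (D.ofFn_domWire c).symm.trans ?_
      refine Eq.trans ?_ (map_eq_map_map (List.ofFn Sum.inl) Sum.inr iE
        (Sum.elim (D.domWire c) (D.codWire c)) fun _ => rfl)
      rw [List.map_ofFn]
      rfl
  · exact fun b => (List.map_id _).symm.trans (map_eq_map_pmap _ _ _ _ fun _ => rfl)
  · rintro (b | b)
    · exact Empty.elim b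
    · refine (D.ofFn_codWire c).symm.trans ?_
      refine Eq.trans ?_ (map_eq_map_map (List.ofFn Sum.inr) Sum.inr iE
        (Sum.elim (D.domWire c) (D.codWire c)) fun _ => rfl)
      rw [List.map_ofFn]
      rfl
  · rintro (b | b)
    · exact Empty.elim b
    · rfl
  · rintro (w | w | w)
    · exact hl w
    · exact D.lab_domWire c w
    · exact D.lab_codWire c w
  · refine Word.tensor_cases (fun i => ?_) fun i => ?_
    · exact (D.expose_q_inl c e he.surjective hl i).trans
        (congrArg iE (tensor_q_inl (FreeMarkov.id X) b₀ i)).symm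
    · exact (D.expose_q_inr c e he.surjective hl i).trans
        (congrArg iE (tensor_q_inr (FreeMarkov.id X) b₀ i)).symm

end FreeMarkov

end RemoveBox

/-! ### Operations on joint density kernels -/

section Residual

open Classical in
/-- A point of a product is a point of the product over all indices but `c`, together with a
coordinate at `c`. -/
noncomputable def piSplitAt {ι : Type} (X : ι → Type u) [∀ i, MeasurableSpace (X i)] (c : ι) :
    (∀ i, X i) ≃ᵐ (∀ i : {i // i ≠ c}, X i.1) × X c where
  toFun m := (fun i => m i.1, m c)
  invFun x i := if h : i = c then cast (by rw [h]) x.2 else x.1 ⟨i, h⟩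
  left_inv m := by
    funext i
    by_cases h : i = c
    · subst h; simp
    · simp [h]
  right_inv x := by
    refine Prod.ext (funext fun i => ?_) ?_
    · simp [i.2]
    · simp
  measurable_toFun := by
    change Measurable fun m : ∀ i, X i => ((fun i : {i // i ≠ c} => m i.1), m c)
    fun_prop
  measurable_invFun := by
    change Measurable fun (x : (∀ i : {i // i ≠ c}, X i.1) × X c) (i : ι) =>
      if h : i = c then cast (by rw [h]) x.2 else x.1 ⟨i, h⟩
    refine measurable_pi_lambda _ fun i => ?_
    by_cases h : i = c
    · subst h
      simpa using measurable_snd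
    · simp only [h, dite_false]
      exact (measurable_pi_apply (X := fun i : {i // i ≠ c} => X i.1) ⟨i, h⟩).comp measurable_fst

theorem map_piSplitAt_symm {ι : Type} [Fintype ι] (X : ι → Type u) [∀ i, MeasurableSpace (X i)]
    (c : ι) [Fintype {i // i ≠ c}] (μ : ∀ i, Measure (X i)) [∀ i, SigmaFinite (μ i)] :
    ((Measure.pi fun i : {i // i ≠ c} => μ i.1).prod (μ c)).map (piSplitAt X c).symm =
      Measure.pi μ := by
  classical
  symm
  refine Measure.pi_eq fun s hs => ?_
  have : (piSplitAt X c).symm ⁻¹' (Set.univ.pi s) =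
      (Set.univ.pi fun i : {i // i ≠ c} => s i.1) ×ˢ s c := by
    ext x
    obtain ⟨m, rfl⟩ := (piSplitAt X c).surjective x
    rw [Set.mem_preimage, MeasurableEquiv.symm_apply_apply]
    change (∀ i, True → m i ∈ s i) ↔ (∀ i : {i // i ≠ c}, True → m i.1 ∈ s i.1) ∧ m c ∈ s c
    refine ⟨fun h => ⟨fun i _ => h i.1 trivial, h c trivial⟩, fun h i _ => ?_⟩
    by_cases hi : i = c
    · exact hi ▸ h.2
    · exact h.1 ⟨i, hi⟩ trivial
  rw [MeasurableEquiv.map_apply, this, Measure.prod_prod, Measure.pi_pi,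
    Fintype.prod_eq_mul_prod_subtype_ne _ c, mul_comm]
  congr!

variable {ι : Type} [Fintype ι] (P : ι → SbsPres.{u}) (c : ι) [Fintype {i // i ≠ c}]

/-- A residual indexed by a finite set consists of the residual indexed by all elements but `c` and
the one at `c`. -/
noncomputable def SbsPres.splitAt : (SbsPres.pi ι P).carrier ≃ᵐ
    ((SbsPres.pi {i // i ≠ c} fun i => P i.1).prod (P c)).carrier :=
  piSplitAt (fun i => (P i).carrier) c

theorem SbsPres.map_splitAt_symm_base :
    ((SbsPres.pi {i // i ≠ c} fun i => P i.1).prod (P c)).base.map (splitAt P c).symm =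
      (SbsPres.pi ι P).base :=
  map_piSplitAt_symm (fun i => (P i).carrier) c fun i => (P i).base

end Residual

namespace JointDensityKernel

variable {M : KernelCat.{u}} {P Q : SbsPres.{u}} {X Y Z V : Type u} [MeasurableSpace X]
  [MeasurableSpace Y] [MeasurableSpace Z] [MeasurableSpace V]

/-- The noise of a composite draws `m` from `f`, then `x` from the first mechanism at `m`, then `n`
from `g x`. By Tonelli, integrating out `x` before `n` exhibits its density. -/
theorem compF_eq_withDensity {R T : Type*} [MeasurableSpace R] [MeasurableSpace T]
    {μ : Measure R} {ν : Measure T} [SFinite μ] [SFinite ν] {k : Kernel (R × Z) X}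
    {f : Kernel Z R} {g : Kernel X T} [IsMarkovKernel k] [IsMarkovKernel f] [IsMarkovKernel g]
    {p : Z → R → ℝ≥0∞} {q : X → T → ℝ≥0∞} (hp : Measurable (Function.uncurry p))
    (hq : Measurable (Function.uncurry q)) (hf : ∀ z, f z = μ.withDensity (p z))
    (hg : ∀ x, g x = ν.withDensity (q x)) :
    Measurable (Function.uncurry
      fun z (m : R × T) => p z m.1 * ∫⁻ x, q x m.2 ∂k (m.1, z)) ∧
    ∀ z, compF k f g z =
      (μ.prod ν).withDensity fun m => p z m.1 * ∫⁻ x, q x m.2 ∂k (m.1, z) := by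
  have hI : Measurable fun w : Z × (R × T) => ∫⁻ x, q x w.2.2 ∂k (w.2.1, w.1) :=
    Measurable.lintegral_kernel_prod_right
      (κ := k.comap (fun w : Z × (R × T) => (w.2.1, w.1)) (by fun_prop))
      (f := fun w x => q x w.2.2)
      (hq.comp (measurable_snd.prodMk (measurable_snd.comp (measurable_snd.comp measurable_fst))))
  have hp' : Measurable fun w : Z × (R × T) => p w.1 w.2.1 :=
    hp.comp (measurable_fst.prodMk (measurable_fst.comp measurable_snd))
  refine ⟨hp'.mul hI, fun z => Measure.ext fun s hs => ?_⟩
  have hi : Measurable (s.indicator (1 : R × T → ℝ≥0∞)) := measurable_one.indicator hs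
  have hpz : Measurable (p z) := hp.comp measurable_prodMk_left
  have hD : Measurable fun m : R × T => p z m.1 * ∫⁻ x, q x m.2 ∂k (m.1, z) :=
    (hp'.mul hI).comp measurable_prodMk_left
  have hmean : Measurable fun m => ∫⁻ x, ∫⁻ n, s.indicator 1 (m, n) ∂g x ∂k (m, z) := by
    have h1 : Measurable fun w : R × X => ∫⁻ n, s.indicator 1 (w.1, n) ∂g w.2 :=
      Measurable.lintegral_kernel_prod_right (κ := g.comap Prod.snd measurable_snd)
        (f := fun (w : R × X) n => s.indicator (1 : R × T → ℝ≥0∞) (w.1, n))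
        (hi.comp (by fun_prop))
    exact Measurable.lintegral_kernel_prod_right
      (κ := k.comap (fun m => (m, z)) measurable_prodMk_right)
      (f := fun m x => ∫⁻ n, s.indicator 1 (m, n) ∂g x) h1
  rw [← lintegral_indicator_one hs, ← lintegral_indicator_one hs, lintegral_compF' _ _ _ _ hi,
    lintegral_withDensity_eq_lintegral_mul _ hD hi, lintegral_prod _ (hD.mul hi).aemeasurable,
    hf z, lintegral_withDensity_eq_lintegral_mul _ hpz hmean]
  refine lintegral_congr fun m => ?_
  have hs' : Measurable fun n => s.indicator (1 : R × T → ℝ≥0∞) (m, n) :=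
    hi.comp measurable_prodMk_left
  have hq₁ : ∀ x, Measurable (q x) := fun x => hq.comp measurable_prodMk_left
  have hq₂ : ∀ n, Measurable fun x => q x n := fun n => hq.comp measurable_prodMk_right
  have h1 : ∀ x, ∫⁻ n, s.indicator 1 (m, n) ∂g x = ∫⁻ n, q x n * s.indicator 1 (m, n) ∂ν := by
    intro x
    rw [hg x, lintegral_withDensity_eq_lintegral_mul _ (hq₁ x) hs']
    rfl
  have hq' : Measurable fun w : X × T =>
      q w.1 w.2 * s.indicator (1 : R × T → ℝ≥0∞) (m, w.2) :=
    hq.mul (hs'.comp measurable_snd)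
  simp only [Pi.mul_apply, h1]
  rw [lintegral_lintegral_swap hq'.aemeasurable,
    ← lintegral_const_mul _ hq'.lintegral_prod_left']
  refine lintegral_congr fun n => ?_
  dsimp only
  rw [lintegral_mul_const _ (hq₂ n), mul_assoc]

/-- The density of a sequential composite: the density of the first noise times the density of the
second, averaged over the output of the first mechanism. -/
theorem isDensity_comp {a : JointDensityKernel M P Z X} {b : JointDensityKernel M Q X Y}
    {p : Z → P.carrier → ℝ≥0∞} {q : X → Q.carrier → ℝ≥0∞} (hp : IsDensity P a.f p)
    (hq : IsDensity Q b.f q) :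
    IsDensity (P.prod Q) (a.comp b).f
      fun z (m : P.carrier × Q.carrier) => p z m.1 * ∫⁻ x, q x m.2 ∂a.k (m.1, z) :=
  compF_eq_withDensity hp.1 hq.1 hp.2 hq.2

/-- Postcomposing the mechanism with a deterministic function. -/
noncomputable def mapOutput (a : JointDensityKernel M P Z X) (g : X → Y) (hg : Measurable g)
    (hgM : M.Hom (Kernel.deterministic g hg)) : JointDensityKernel M P Z Y where
  k := a.k.map g
  f := a.f
  k_mem := by
    rw [← Kernel.deterministic_comp_eq_map hg]
    exact M.hom_comp a.k_mem hgM
  k_det := by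
    rw [← Kernel.deterministic_comp_eq_map hg]
    exact isDeterministic_comp a.k_det inferInstance
  f_mem := a.f_mem
  f_density := a.f_density

theorem denote_mapOutput (a : JointDensityKernel M P Z X) (g : X → Y) (hg : Measurable g)
    (hgM : M.Hom (Kernel.deterministic g hg)) :
    (a.mapOutput g hg hgM).denote = a.denote.map g :=
  (Kernel.map_comp _ _ _).symm

/-- Replacing the residual of a joint density kernel by an equivalent one. -/
noncomputable def transport (a : JointDensityKernel M Q Z X) (e : P.carrier ≃ᵐ Q.carrier)
    (he : Q.base.map e.symm = P.base) : JointDensityKernel M P Z X where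
  k := a.k.comap (fun x => (e x.1, x.2)) (by fun_prop)
  f := a.f.map e.symm
  k_mem := by
    have hP := M.obj_borel P.carrier
    have hZ := (M.hom_obj a.f_mem).1
    rw [← Kernel.comp_deterministic_eq_comap]
    exact M.hom_comp (KernelCat.hom_det_pair (KernelCat.hom_det_comp (M.hom_fst hP hZ)
      (M.hom_borel (Kernel.deterministic e e.measurable))) (M.hom_snd hP hZ)) a.k_mem
  k_det := by
    rw [← Kernel.comp_deterministic_eq_comap]
    exact isDeterministic_comp inferInstance a.k_det
  f_mem := by
    rw [← Kernel.deterministic_comp_eq_map e.symm.measurable]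
    exact M.hom_comp a.f_mem (M.hom_borel _)
  f_density := by
    refine ⟨Kernel.IsMarkovKernel.map _ e.symm.measurable, fun z => ?_⟩
    rw [Kernel.map_apply _ e.symm.measurable, ← he]
    exact (a.f_density.2 z).map e.symm.measurable

theorem denote_transport (a : JointDensityKernel M Q Z X) (e : P.carrier ≃ᵐ Q.carrier)
    (he : Q.base.map e.symm = P.base) : (a.transport e he).denote = a.denote := by
  refine Kernel.ext_fun fun z g hg => ?_
  have hk : ∀ m, (a.transport e he).k (m, z) = a.k (e m, z) := fun _ => rfl
  have hf : (a.transport e he).f z = (a.f z).map e.symm :=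
    Kernel.map_apply _ e.symm.measurable _
  rw [lintegral_denote _ _ hg, lintegral_denote _ _ hg, hf, lintegral_map_equiv]
  simp [hk]

theorem isDensity_transport {a : JointDensityKernel M Q Z X} {p : Z → Q.carrier → ℝ≥0∞}
    (hp : IsDensity Q a.f p) (e : P.carrier ≃ᵐ Q.carrier) (he : Q.base.map e.symm = P.base) :
    IsDensity P (a.transport e he).f fun z m => p z (e m) := by
  refine ⟨hp.1.comp (measurable_fst.prodMk (e.measurable.comp measurable_snd)), fun z => ?_⟩
  change a.f.map e.symm z = _
  have hpz : Measurable (p z) := hp.1.comp measurable_prodMk_left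
  refine Measure.ext fun s hs => ?_
  rw [Kernel.map_apply _ e.symm.measurable, MeasurableEquiv.map_apply, hp.2 z, ← he,
    withDensity_apply _ hs, withDensity_apply _ (e.symm.measurable hs),
    e.symm.restrict_map, lintegral_map_equiv]
  simp

/-- Applying a joint density kernel to a part `d x` of the input `x` and combining the result with
the input. -/
noncomputable def extend (a : JointDensityKernel M P Z Y) (d : X → Z) (hd : Measurable d)
    (hdM : M.Hom (Kernel.deterministic d hd)) (g : X × Y → V) (hg : Measurable g)
    (hgM : M.Hom (Kernel.deterministic g hg)) : JointDensityKernel M P X V where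
  k := Kernel.deterministic g hg ∘ₖ (Kernel.deterministic Prod.snd measurable_snd ×ₖ
    (a.k.comap (fun x : P.carrier × X => (x.1, d x.2)) (by fun_prop)))
  f := a.f.comap d hd
  k_mem := by
    have hP := M.obj_borel P.carrier
    have hX := (M.hom_obj hdM).1
    rw [← Kernel.comp_deterministic_eq_comap]
    exact M.hom_comp (KernelCat.hom_prod (M.hom_snd hP hX) (M.hom_comp
      (KernelCat.hom_det_pair (M.hom_fst hP hX) (KernelCat.hom_det_comp (M.hom_snd hP hX) hdM))
      a.k_mem)) hgM
  k_det := by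
    rw [← Kernel.comp_deterministic_eq_comap]
    exact isDeterministic_comp (isDeterministic_prod inferInstance
      (isDeterministic_comp inferInstance a.k_det)) inferInstance
  f_mem := by
    rw [← Kernel.comp_deterministic_eq_comap]
    exact M.hom_comp hdM a.f_mem
  f_density := ⟨inferInstance, fun x => a.f_density.2 (d x)⟩

section Extend

variable (a : JointDensityKernel M P Z Y) {d : X → Z} {hd : Measurable d}
  (hdM : M.Hom (Kernel.deterministic d hd)) {g : X × Y → V} {hg : Measurable g}
  (hgM : M.Hom (Kernel.deterministic g hg))

theorem lintegral_extend_k (m : P.carrier) (x : X) {h : V → ℝ≥0∞} (hh : Measurable h) :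
    ∫⁻ v, h v ∂(a.extend d hd hdM g hg hgM).k (m, x) =
      ∫⁻ y, h (g (x, y)) ∂a.k (m, d x) := by
  have hhg : Measurable fun w => h (g w) := hh.comp hg
  change ∫⁻ v, h v ∂(Kernel.deterministic g hg ∘ₖ (Kernel.deterministic Prod.snd measurable_snd ×ₖ
    (a.k.comap (fun x : P.carrier × X => (x.1, d x.2)) _))) (m, x) = _
  rw [Kernel.deterministic_comp_eq_map, Kernel.lintegral_map _ hg _ hh,
    Kernel.lintegral_prod _ _ _ hhg, Kernel.deterministic_apply,
    lintegral_dirac' _ (f := fun x' => ∫⁻ y, h (g (x', y)) ∂_) hhg.lintegral_prod_right']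
  rfl

theorem lintegral_extend_denote (x : X) {h : V → ℝ≥0∞} (hh : Measurable h) :
    ∫⁻ v, h v ∂(a.extend d hd hdM g hg hgM).denote x =
      ∫⁻ y, h (g (x, y)) ∂a.denote (d x) := by
  rw [lintegral_denote _ _ hh,
    lintegral_denote _ _ (g := fun y => h (g (x, y))) (hh.comp (hg.comp measurable_prodMk_left))]
  simp only [lintegral_extend_k _ _ _ _ _ hh]
  rfl

theorem isDensity_extend {p : Z → P.carrier → ℝ≥0∞} (hp : IsDensity P a.f p) :
    IsDensity P (a.extend d hd hdM g hg hgM).f fun x => p (d x) :=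
  ⟨hp.1.comp ((hd.comp measurable_fst).prodMk measurable_snd), fun x => hp.2 (d x)⟩

end Extend

end JointDensityKernel

/-! ### Values of all wires -/

section

open Diagram

variable {S : Hypergraph} {M : KernelCat.{u}} (obj : S.W → M.Ob) {A B X : Word S}

namespace Diagram

variable (D : Diagram S A B) (c : D.G.B)

/-- An assignment of values to the wires that are not outputs of the box `c`. -/
abbrev Rest : Type u := ∀ w : {w // w ∉ D.G.cod c}, (obj (D.lab.onW w.1)).carrier

open Classical in
/-- Extending an assignment of values to the outputs of the box `c`. -/
noncomputable def extendVal (x : D.Rest obj c × (wordOb obj (D.codWord c)).carrier) : D.Val obj :=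
  fun w => if h : ∃ i, D.codWire c i = w
    then tr obj ((D.lab_codWire c _).symm.trans (congrArg D.lab.onW h.choose_spec)) (x.2 h.choose)
    else x.1 ⟨w, fun h' => h ((D.mem_cod_iff c).1 h')⟩

variable {obj D c}

theorem extendVal_of_notMem (x : D.Rest obj c × (wordOb obj (D.codWord c)).carrier)
    (w : {w // w ∉ D.G.cod c}) : D.extendVal obj c x w.1 = x.1 w :=
  dif_neg fun h => w.2 ((D.mem_cod_iff c).2 h)

theorem reindex_extendVal {κ : Type} {l : κ → S.W} {g : κ → D.G.W}
    {g' : κ → {w // w ∉ D.G.cod c}} (h : ∀ j, (g' j).1 = g j) (hg : ∀ j, D.lab.onW (g j) = l j)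
    (hg' : ∀ j, D.lab.onW (g' j).1 = l j)
    (x : D.Rest obj c × (wordOb obj (D.codWord c)).carrier) :
    reindex obj D.lab.onW l g hg (D.extendVal obj c x) =
      reindex obj (fun w : {w // w ∉ D.G.cod c} => D.lab.onW w.1) l g' hg' x.1 := by
  funext j
  refine (tr_apply_eq obj (D.extendVal obj c x) (h j).symm _ (hg' j)).trans ?_
  exact congrArg _ (extendVal_of_notMem x (g' j))

variable (obj D c)

theorem measurable_extendVal_apply (w : D.G.W) :
    Measurable fun x : D.Rest obj c × (wordOb obj (D.codWord c)).carrier =>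
      D.extendVal obj c x w := by
  by_cases h : ∃ i, D.codWire c i = w
  · simp only [extendVal, h, dite_true]
    exact (measurable_tr obj _).comp ((measurable_pi_apply _).comp measurable_snd)
  · simp only [extendVal, h, dite_false]
    exact (measurable_pi_apply _).comp measurable_fst

theorem measurable_extendVal : Measurable (D.extendVal obj c) :=
  measurable_pi_lambda _ (D.measurable_extendVal_apply obj c)

theorem obj_rest : M.Obj (D.Rest obj c) := M.obj_pi fun _ => (obj _).obj

theorem hom_extendVal :
    M.Hom (Kernel.deterministic (D.extendVal obj c) (D.measurable_extendVal obj c)) := by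
  have h1 := D.obj_rest obj c
  have h2 := (wordOb obj (D.codWord c)).obj
  refine M.hom_tuple (D.measurable_extendVal_apply obj c) (M.obj_prod h1 h2) fun w => ?_
  by_cases h : ∃ i, D.codWire c i = w
  · have h3 := KernelCat.hom_det_comp (KernelCat.hom_det_comp (M.hom_snd h1 h2)
      (M.hom_eval (fun i => (obj ((D.codWord c).lab i)).obj) h.choose))
      (hom_tr obj ((D.lab_codWire c _).symm.trans (congrArg D.lab.onW h.choose_spec)))
    convert h3 using 2
    funext x
    exact dif_pos h
  · have h3 := KernelCat.hom_det_comp (M.hom_fst h1 h2)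
      (M.hom_eval (fun w : {w // w ∉ D.G.cod c} => (obj (D.lab.onW w.1)).obj)
        ⟨w, fun h' => h ((D.mem_cod_iff c).1 h')⟩)
    convert h3 using 2
    funext x
    exact dif_neg h

variable {c} in
/-- The values of the input wires of a sink. -/
def restDom (hc : D.IsSink c) (v : D.Rest obj c) : (wordOb obj (D.domWord c)).carrier :=
  reindex obj (fun w : {w // w ∉ D.G.cod c} => D.lab.onW w.1) (D.domWord c).lab
    (fun i => ⟨D.domWire c i, fun h => hc _ h c ((D.mem_dom_iff c).2 ⟨i, rfl⟩)⟩)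
    (D.lab_domWire c) v

variable {c} (hc : D.IsSink c)

theorem measurable_restDom : Measurable (D.restDom obj hc) := measurable_reindex obj _ _ _ _

theorem hom_restDom :
    M.Hom (Kernel.deterministic (D.restDom obj hc) (D.measurable_restDom obj hc)) :=
  hom_reindex obj _ _ _ _

theorem domVal_extendVal_self (x : D.Rest obj c × (wordOb obj (D.codWord c)).carrier) :
    D.domVal obj c (D.extendVal obj c x) = D.restDom obj hc x.1 :=
  reindex_extendVal (g := D.domWire c)
    (g' := fun i => ⟨D.domWire c i, fun h => hc _ h c ((D.mem_dom_iff c).2 ⟨i, rfl⟩)⟩)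
    (fun _ => rfl) _ (D.lab_domWire c) x

variable {P : S.B → SbsPres.{u}} {Z : Type u} [MeasurableSpace Z] [Fintype {b // b ≠ c}]
  (a : ∀ b, JointDensityKernel M (P b) (wordOb obj (.ofList (S.dom b))).carrier
    (wordOb obj (.ofList (S.cod b))).carrier)
  (a' : JointDensityKernel M (.pi {b // b ≠ c} fun b => P (D.lab.onB b.1)) Z (D.Rest obj c))

/-- The joint density kernel computing the values of all wires, obtained from the one for the
diagram without the sink `c` by sequentially composing it with the one for `c`. -/
noncomputable def addSink : JointDensityKernel M (D.residual P) Z (D.Val obj) :=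
  (a'.comp ((a (D.lab.onB c)).extend (D.restDom obj hc) (D.measurable_restDom obj hc)
    (D.hom_restDom obj hc) (D.extendVal obj c) (D.measurable_extendVal obj c)
    (D.hom_extendVal obj c))).transport
    (SbsPres.splitAt (fun b => P (D.lab.onB b)) c) (SbsPres.map_splitAt_symm_base _ c)

/-- The residuals of the boxes other than `c`. -/
def restRes (c : D.G.B) [Fintype {b // b ≠ c}] (m : (D.residual P).carrier) :
    (SbsPres.pi {b // b ≠ c} fun b => P (D.lab.onB b.1)).carrier :=
  fun b => SbsPres.proj _ b.1 m

theorem lintegral_addSink_k (m : (D.residual P).carrier) (z : Z) {h : D.Val obj → ℝ≥0∞}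
    (hh : Measurable h) :
    ∫⁻ v, h v ∂(D.addSink obj hc a a').k (m, z) =
      ∫⁻ v, ∫⁻ y, h (D.extendVal obj c (v, y))
        ∂(a (D.lab.onB c)).k (SbsPres.proj _ c m, D.restDom obj hc v)
        ∂a'.k (D.restRes c m, z) := by
  refine (lintegral_compK (R := (SbsPres.pi {b // b ≠ c} fun b => P (D.lab.onB b.1)).carrier)
    (S := (P (D.lab.onB c)).carrier) a'.k _
    (((D.restRes c m, SbsPres.proj _ c m) : _ × _), z) hh).trans ?_
  exact lintegral_congr fun v =>
    JointDensityKernel.lintegral_extend_k _ _ _ _ _ hh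

theorem lintegral_addSink_denote (z : Z) {h : D.Val obj → ℝ≥0∞} (hh : Measurable h) :
    ∫⁻ v, h v ∂(D.addSink obj hc a a').denote z =
      ∫⁻ v, ∫⁻ y, h (D.extendVal obj c (v, y)) ∂(a (D.lab.onB c)).denote (D.restDom obj hc v)
        ∂a'.denote z := by
  rw [addSink, JointDensityKernel.denote_transport, JointDensityKernel.denote_comp,
    Kernel.lintegral_comp _ _ _ hh]
  exact lintegral_congr fun v => JointDensityKernel.lintegral_extend_denote _ _ _ _ hh

theorem isDensity_addSink {p : (wordOb obj (D.domWord c)).carrier →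
      (P (D.lab.onB c)).carrier → ℝ≥0∞}
    {p' : Z → (SbsPres.pi {b // b ≠ c} fun b => P (D.lab.onB b.1)).carrier → ℝ≥0∞}
    (hp : IsDensity _ (a (D.lab.onB c)).f p) (hp' : IsDensity _ a'.f p') :
    IsDensity (D.residual P) (D.addSink obj hc a a').f fun z m => p' z (D.restRes c m) *
      ∫⁻ v, p (D.restDom obj hc v) (SbsPres.proj _ c m) ∂a'.k (D.restRes c m, z) :=
  JointDensityKernel.isDensity_transport
    (JointDensityKernel.isDensity_comp hp' (JointDensityKernel.isDensity_extend _ _ _ hp)) _ _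

/-- The values of the wires that are not outputs of the sink do not depend on the sink. -/
theorem lintegral_addSink_k_of_rest (m : (D.residual P).carrier) (z : Z) {T : Type*}
    [MeasurableSpace T] {r : D.Val obj → T} {r' : D.Rest obj c → T} (hr : Measurable r)
    (h : ∀ x, r (D.extendVal obj c x) = r' x.1) {g : T → ℝ≥0∞} (hg : Measurable g) :
    ∫⁻ v, g (r v) ∂(D.addSink obj hc a a').k (m, z) =
      ∫⁻ v, g (r' v) ∂a'.k (D.restRes c m, z) := by
  rw [lintegral_addSink_k (h := fun v => g (r v)) _ _ _ _ _ _ _ (hg.comp hr)]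
  refine lintegral_congr fun v => ?_
  simp [h]

theorem map_addSink_k_of_rest (m : (D.residual P).carrier) (z : Z) {T : Type*}
    [MeasurableSpace T] {r : D.Val obj → T} {r' : D.Rest obj c → T} (hr : Measurable r)
    (hr' : Measurable r') (h : ∀ x, r (D.extendVal obj c x) = r' x.1) :
    (D.addSink obj hc a a').k.map r (m, z) = a'.k.map r' (D.restRes c m, z) := by
  refine Measure.ext_of_lintegral _ fun g hg => ?_
  rw [Kernel.lintegral_map _ hr _ hg, Kernel.lintegral_map _ hr' _ hg]
  exact D.lintegral_addSink_k_of_rest obj hc a a' m z hr h hg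

end Diagram

namespace FreeMarkov

variable (D : FreeMarkov S A B) {c : D.G.B}

theorem codVal_extendVal_self (x : D.Rest obj c × (wordOb obj (D.codWord c)).carrier) :
    D.codVal obj c (D.extendVal obj c x) = x.2 := by
  funext i
  have h : ∃ j, D.codWire c j = D.codWire c i := ⟨i, rfl⟩
  have hi : h.choose = i := D.codWire_injective c h.choose_spec
  have h1 : D.extendVal obj c x (D.codWire c i) = _ := dif_pos h
  refine (congrArg (tr obj (D.lab_cod c i)) h1).trans ?_
  exact (tr_tr _ _ _ _).trans (tr_apply_eq obj x.2 hi _ rfl)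

section RemoveBox

variable (hc : D.IsSink c) (e : Fin X.n → {w // w ∉ D.G.cod c}) (he : Function.Surjective e)
  (hl : ∀ i, D.lab.onW (e i).1 = X.lab i)
  (x : D.Rest obj c × (wordOb obj (D.codWord c)).carrier)

theorem inputs_removeBox :
    D.inputs obj (D.extendVal obj c x) = (D.removeBox hc e he hl).inputs obj x.1 :=
  reindex_extendVal (g := D.p) (g' := fun i => ⟨D.p i, D.p_notMem_cod i c⟩)
    (fun _ => rfl) _ D.p_lab x

theorem domVal_removeBox (b : {b // b ≠ c}) :
    D.domVal obj b.1 (D.extendVal obj c x) = (D.removeBox hc e he hl).domVal obj b x.1 :=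
  reindex_extendVal (fun i => by simp [removeBox]; rfl) _ _ x

theorem codVal_removeBox (b : {b // b ≠ c}) :
    D.codVal obj b.1 (D.extendVal obj c x) = (D.removeBox hc e he hl).codVal obj b x.1 :=
  reindex_extendVal (fun i => by simp [removeBox]; rfl) _ _ x

end RemoveBox

end FreeMarkov

end

/-! ### Mechanism and density of a diagram with a sink -/

section

open Diagram

section Mechanism

variable {R Y Y' T V : Type*} [MeasurableSpace R] [MeasurableSpace Y] [MeasurableSpace Y']
  [MeasurableSpace T] [MeasurableSpace V] (k : Kernel (R × T) V) {f : Y → R} (hf : Measurable f)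
  (κ : Kernel Y T) [IsSFiniteKernel κ]

/-- Integration against the right-hand side of the equation for a box in
`Diagram.IsMechanism`. -/
theorem lintegral_comp_deterministic_prod (y : Y) {g : V → ℝ≥0∞} (hg : Measurable g) :
    ∫⁻ v, g v ∂(k ∘ₖ (Kernel.deterministic f hf ×ₖ κ)) y =
      ∫⁻ t, ∫⁻ v, g v ∂k (f y, t) ∂κ y := by
  rw [Kernel.lintegral_comp _ _ _ hg, Kernel.lintegral_prod _ _ _ hg.lintegral_kernel,
    Kernel.deterministic_apply,
    lintegral_dirac' _ (f := fun r => ∫⁻ t, ∫⁻ v, g v ∂k (r, t) ∂κ y)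
      hg.lintegral_kernel.lintegral_prod_right']

theorem comp_deterministic_prod_congr {f' : Y' → R} (hf' : Measurable f') (κ' : Kernel Y' T)
    (_ : IsSFiniteKernel κ') {y : Y} {y' : Y'} (h : f y = f' y') (hκ : κ y = κ' y') :
    (k ∘ₖ (Kernel.deterministic f hf ×ₖ κ)) y = (k ∘ₖ (Kernel.deterministic f' hf' ×ₖ κ')) y' := by
  refine Measure.ext_of_lintegral _ fun g hg => ?_
  rw [lintegral_comp_deterministic_prod _ _ _ _ hg, lintegral_comp_deterministic_prod _ _ _ _ hg,
    h, hκ]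

end Mechanism

namespace FreeMarkov

section Step

variable {S : Hypergraph} {M : KernelCat.{u}} (obj : S.W → M.Ob) {A B X : Word S}
  (D : FreeMarkov S A B) {c : D.G.B} (hc : D.IsSink c) (e : Fin X.n → {w // w ∉ D.G.cod c})
  (he : Function.Surjective e) (hl : ∀ i, D.lab.onW (e i).1 = X.lab i)

section Measures

variable {P : S.B → SbsPres.{u}}
  (a : ∀ b, JointDensityKernel M (P b) (wordOb obj (.ofList (S.dom b))).carrier
    (wordOb obj (.ofList (S.cod b))).carrier)
  (a' : JointDensityKernel M ((D.removeBox hc e he hl).residual P) (wordOb obj A).carrier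
    ((D.removeBox hc e he hl).Val obj))

/-- The joint density kernel for all wires of a diagram, from the one for the diagram without a
sink. -/
noncomputable def addSink : JointDensityKernel M (D.residual P) (wordOb obj A).carrier
    (D.Val obj) :=
  letI : Fintype {b // b ≠ c} := (D.removeBox hc e he hl).fintypeB
  Diagram.addSink obj D.toDiagram hc a a'

/-- Adding a sink preserves mechanisms: the equations for the inputs and for the other boxes concern
only wires that do not depend on the sink, and the equation for the sink holds by construction. -/
theorem isMechanism_addSink (h : (D.removeBox hc e he hl).IsMechanism obj P a a'.k) :
    D.IsMechanism obj P a (D.addSink obj hc e he hl a a').k where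
  mem := (D.addSink obj hc e he hl a a').k_mem
  det := (D.addSink obj hc e he hl a a').k_det
  inputs_eq := by
    let _ : Fintype {b // b ≠ c} := (D.removeBox hc e he hl).fintypeB
    ext ⟨m, z⟩ : 1
    refine (Diagram.map_addSink_k_of_rest obj D.toDiagram hc a a' m z (D.measurable_inputs obj)
      ((D.removeBox hc e he hl).measurable_inputs obj)
      (fun x => D.inputs_removeBox obj hc e he hl x)).trans ?_
    exact DFunLike.congr_fun h.inputs_eq (D.restRes c m, z)
  box_eq b := by
    let _ : Fintype {b // b ≠ c} := (D.removeBox hc e he hl).fintypeB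
    ext ⟨m, z⟩ : 1
    by_cases hb : b = c
    · subst hb
      refine Measure.ext_of_lintegral _ fun g hg => ?_
      have hdom := Diagram.map_addSink_k_of_rest obj D.toDiagram hc a a' m z
        (D.measurable_domVal obj b) (D.measurable_restDom obj hc)
        (fun x => D.domVal_extendVal_self obj hc x)
      rw [Kernel.lintegral_map _ (D.measurable_codVal obj b) _ hg]
      refine (Diagram.lintegral_addSink_k obj D.toDiagram hc a a' m z
        (h := fun v => g (D.codVal obj b v)) (hg.comp (D.measurable_codVal obj b))).trans ?_
      simp only [codVal_extendVal_self]
      refine Eq.trans ?_ (lintegral_comp_deterministic_prod _ _ _ _ hg).symm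
      rw [show (D.addSink obj hc e he hl a a').k.map (D.domVal obj b) (m, z) = _ from hdom,
        Kernel.lintegral_map _ (D.measurable_restDom obj hc) _ (by fun_prop)]
    · refine (Diagram.map_addSink_k_of_rest obj D.toDiagram hc a a' m z (D.measurable_codVal obj b)
        ((D.removeBox hc e he hl).measurable_codVal obj ⟨b, hb⟩)
        (fun x => D.codVal_removeBox obj hc e he hl x ⟨b, hb⟩)).trans ?_
      have hdom := Diagram.map_addSink_k_of_rest obj D.toDiagram hc a a' m z
        (D.measurable_domVal obj b) ((D.removeBox hc e he hl).measurable_domVal obj ⟨b, hb⟩)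
        (fun x => D.domVal_removeBox obj hc e he hl x ⟨b, hb⟩)
      have h' := DFunLike.congr_fun (h.box_eq ⟨b, hb⟩) (D.restRes c m, z)
      have hs : IsSFiniteKernel (a'.k.map ((D.removeBox hc e he hl).domVal obj
        (show (D.removeBox hc e he hl).G.B from ⟨b, hb⟩))) := inferInstance
      refine h'.trans (Eq.symm ?_)
      exact comp_deterministic_prod_congr (a (D.lab.onB b)).k _
        ((D.addSink obj hc e he hl a a').k.map (D.domVal obj b)) _ _
        hs rfl hdom

/-- The product density of a diagram with a sink splits off the factor of the sink; the other
factors, and the input wires of the sink, do not depend on the residual of the sink. -/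
theorem productDensity_addSink
    {p : ∀ b, (wordOb obj (.ofList (S.dom b))).carrier → (P b).carrier → ℝ≥0∞}
    (hp : ∀ b, IsDensity (P b) (a b).f (p b)) (z : (wordOb obj A).carrier)
    (m : (D.residual P).carrier) :
    letI : Fintype {b // b ≠ c} := (D.removeBox hc e he hl).fintypeB
    D.productDensity obj P p (D.addSink obj hc e he hl a a').k z m =
      (D.removeBox hc e he hl).productDensity obj P p a'.k z (D.restRes c m) *
        ∫⁻ v, p _ (D.restDom obj hc v) (SbsPres.proj _ c m) ∂a'.k (D.restRes c m, z) := by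
  classical
  let _ : Fintype {b // b ≠ c} := (D.removeBox hc e he hl).fintypeB
  have hpm : ∀ b x, Measurable fun y => p b y x := fun b x =>
    (hp b).1.comp measurable_prodMk_right
  unfold Diagram.productDensity
  rw [Fintype.prod_eq_mul_prod_subtype_ne _ c, mul_comm]
  refine congrArg₂ (· * ·) ?_ ?_
  · refine Fintype.prod_equiv (Equiv.refl {b // b ≠ c}) _ _ fun b => ?_
    exact Diagram.lintegral_addSink_k_of_rest obj D.toDiagram hc a a' m z
      (D.measurable_domVal obj b.1) (fun x => D.domVal_removeBox obj hc e he hl x b)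
      (hpm _ (SbsPres.proj _ b.1 m))
  · exact Diagram.lintegral_addSink_k_of_rest obj D.toDiagram hc a a' m z
      (D.measurable_domVal obj c) (fun x => D.domVal_extendVal_self obj hc x)
      (hpm _ (SbsPres.proj _ c m))

theorem isDensity_addSink
    {p : ∀ b, (wordOb obj (.ofList (S.dom b))).carrier → (P b).carrier → ℝ≥0∞}
    (hp : ∀ b, IsDensity (P b) (a b).f (p b))
    (h : IsDensity _ a'.f ((D.removeBox hc e he hl).productDensity obj P p a'.k)) :
    IsDensity (D.residual P) (D.addSink obj hc e he hl a a').f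
      (D.productDensity obj P p (D.addSink obj hc e he hl a a').k) := by
  let _ : Fintype {b // b ≠ c} := (D.removeBox hc e he hl).fintypeB
  have h1 := Diagram.isDensity_addSink obj D.toDiagram hc a a' (hp _) h
  have h2 : D.productDensity obj P p (D.addSink obj hc e he hl a a').k = _ :=
    funext fun z => funext fun m => D.productDensity_addSink obj hc e he hl a a' hp z m
  rw [h2]
  exact h1

end Measures

end Step

end FreeMarkov

end

/-! ### The image of a diagram under a strict Markov functor -/

section

open Diagram

namespace FreeMarkov

variable {S : Hypergraph} {M : KernelCat.{u}} (obj : S.W → M.Ob) {A B X : Word S}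
  (D : FreeMarkov S A B) {c : D.G.B} (hc : D.IsSink c) (e : Fin X.n → {w // w ∉ D.G.cod c})
  (he : Function.Surjective e) (hl : ∀ i, D.lab.onW (e i).1 = X.lab i)

/-- The values of the wires that are not outputs of a sink, as a tuple indexed by a word. -/
def restWord (v : D.Rest obj c) : (wordOb obj X).carrier :=
  reindex obj (fun w : {w // w ∉ D.G.cod c} => D.lab.onW w.1) X.lab e hl v

theorem splitFun_outputs_removeBox (v : (D.removeBox hc e he hl).Val obj) :
    splitFun obj X (D.domWord c) ((D.removeBox hc e he hl).outputs obj v) =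
      (D.restWord obj e hl v, D.restDom obj hc v) := by
  refine Prod.ext ?_ ?_
  · refine (reindex_reindex _ _ _ _ (Word.lab_inl _ _) _).trans ?_
    exact reindex_congr obj (fun j => D.removeBox_q_inl hc e he hl j) _ hl v
  · refine (reindex_reindex _ _ _ _ (Word.lab_inr _ _) _).trans ?_
    exact reindex_congr obj (fun j => Subtype.ext (D.removeBox_q_inr hc e he hl j)) _
      (D.lab_domWire c) v

theorem splitFun_outputs_expose
    (x : D.Rest obj c × (wordOb obj (D.codWord c)).carrier) :
    splitFun obj X (D.codWord c) ((D.expose c e he hl).outputs obj (D.extendVal obj c x)) =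
      (D.restWord obj e hl x.1, x.2) := by
  refine Prod.ext ?_ ?_
  · refine (reindex_reindex _ _ _ _ (Word.lab_inl _ _) _).trans ?_
    exact reindex_extendVal (fun j => (D.expose_q_inl c e he hl j).symm) _ hl x
  · refine (reindex_reindex _ _ _ _ (Word.lab_inr _ _) _).trans
      (Eq.trans ?_ (D.codVal_extendVal_self obj x))
    exact reindex_congr obj (fun j => D.expose_q_inr c e he hl j) _ _ _

section NoBox

variable [IsEmpty D.G.B]

theorem p_bijective : Function.Bijective D.p :=
  ⟨D.p_injective, fun w => (D.exists_start w).resolve_right fun ⟨b, _⟩ => isEmptyElim b⟩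

variable {P : S.B → SbsPres.{u}}

/-- The only point of an empty product. -/
def emptyResidual : (D.residual P).carrier := fun b => isEmptyElim b

theorem base_residual_of_isEmpty :
    (D.residual P).base = Measure.dirac (D.emptyResidual) :=
  Measure.pi_of_empty (fun b => (P (D.lab.onB b)).base) _

end NoBox

end FreeMarkov

namespace StrictMarkovFunctor

variable {S : Hypergraph} {M : KernelCat.{u}} (F : StrictMarkovFunctor S M) {A B X : Word S}

/-- Applying `id ⊗ ⟨b⟩` to `(x, y)` leaves `x` unchanged. -/
theorem lintegral_kernel_id_tensor {C E : Word S} (T : FreeMarkov S C E)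
    (w : (wordOb F.obj (X.tensor C)).carrier)
    {g : (wordOb F.obj X).carrier × (wordOb F.obj E).carrier → ℝ≥0∞} (hg : Measurable g) :
    ∫⁻ v, g (splitFun F.obj X E v) ∂F.kernel ((FreeMarkov.id X).tensor T) w =
      ∫⁻ y, g ((splitFun F.obj X C w).1, y) ∂F.kernel T (splitFun F.obj X C w).2 := by
  rw [← Kernel.lintegral_map _ (measurable_splitFun _ _ _) _ hg, kernel_tensor, kernel_id,
    Kernel.comap_apply, Kernel.parallelComp_apply, Kernel.id_apply, Measure.dirac_prod,
    lintegral_map hg measurable_prodMk_left]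

variable {P : S.B → SbsPres.{u}}
  (a : ∀ b, JointDensityKernel M (P b) (wordOb F.obj (.ofList (S.dom b))).carrier
    (wordOb F.obj (.ofList (S.cod b))).carrier)

theorem kernel_boxOf (ha : ∀ b, DJoint.mk (a b) = F.map (FreeMarkov.box b)) (b : S.B)
    (hb : S.cod b ≠ []) : F.kernel (FreeMarkov.boxOf b hb) = (a b).denote :=
  (F.kernel_iso (FreeMarkov.box_iso b hb)).symm.trans (congrArg DJoint.kernel (ha b)).symm

/-- The image of a diagram with all wires as outputs, given the joint density kernel of the diagram
without a sink: both sides draw the values `v` of the remaining wires and then the outputs of the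
sink from its kernel at the values of its inputs. -/
theorem kernel_expose (ha : ∀ b, DJoint.mk (a b) = F.map (FreeMarkov.box b))
    (D : FreeMarkov S A B) {c : D.G.B} (hc : D.IsSink c)
    (e : Fin X.n → {w // w ∉ D.G.cod c}) (he : Function.Bijective e)
    (hl : ∀ i, D.lab.onW (e i).1 = X.lab i)
    (a' : JointDensityKernel M ((D.removeBox hc e he.surjective hl).residual P)
      (wordOb F.obj A).carrier ((D.removeBox hc e he.surjective hl).Val F.obj))
    (h : F.kernel (D.removeBox hc e he.surjective hl) =
      a'.denote.map ((D.removeBox hc e he.surjective hl).outputs F.obj)) :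
    F.kernel (D.expose c e he.surjective hl) =
      (D.addSink F.obj hc e he.surjective hl a a').denote.map
        ((D.expose c e he.surjective hl).outputs F.obj) := by
  have hout' := (D.removeBox hc e he.surjective hl).measurable_outputs F.obj
  have hout := (D.expose c e he.surjective hl).measurable_outputs F.obj
  refine Kernel.ext_fun fun z g hg => ?_
  -- Values at the outputs are compared as pairs, by writing `g` as a function of `splitFun`.
  have hgj := hg.comp (measurable_joinFun F.obj X (D.codWord c))
  have hgs : ∀ v, g v = g (joinFun F.obj X (D.codWord c) (splitFun F.obj X (D.codWord c) v)) :=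
    fun v => congrArg g (joinFun_splitFun F.obj X (D.codWord c) v).symm
  rw [← F.kernel_iso (D.removeBox_comp_iso hc e he hl), kernel_comp, h,
    Kernel.lintegral_comp _ _ _ hg, Kernel.lintegral_map _ hout' _ hg.lintegral_kernel]
  refine Eq.trans ?_ (Kernel.lintegral_map (D.addSink F.obj hc e he.surjective hl a a').denote
    hout z hg).symm
  let _ : Fintype {b // b ≠ c} := (D.removeBox hc e he.surjective hl).fintypeB
  refine Eq.trans ?_ (Diagram.lintegral_addSink_denote F.obj D.toDiagram hc a a' z
    (h := fun v => g ((D.expose c e he.surjective hl).outputs F.obj v)) (hg.comp hout)).symm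
  refine lintegral_congr fun v => ?_
  rw [lintegral_congr hgs]
  refine (F.lintegral_kernel_id_tensor _ _ hgj).trans ?_
  rw [D.splitFun_outputs_removeBox, F.kernel_boxOf a ha]
  refine lintegral_congr fun y => ?_
  rw [hgs, D.splitFun_outputs_expose]
  rfl

/-- The image of a diagram with a sink, given the joint density kernel of the diagram without the
sink: the outputs are selected from the diagram with all wires as outputs. -/
theorem kernel_addSink (ha : ∀ b, DJoint.mk (a b) = F.map (FreeMarkov.box b))
    (D : FreeMarkov S A B) {c : D.G.B} (hc : D.IsSink c)
    (e : Fin X.n → {w // w ∉ D.G.cod c}) (he : Function.Bijective e)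
    (hl : ∀ i, D.lab.onW (e i).1 = X.lab i)
    (a' : JointDensityKernel M ((D.removeBox hc e he.surjective hl).residual P)
      (wordOb F.obj A).carrier ((D.removeBox hc e he.surjective hl).Val F.obj))
    (h : F.kernel (D.removeBox hc e he.surjective hl) =
      a'.denote.map ((D.removeBox hc e he.surjective hl).outputs F.obj)) :
    F.kernel D = (D.addSink F.obj hc e he.surjective hl a a').denote.map (D.outputs F.obj) := by
  have hout := (D.expose c e he.surjective hl).measurable_outputs F.obj
  choose g hg using fun j => D.exists_elim_eq c he.surjective (D.q j)
  have hg' : ∀ j, (X.tensor (D.codWord c)).lab (g j) = B.lab j := fun j =>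
    ((D.expose c e he.surjective hl).q_lab (g j)).symm.trans
      ((congrArg D.lab.onW (hg j)).trans (D.q_lab j))
  rw [← F.kernel_iso (D.expose_comp_wiring_iso e he.surjective hl g hg hg'), kernel_comp,
    F.kernel_expose a ha D hc e he hl a' h, kernel_wiring,
    Kernel.deterministic_comp_eq_map (measurable_wordMap _ _ _)]
  refine (Kernel.map_comp_right _ hout (measurable_wordMap _ _ _)).symm.trans ?_
  congr 1
  funext v
  exact (reindex_reindex _ _ _ _ hg' _).trans (reindex_congr F.obj hg _ D.q_lab v)

section NoBox

variable (D : FreeMarkov S A B) [IsEmpty D.G.B]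

/-- In a diagram without boxes, every wire carries an input. -/
noncomputable def valOfInputs (z : (wordOb F.obj A).carrier) : D.Val F.obj :=
  reindex F.obj A.lab D.lab.onW (Equiv.ofBijective D.p D.p_bijective).symm
    (fun w => (D.p_lab _).symm.trans
      (congrArg D.lab.onW ((Equiv.ofBijective D.p D.p_bijective).apply_symm_apply w))) z

theorem measurable_valOfInputs : Measurable (F.valOfInputs D) := measurable_reindex _ _ _ _ _

theorem inputs_valOfInputs (z : (wordOb F.obj A).carrier) :
    D.inputs F.obj (F.valOfInputs D z) = z := by
  refine (reindex_reindex _ _ _ _ _ _).trans (funext fun j => ?_)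
  exact tr_apply_eq F.obj z ((Equiv.ofBijective D.p D.p_bijective).symm_apply_apply j) _ rfl

/-- A diagram without boxes is isomorphic to a wiring, as its wires are in bijection with its
inputs. -/
theorem kernel_of_isEmpty : F.kernel D = Kernel.deterministic
    (fun z => D.outputs F.obj (F.valOfInputs D z))
    ((D.measurable_outputs F.obj).comp (F.measurable_valOfInputs D)) := by
  let eW := Equiv.ofBijective D.p D.p_bijective
  have hg : ∀ j, A.lab (eW.symm (D.q j)) = B.lab j := fun j =>
    (D.p_lab _).symm.trans ((congrArg D.lab.onW (eW.apply_symm_apply _)).trans (D.q_lab j))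
  have hiso : D.toDiagram.Iso (FreeMarkov.wiring (fun j => eW.symm (D.q j)) hg).toDiagram :=
    ⟨eW.symm, Equiv.equivOfIsEmpty _ Empty, isEmptyElim, isEmptyElim,
      fun w => (D.p_lab _).symm.trans (congrArg D.lab.onW (eW.apply_symm_apply w)), isEmptyElim,
      fun i => (eW.symm_apply_apply i).symm, fun _ => rfl⟩
  rw [F.kernel_iso hiso, kernel_wiring]
  congr 1
  funext z
  exact (reindex_reindex _ _ _ _ _ _).symm

theorem hom_emptyResidual : M.Hom (Kernel.deterministic
    (fun _ : (wordOb F.obj A).carrier => D.emptyResidual (P := P)) measurable_const) :=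
  M.hom_tuple (X := fun b => (P (D.lab.onB b)).carrier)
    (g := fun b (_ : (wordOb F.obj A).carrier) => isEmptyElim b)
    (fun _ => measurable_const) (wordOb F.obj A).obj fun b => isEmptyElim b

/-- The joint density kernel computing the values of all wires of a diagram without boxes. -/
noncomputable def jointOfIsEmpty :
    JointDensityKernel M (D.residual P) (wordOb F.obj A).carrier (D.Val F.obj) where
  k := Kernel.deterministic (fun x => F.valOfInputs D x.2)
    ((F.measurable_valOfInputs D).comp measurable_snd)
  f := Kernel.deterministic (fun _ => D.emptyResidual) measurable_const
  k_mem := KernelCat.hom_det_comp (M.hom_snd (M.obj_borel _) (wordOb F.obj A).obj)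
    (hom_reindex F.obj _ _ _ _)
  k_det := isDeterministic_det _
  f_mem := F.hom_emptyResidual D
  f_density := by
    refine ⟨Kernel.isMarkovKernel_deterministic _, fun z => ?_⟩
    rw [Kernel.deterministic_apply, D.base_residual_of_isEmpty]

theorem denote_jointOfIsEmpty : (F.jointOfIsEmpty (P := P) D).denote =
    Kernel.deterministic (F.valOfInputs D) (F.measurable_valOfInputs D) := by
  refine Kernel.ext_fun fun z g hg => ?_
  have hk : ∀ m, (F.jointOfIsEmpty (P := P) D).k (m, z) = Measure.dirac (F.valOfInputs D z) :=
    fun m => Kernel.deterministic_apply ((F.measurable_valOfInputs D).comp measurable_snd) _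
  have hf : (F.jointOfIsEmpty (P := P) D).f z = Measure.dirac (D.emptyResidual) :=
    Kernel.deterministic_apply measurable_const _
  simp only [JointDensityKernel.lintegral_denote _ _ hg, hk, hf, Kernel.deterministic_apply,
    lintegral_dirac' _ hg, lintegral_const, measure_univ, mul_one]

end NoBox

/-- Every diagram has a joint mechanism and a noise with the product density, which together
compute the values of all wires: by induction on the number of boxes, removing a sink. -/
theorem exists_joint (ha : ∀ b, DJoint.mk (a b) = F.map (FreeMarkov.box b))
    {p : ∀ b, (wordOb F.obj (.ofList (S.dom b))).carrier →
      (P b).carrier → ℝ≥0∞} (hp : ∀ b, IsDensity (P b) (a b).f (p b)) (D : FreeMarkov S A B) :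
    ∃ t : JointDensityKernel M (D.residual P) (wordOb F.obj A).carrier (D.Val F.obj),
      D.IsMechanism F.obj P a t.k ∧
      IsDensity (D.residual P) t.f (D.productDensity F.obj P p t.k) ∧
      F.kernel D = t.denote.map (D.outputs F.obj) := by
  induction hn : Nat.card D.G.B using Nat.strong_induction_on generalizing B with
  | _ n ih =>
    subst hn
    rcases isEmpty_or_nonempty D.G.B with hB | hB
    · refine ⟨F.jointOfIsEmpty D, ?_, ?_, ?_⟩
      · refine ⟨(F.jointOfIsEmpty D).k_mem, (F.jointOfIsEmpty D).k_det, ?_, isEmptyElim⟩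
        change (Kernel.deterministic _
          ((F.measurable_valOfInputs D).comp measurable_snd)).map _ = _
        rw [← Kernel.deterministic_comp_eq_map (D.measurable_inputs F.obj),
          Kernel.deterministic_comp_deterministic]
        congr 1
        funext x
        exact F.inputs_valOfInputs D x.2
      · have h1 : D.productDensity F.obj P p (F.jointOfIsEmpty D).k = fun _ _ => 1 := by
          funext z m
          simp [productDensity]
        rw [h1]
        refine ⟨measurable_const, fun z => ?_⟩
        rw [D.base_residual_of_isEmpty]
        exact (Kernel.deterministic_apply measurable_const _).trans withDensity_one.symm
      · rw [denote_jointOfIsEmpty, kernel_of_isEmpty,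
          ← Kernel.deterministic_comp_eq_map (D.measurable_outputs F.obj),
          Kernel.deterministic_comp_deterministic]
        rfl
    · obtain ⟨c, hc⟩ := D.exists_isSink D.acyclic
      obtain ⟨n, ⟨e⟩⟩ := Finite.exists_equiv_fin {w // w ∉ D.G.cod c}
      let X : Word S := ⟨n, fun i => D.lab.onW (e.symm i).1⟩
      have he : Function.Bijective (e.symm : Fin X.n → _) := e.symm.bijective
      obtain ⟨t, h1, h2, h3⟩ := ih _ (Finite.card_subtype_lt (p := fun b => b ≠ c) (x := c)
        (by simp)) (D.removeBox (X := X) hc e.symm he.surjective fun _ => rfl) rfl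
      exact ⟨D.addSink F.obj hc _ he.surjective _ a t,
        D.isMechanism_addSink F.obj hc _ he.surjective _ a t h1,
        D.isDensity_addSink F.obj hc _ he.surjective _ a t hp h2,
        F.kernel_addSink a ha D hc _ he _ t h3⟩

end StrictMarkovFunctor

end

end JointDensity

open JointDensity
theorem mainTheorem4 (S : Hypergraph) [Finite S.W] [Finite S.B] (M : KernelCat.{u})
    (F : StrictMarkovFunctor S M) :
    (∀ (A B : Word S) (φ : FreeMarkov S A B), φ.IsCausalModel →
      ∀ (P : SbsPres.{u})
        (t : JointDensityKernel M P (wordOb F.obj A).carrier (wordOb F.obj B).carrier),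
        DJoint.mk t = F.map φ → ∃ p, IsDensity P t.f p) ∧
    ∀ (P : S.B → SbsPres.{u})
      (a : ∀ b, JointDensityKernel M (P b) (wordOb F.obj (.ofList (S.dom b))).carrier
        (wordOb F.obj (.ofList (S.cod b))).carrier),
      (∀ b, DJoint.mk (a b) = F.map (FreeMarkov.box b)) →
      (∀ b, ∃ p, IsDensity (P b) (a b).f p) ∧
      ∀ p : ∀ b, (wordOb F.obj (.ofList (S.dom b))).carrier → (P b).carrier → ℝ≥0∞,
        (∀ b, IsDensity (P b) (a b).f (p b)) →
        ∀ (A B : Word S) (φ : FreeMarkov S A B), φ.IsCausalModel →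
          ∃ (K : Kernel ((φ.residual P).carrier × (wordOb F.obj A).carrier) (φ.Val F.obj))
            (t : JointDensityKernel M (φ.residual P) (wordOb F.obj A).carrier
              (wordOb F.obj B).carrier),
            φ.IsMechanism F.obj P a K ∧
            DJoint.mk t = F.map φ ∧
            t.k = K.map (φ.outputs F.obj) ∧
            IsDensity (φ.residual P) t.f (φ.productDensity F.obj P p K) := by
  refine ⟨fun A B φ _ P t _ => exists_isDensity t.f_density, fun P a ha =>
    ⟨fun b => exists_isDensity (a b).f_density, fun p hp A B φ _ => ?_⟩⟩
  obtain ⟨t, h1, h2, h3⟩ := F.exists_joint a ha hp φ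
  have ho := φ.measurable_outputs F.obj
  have hM : M.Hom (Kernel.deterministic (φ.outputs F.obj) ho) := hom_reindex F.obj _ _ _ _
  refine ⟨t.k, t.mapOutput _ ho hM, h1, ?_, rfl, h2⟩
  exact DJoint.kernel_injective ((t.denote_mapOutput _ ho hM).trans h3.symm)
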